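/- Let $G$ be a finite directed acyclic graph (without multiple edges). Then $G$ has an upward planar drawing if and only if it has a visibility representation in which every edge is a vertical segment, with the head above the tail. Here all drawings are planar: no two elements (vertices, edges) of the drawing intersect unless the corresponding elements of the graph do, i.e. different vertices are drawn disjointly, no edge meets a vertex other than its two ends, and two different edges meet only at common ends (in the point or box of a common end vertex). All coordinates of vertex points, box corners and attachment points of edges are integers. An upward planar drawing of $G$ is a planar straight-line drawing (every vertex is a point with integer coordinates and every edge is the straight-line segment between the points of its ends) in which, for every directed edge $v\to w$, the $y$-coordinate of $v$ is smaller than the $y$-coordinate of $w$. A visibility representation of $G$ is a planar drawing in which every vertex is a closed axis-aligned box with integer corners (possibly degenerated to a segment or a point) and every edge $v\to w$ is a single horizontal or vertical segment that joins an integer point of the box of $v$ to an integer point of the box of $w$ and touches these two boxes only there. The head of an edge is above its tail if the box of the head lies strictly above the box of the tail. -/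

import Mathlib

namespace GraphDrawing

/-- A directed graph is acyclic if no vertex lies on a directed closed walk of positive length. -/
def IsDAG {V : Type*} (G : Digraph V) : Prop :=
  ∀ v : V, ¬ Relation.TransGen G.Adj v v

/-- The point of the real plane with the given integer coordinates. -/
def toPlane (p : ℤ × ℤ) : ℝ × ℝ := ((p.1 : ℝ), (p.2 : ℝ))

/-- The closed straight-line segment between two grid points. -/
def lineSegment (p q : ℤ × ℤ) : Set (ℝ × ℝ) := segment ℝ (toPlane p) (toPlane q)

/-- The planarity condition for a drawing in which the vertex `v` occupies the set `vert v` (a point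
or a box) and the edge `u → v` occupies the set `edge u v`: no two elements of the drawing
intersect unless the corresponding elements of the graph do. That is, vertices are disjoint, an
edge meets no vertex other than its two ends, and two different edges meet only at common ends. -/
structure PlanarElements {V : Type*} (G : Digraph V) (vert : V → Set (ℝ × ℝ))
    (edge : V → V → Set (ℝ × ℝ)) : Prop where
  vertex_vertex : ∀ v w : V, v ≠ w → Disjoint (vert v) (vert w)
  edge_vertex : ∀ u v w : V, G.Adj u v → w ≠ u → w ≠ v → Disjoint (edge u v) (vert w)
  edge_edge : ∀ u v u' v' : V, G.Adj u v → G.Adj u' v' → (u, v) ≠ (u', v') →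
    edge u v ∩ edge u' v' ⊆ ⋃ w ∈ ({u, v} ∩ {u', v'} : Set V), vert w

/-- A planar straight-line drawing: vertices are grid points and the edge `u → v` is the
straight-line segment between the points of `u` and `v`. -/
structure StraightLineDrawing {V : Type*} (G : Digraph V) where
  pos : V → ℤ × ℤ
  planar : PlanarElements G (fun v => {toPlane (pos v)})
    (fun u v => lineSegment (pos u) (pos v))

/-- The tail of every edge has smaller `y`-coordinate than its head. -/
def StraightLineDrawing.IsUpward {V : Type*} {G : Digraph V} (D : StraightLineDrawing G) : Prop :=
  ∀ u v : V, G.Adj u v → (D.pos u).2 < (D.pos v).2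

/-- An axis-aligned box with integer corners; it may degenerate to a segment or to a point. -/
structure Box where
  left : ℤ
  right : ℤ
  bottom : ℤ
  top : ℤ
  left_le_right : left ≤ right
  bottom_le_top : bottom ≤ top

/-- The closed region of the plane covered by a box. -/
def Box.toSet (B : Box) : Set (ℝ × ℝ) :=
  Set.Icc (B.left : ℝ) (B.right : ℝ) ×ˢ Set.Icc (B.bottom : ℝ) (B.top : ℝ)

/-- A (planar) visibility representation: vertices are boxes, and the edge `u → v` is a single
horizontal or vertical segment which runs from a grid point `tailPt u v` on the box of `u` to a
grid point `headPt u v` on the box of `v` and touches these two boxes only there. The values of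
`tailPt` and `headPt` matter only at edges. -/
structure VisibilityRepresentation {V : Type*} (G : Digraph V) where
  box : V → Box
  tailPt : V → V → ℤ × ℤ
  headPt : V → V → ℤ × ℤ
  axis_parallel : ∀ u v : V, G.Adj u v →
    (tailPt u v).1 = (headPt u v).1 ∨ (tailPt u v).2 = (headPt u v).2
  attach_tail : ∀ u v : V, G.Adj u v →
    lineSegment (tailPt u v) (headPt u v) ∩ (box u).toSet = {toPlane (tailPt u v)}
  attach_head : ∀ u v : V, G.Adj u v →
    lineSegment (tailPt u v) (headPt u v) ∩ (box v).toSet = {toPlane (headPt u v)}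
  planar : PlanarElements G (fun v => (box v).toSet)
    (fun u v => lineSegment (tailPt u v) (headPt u v))

/-- Every edge is a vertical segment, and the box of its head lies above the box of its tail. -/
def VisibilityRepresentation.IsVerticalUpward {V : Type*} {G : Digraph V}
    (R : VisibilityRepresentation G) : Prop :=
  ∀ u v : V, G.Adj u v →
    (R.tailPt u v).1 = (R.headPt u v).1 ∧ (R.box u).top < (R.box v).bottom

end GraphDrawing

set_option linter.unusedSectionVars false

/-! From a drawing to bars. Say that one vertex or edge lies left of another if it does so at some
common height. Planarity makes this independent of the height up to equality (`xAt_le_of_leftOf`).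
The relation need not be transitive, but it is transitive through an element whose lower end is at
least as high as those of the other two (`leftOf_trans`). Inserting the elements by increasing lower
end therefore gives each one an integer that respects the relation (`exists_labelling`). These
integers are the abscissas of the vertical edges, heights are kept, and the bar of a vertex spans
the labels of the vertex and of its edges.

From bars to a drawing. Collapse the boxes to bars on distinct levels and add a frame: a lowest bar
s, a highest bar z, a left boundary edge s → z and a right boundary path s → u → z. By induction on
the number of bars, such a representation can be drawn with straight lines in every upward triangle
of the right orientation (`Framed.drawable`). The induction also preserves the left-to-right order
of the edges at s and at z.

Let v ≠ u be the second lowest vertex; if u is second lowest, the picture is turned upside down. No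
bar lies between the levels of s and v, so s → v may be assumed to be an edge, and v can be
contracted into s. This identifies s → y with v → y whenever both exist, and the two edges enclose a
region that is attached to the rest only at s, v and y. On each side of v these regions are nested.
The vertices inside them are removed, and the remaining core is contracted and drawn by induction.

Then v is split off again as a point very close to s, in the angle between the edges of s that pass
v on its left and on its right (`exists_placement`). On each side a nonempty removed region belongs
to an empty triangle s, v, y, into which it is drawn by induction (`exists_fill`).

Planarity is recorded by affine functionals: two simplices are separated if some functional vanishes
on their common vertices, is positive on the other vertices of the first and negative on those of
the second (`Sep`). Strict inequalities survive small perturbations, which yields the position of v,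
and weak separations with few contacts can be tilted into proper ones (`Sep.of_weak`). All
coordinates are rational, so scaling leads to the integer grid. -/

namespace GraphDrawing

/-! ### Segments as graphs over the height axis -/

/-- The first coordinate, at height `y`, of the line through two grid points. -/
noncomputable def lineAt (p q : ℤ × ℤ) (y : ℝ) : ℝ :=
  p.1 + ((q.1 : ℝ) - p.1) / ((q.2 : ℝ) - p.2) * (y - p.2)

theorem mem_lineSegment_iff {p q : ℤ × ℤ} (h : p.2 < q.2) (z : ℝ × ℝ) :
    z ∈ lineSegment p q ↔ (p.2 : ℝ) ≤ z.2 ∧ z.2 ≤ q.2 ∧ z.1 = lineAt p q z.2 := by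
  have h' : (0 : ℝ) < q.2 - p.2 := by
    have : (p.2 : ℝ) < q.2 := by exact_mod_cast h
    linarith
  unfold lineSegment toPlane lineAt
  rw [segment_eq_image]
  constructor
  · rintro ⟨θ, ⟨h0, h1⟩, rfl⟩
    refine ⟨?_, ?_, ?_⟩
    · simp only [Prod.snd_add, Prod.smul_snd, smul_eq_mul]; nlinarith
    · simp only [Prod.snd_add, Prod.smul_snd, smul_eq_mul]; nlinarith
    · simp only [Prod.snd_add, Prod.smul_snd, smul_eq_mul, Prod.fst_add, Prod.smul_fst]
      field_simp
      ring
  · rintro ⟨h0, h1, h2⟩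
    refine ⟨(z.2 - p.2) / (q.2 - p.2), ⟨by apply div_nonneg <;> linarith,
      by rw [div_le_one h']; linarith⟩, ?_⟩
    refine Prod.ext ?_ ?_
    · simp only [Prod.smul_fst, smul_eq_mul, Prod.fst_add, h2]
      field_simp
      ring
    · simp only [Prod.smul_snd, smul_eq_mul, Prod.snd_add]
      field_simp
      ring

theorem lineAt_self_left (p q : ℤ × ℤ) : lineAt p q p.2 = p.1 := by simp [lineAt]

theorem lineAt_self_right {p q : ℤ × ℤ} (h : p.2 < q.2) : lineAt p q q.2 = q.1 := by
  have h' : (0 : ℝ) < q.2 - p.2 := by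
    have : (p.2 : ℝ) < q.2 := by exact_mod_cast h
    linarith
  unfold lineAt
  field_simp
  ring

theorem mem_vertical_lineSegment_iff {c a b : ℤ} (h : a < b) (z : ℝ × ℝ) :
    z ∈ lineSegment (c, a) (c, b) ↔ (a : ℝ) ≤ z.2 ∧ z.2 ≤ b ∧ z.1 = c := by
  rw [mem_lineSegment_iff (by simpa using h)]
  simp [lineAt]

/-! ### Integer labellings of a partly transitive relation -/

/-- A relation that is transitive through elements of maximal rank extends to an integer
labelling. -/
theorem exists_labelling {E : Type*} [Finite E] (r : E → E → Prop) (rank : E → ℤ)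
    (hirr : ∀ e, ¬ r e e)
    (htr : ∀ e g f, rank e ≤ rank g → rank f ≤ rank g → r e g → r g f → r e f) :
    ∃ φ : E → ℤ, ∀ e f, r e f → φ e < φ f := by
  classical
  have := Fintype.ofFinite E
  have key : ∀ s : Finset E, ∃ φ : E → ℚ, ∀ e ∈ s, ∀ f ∈ s, r e f → φ e < φ f := by
    intro s
    induction s using Finset.induction_on_max_value rank with
    | empty => exact ⟨fun _ => 0, by simp⟩
    | insert g s hg hmax ih =>
      obtain ⟨φ, hφ⟩ := ih
      -- The new element g has the largest rank so far, so `htr` applies through g: all labels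
      -- required below g are smaller than all labels required above it.
      obtain ⟨c, hlo, hhi⟩ := Order.exists_between_finsets
        ((s.filter (fun e => r e g)).image φ) ((s.filter (fun f => r g f)).image φ) (by
          intro x hx y hy
          simp only [Finset.mem_image, Finset.mem_filter] at hx hy
          obtain ⟨e, ⟨he, he'⟩, rfl⟩ := hx
          obtain ⟨f, ⟨hf, hf'⟩, rfl⟩ := hy
          exact hφ e he f hf (htr e g f (hmax e he) (hmax f hf) he' hf'))
      refine ⟨Function.update φ g c, ?_⟩
      intro e he f hf hef
      rcases Finset.mem_insert.1 he with rfl | he'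
      · rcases Finset.mem_insert.1 hf with rfl | hf'
        · exact absurd hef (hirr _)
        · have : f ≠ e := by rintro rfl; exact hg hf'
          rw [Function.update_self, Function.update_of_ne this]
          exact hhi _ (Finset.mem_image_of_mem _ (by simp [hf', hef]))
      · have h1 : e ≠ g := by rintro rfl; exact hg he'
        rcases Finset.mem_insert.1 hf with rfl | hf'
        · rw [Function.update_self, Function.update_of_ne h1]
          exact hlo _ (Finset.mem_image_of_mem _ (by simp [he', hef]))
        · have h2 : f ≠ g := by rintro rfl; exact hg hf'
          rw [Function.update_of_ne h1, Function.update_of_ne h2]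
          exact hφ e he' f hf' hef
  obtain ⟨φ, hφ⟩ := key Finset.univ
  -- Rational labels become integers by counting the elements with a smaller label.
  refine ⟨fun e => ((Finset.univ.filter (fun f => φ f < φ e)).card : ℤ), fun e f hef => ?_⟩
  have h := hφ e (Finset.mem_univ _) f (Finset.mem_univ _) hef
  have : (Finset.univ.filter (fun g => φ g < φ e)) ⊂ Finset.univ.filter (fun g => φ g < φ f) := by
    rw [Finset.ssubset_iff_of_subset]
    · exact ⟨e, by simpa using h, by simp⟩
    · intro g; simp only [Finset.mem_filter, Finset.mem_univ, true_and]; intro h'; exact h'.trans h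
  simpa using Finset.card_lt_card this

/-- The edges and the vertices `(v, v)` of a digraph. -/
abbrev Element {V : Type*} (G : Digraph V) : Type _ := {e : V × V // G.Adj e.1 e.2 ∨ e.1 = e.2}

/-! ### From upward drawings to visibility representations -/

namespace StraightLineDrawing

variable {V : Type*} {G : Digraph V} (D : StraightLineDrawing G)

/-- The closed range of heights of an element. -/
def Spans (e : Element G) (y : ℝ) : Prop :=
  ((D.pos e.1.1).2 : ℝ) ≤ y ∧ y ≤ (D.pos e.1.2).2

/-- The horizontal position of an element at a height. -/
noncomputable def xAt (e : Element G) (y : ℝ) : ℝ := lineAt (D.pos e.1.1) (D.pos e.1.2) y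

/-- At some common height, the first element lies to the left of the second. -/
def LeftOf (e f : Element G) : Prop := ∃ y, D.Spans e y ∧ D.Spans f y ∧ D.xAt e y < D.xAt f y

variable {D}

theorem xAt_affine (D : StraightLineDrawing G) (e : Element G) :
    ∃ a b : ℝ, ∀ y, D.xAt e y = a + b * y := by
  refine ⟨(D.pos e.1.1).1 - (((D.pos e.1.2).1 : ℝ) - (D.pos e.1.1).1) /
      (((D.pos e.1.2).2 : ℝ) - (D.pos e.1.1).2) * (D.pos e.1.1).2,
    (((D.pos e.1.2).1 : ℝ) - (D.pos e.1.1).1) / (((D.pos e.1.2).2 : ℝ) - (D.pos e.1.1).2),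
    fun y => ?_⟩
  unfold xAt lineAt; ring

theorem spans_incident (hD : D.IsUpward) {e : Element G} {w : V} (h : e.1.1 = w ∨ e.1.2 = w) :
    D.Spans e (D.pos w).2 := by
  obtain ⟨⟨a, b⟩, hab⟩ := e
  have hle : ((D.pos a).2 : ℝ) ≤ (D.pos b).2 := by
    rcases hab with hab | hab
    · exact_mod_cast (hD a b hab).le
    · simp only at hab; subst hab; exact le_rfl
  rcases h with rfl | rfl
  · exact ⟨le_rfl, hle⟩
  · exact ⟨hle, le_rfl⟩

theorem xAt_incident (hD : D.IsUpward) {e : Element G} {w : V} (h : e.1.1 = w ∨ e.1.2 = w) :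
    D.xAt e (D.pos w).2 = (D.pos w).1 := by
  obtain ⟨⟨a, b⟩, hab⟩ := e
  rcases h with rfl | rfl
  · exact lineAt_self_left _ _
  · rcases hab with hab | hab
    · exact lineAt_self_right (hD a b hab)
    · simp only at hab; subst hab; exact lineAt_self_left _ _

theorem common_vertex (hD : D.IsUpward) {a b c d : V} (hab : G.Adj a b) (hcd : G.Adj c d)
    (hne : (a, b) ≠ (c, d)) {y : ℝ} (h1 : D.Spans ⟨(a, b), Or.inl hab⟩ y)
    (h2 : D.Spans ⟨(c, d), Or.inl hcd⟩ y)
    (hx : D.xAt ⟨(a, b), Or.inl hab⟩ y = D.xAt ⟨(c, d), Or.inl hcd⟩ y) :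
    ∃ w, (w = a ∨ w = b) ∧ (w = c ∨ w = d) ∧ y = (D.pos w).2 := by
  have m1 : (D.xAt ⟨(a, b), Or.inl hab⟩ y, y) ∈ lineSegment (D.pos a) (D.pos b) :=
    (mem_lineSegment_iff (hD a b hab) _).2 ⟨h1.1, h1.2, rfl⟩
  have m2 : (D.xAt ⟨(a, b), Or.inl hab⟩ y, y) ∈ lineSegment (D.pos c) (D.pos d) :=
    (mem_lineSegment_iff (hD c d hcd) _).2 ⟨h2.1, h2.2, hx⟩
  have := D.planar.edge_edge a b c d hab hcd hne ⟨m1, m2⟩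
  simp only [Set.mem_iUnion, Set.mem_singleton_iff, Set.mem_inter_iff, Set.mem_insert_iff] at this
  obtain ⟨w, ⟨hw1, hw2⟩, hw⟩ := this
  exact ⟨w, hw1, hw2, congrArg Prod.snd hw⟩

/-- If the two elements changed sides, linearity would make them cross strictly between the two
heights. Both would then be edges, because a vertex spans only one height, and they would meet in
their interiors; but different edges meet only at common ends. -/
theorem xAt_le_of_leftOf (hD : D.IsUpward) {e f : Element G} {y y' : ℝ} (he : D.Spans e y)
    (hf : D.Spans f y) (h : D.xAt e y < D.xAt f y) (he' : D.Spans e y') (hf' : D.Spans f y') :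
    D.xAt e y' ≤ D.xAt f y' := by
  by_contra! hlt
  obtain ⟨p, q, hpq⟩ := D.xAt_affine e
  obtain ⟨p', q', hpq'⟩ := D.xAt_affine f
  have hyy : y ≠ y' := by rintro rfl; linarith
  obtain ⟨⟨a, b⟩, hab⟩ := e
  obtain ⟨⟨c, d⟩, hcd⟩ := f
  have hab' : G.Adj a b := by
    refine hab.resolve_right fun hh => hyy ?_
    simp only at hh; subst hh
    exact le_antisymm (he.2.trans he'.1) (he'.2.trans he.1)
  have hcd' : G.Adj c d := by
    refine hcd.resolve_right fun hh => hyy ?_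
    simp only at hh; subst hh
    exact le_antisymm (hf.2.trans hf'.1) (hf'.2.trans hf.1)
  have hne : (a, b) ≠ (c, d) := by
    rintro hh
    simp only [Prod.mk.injEq] at hh
    obtain ⟨rfl, rfl⟩ := hh
    exact lt_irrefl _ h
  rw [hpq, hpq'] at h hlt
  have hA : 0 < (p' + q' * y) - (p + q * y) := by linarith
  have hB : 0 < (p + q * y') - (p' + q' * y') := by linarith
  set A := (p' + q' * y) - (p + q * y) with hAd
  set B := (p + q * y') - (p' + q' * y') with hBd
  -- The height at which the two affine functions agree, found from their gaps A at y and B at y'.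
  set y0 := (B * y + A * y') / (A + B) with hy0
  have hAB : 0 < A + B := by linarith
  have hy0' : y0 * (A + B) = B * y + A * y' := by rw [hy0]; field_simp
  have between : ∀ lo hi : ℝ, lo ≤ y → lo ≤ y' → y ≤ hi → y' ≤ hi → lo < y0 ∧ y0 < hi := by
    intro lo hi h1 h2 h3 h4
    rcases lt_or_gt_of_ne hyy with h5 | h5 <;>
    · constructor
      · rw [hy0, lt_div_iff₀ hAB]; nlinarith
      · rw [hy0, div_lt_iff₀ hAB]; nlinarith
  have b1 := between _ _ he.1 he'.1 he.2 he'.2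
  have b2 := between _ _ hf.1 hf'.1 hf.2 hf'.2
  obtain ⟨w, hw, -, hy⟩ := common_vertex hD hab' hcd' hne (y := y0) ⟨b1.1.le, b1.2.le⟩
    ⟨b2.1.le, b2.2.le⟩ (by
      rw [hpq, hpq']
      have : (p + q * y0 - (p' + q' * y0)) * (A + B) = 0 := by
        have : (p + q * y0 - (p' + q' * y0)) * (A + B) =
          (p - p') * (A + B) + (q - q') * (y0 * (A + B)) := by ring
        rw [this, hy0', hAd, hBd]; ring
      have := (mul_eq_zero.1 this).resolve_right hAB.ne'
      linarith)
  rcases hw with rfl | rfl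
  · exact b1.1.ne' hy
  · exact b1.2.ne hy

/-- At the lower end of g all three elements are present, since e and f start no higher and meet the
range of g. There e, g, f are in weak order. If all three coincide at that height, their slopes are
strictly increasing, which separates e from f just above it. -/
theorem leftOf_trans (hD : D.IsUpward) {e g f : Element G}
    (heg : (D.pos e.1.1).2 ≤ (D.pos g.1.1).2) (hfg : (D.pos f.1.1).2 ≤ (D.pos g.1.1).2)
    (h1 : D.LeftOf e g) (h2 : D.LeftOf g f) : D.LeftOf e f := by
  obtain ⟨y1, he1, hg1, hlt1⟩ := h1
  obtain ⟨y2, hg2, hf2, hlt2⟩ := h2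
  obtain ⟨y0, hy0⟩ : ∃ y0 : ℝ, y0 = ((D.pos g.1.1).2 : ℝ) := ⟨_, rfl⟩
  have heg' : ((D.pos e.1.1).2 : ℝ) ≤ y0 := by rw [hy0]; exact_mod_cast heg
  have hfg' : ((D.pos f.1.1).2 : ℝ) ≤ y0 := by rw [hy0]; exact_mod_cast hfg
  have he0 : D.Spans e y0 := ⟨heg', hy0.le.trans (hg1.1.trans he1.2)⟩
  have hf0 : D.Spans f y0 := ⟨hfg', hy0.le.trans (hg2.1.trans hf2.2)⟩
  have hg0 : D.Spans g y0 := ⟨hy0.ge, hy0.le.trans (hg1.1.trans hg1.2)⟩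
  have l1 := xAt_le_of_leftOf hD he1 hg1 hlt1 he0 hg0
  have l2 := xAt_le_of_leftOf hD hg2 hf2 hlt2 hg0 hf0
  by_cases hlt : D.xAt e y0 < D.xAt f y0
  · exact ⟨y0, he0, hf0, hlt⟩
  have e1 : D.xAt e y0 = D.xAt g y0 := by linarith
  have e2 : D.xAt g y0 = D.xAt f y0 := by linarith
  have k1 : y0 < y1 := lt_of_le_of_ne (hy0.le.trans hg1.1) (by rintro h; rw [← h] at hlt1; linarith)
  have k2 : y0 < y2 := lt_of_le_of_ne (hy0.le.trans hg2.1) (by rintro h; rw [← h] at hlt2; linarith)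
  obtain ⟨p, q, hpq⟩ := D.xAt_affine e
  obtain ⟨p', q', hpq'⟩ := D.xAt_affine g
  obtain ⟨p'', q'', hpq''⟩ := D.xAt_affine f
  rw [hpq, hpq'] at hlt1 e1
  rw [hpq', hpq''] at hlt2 e2
  have s1 : q < q' := by nlinarith
  have s2 : q' < q'' := by nlinarith
  refine ⟨min y1 y2, ⟨heg'.trans (le_min k1.le k2.le), (min_le_left _ _).trans he1.2⟩,
    ⟨hfg'.trans (le_min k1.le k2.le), (min_le_right _ _).trans hf2.2⟩, ?_⟩
  have k3 : y0 < min y1 y2 := lt_min k1 k2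
  rw [hpq, hpq'']
  nlinarith

/-- Every upward planar straight-line drawing yields a visibility representation with the same
heights. -/
theorem exists_visibilityRepresentation [Finite V] (D : StraightLineDrawing G) (hD : D.IsUpward) :
    ∃ R : VisibilityRepresentation G, R.IsVerticalUpward := by
  classical
  have := Fintype.ofFinite V
  have : Finite (Element G) := Subtype.finite
  have := Fintype.ofFinite (Element G)
  -- The rank is the height of the lower end, as `leftOf_trans` requires.
  obtain ⟨φ, hφ⟩ := exists_labelling D.LeftOf (fun e => (D.pos e.1.1).2)
    (fun e ⟨y, _, _, h⟩ => lt_irrefl _ h) (fun e g f h1 h2 h3 h4 => leftOf_trans hD h1 h2 h3 h4)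
  let inc : V → Finset (Element G) := fun v => Finset.univ.filter fun e => e.1.1 = v ∨ e.1.2 = v
  have hinc : ∀ v, (inc v).Nonempty := fun v => ⟨⟨(v, v), Or.inr rfl⟩, by simp [inc]⟩
  have mem_inc : ∀ v e, e ∈ inc v ↔ e.1.1 = v ∨ e.1.2 = v := by intro v e; simp [inc]
  let lo : V → ℤ := fun v => (inc v).inf' (hinc v) φ
  let hi : V → ℤ := fun v => (inc v).sup' (hinc v) φ
  have hlo : ∀ v e, e ∈ inc v → lo v ≤ φ e := fun v e he => Finset.inf'_le _ he
  have hhi : ∀ v e, e ∈ inc v → φ e ≤ hi v := fun v e he => Finset.le_sup' _ he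
  have hlo' : ∀ v, ∃ e ∈ inc v, lo v = φ e := fun v => Finset.exists_mem_eq_inf' _ _
  have hhi' : ∀ v, ∃ e ∈ inc v, hi v = φ e := fun v => Finset.exists_mem_eq_sup' _ _
  -- At the height of w all elements incident with w pass through its point. An element that misses
  -- this point lies on the same side of all of them, so its label falls outside the bar of w.
  have miss : ∀ (e : Element G) (w : V), D.Spans e (D.pos w).2 →
      D.xAt e (D.pos w).2 ≠ (D.pos w).1 → φ e < lo w ∨ hi w < φ e := by
    intro e w hs hne
    rcases lt_or_gt_of_ne hne with h | h
    · left
      obtain ⟨f, hf, hf'⟩ := hlo' w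
      rw [hf']
      rw [mem_inc] at hf
      exact hφ _ _ ⟨_, hs, spans_incident hD hf, by rwa [xAt_incident hD hf]⟩
    · right
      obtain ⟨f, hf, hf'⟩ := hhi' w
      rw [hf']
      rw [mem_inc] at hf
      exact hφ _ _ ⟨_, spans_incident hD hf, hs, by rwa [xAt_incident hD hf]⟩
  let box : V → Box := fun v => ⟨lo v, hi v, (D.pos v).2, (D.pos v).2, by
    obtain ⟨e, he⟩ := hinc v; exact (hlo v e he).trans (hhi v e he), le_rfl⟩
  let xe : V → V → ℤ := fun u v => if h : G.Adj u v then φ ⟨(u, v), Or.inl h⟩ else 0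
  have hxe : ∀ u v (h : G.Adj u v), xe u v = φ ⟨(u, v), Or.inl h⟩ := fun u v h => dif_pos h
  have mem_box : ∀ v (z : ℝ × ℝ), z ∈ (box v).toSet ↔
      (lo v : ℝ) ≤ z.1 ∧ z.1 ≤ hi v ∧ z.2 = (D.pos v).2 := by
    intro v z
    simp only [Box.toSet, box, Set.mem_prod, Set.mem_Icc]
    constructor
    · rintro ⟨⟨h1, h2⟩, h3, h4⟩; exact ⟨h1, h2, le_antisymm h4 h3⟩
    · rintro ⟨h1, h2, h3⟩; exact ⟨⟨h1, h2⟩, h3.ge, h3.le⟩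
  have mem_seg : ∀ u v (h : G.Adj u v) (z : ℝ × ℝ),
      z ∈ lineSegment (xe u v, (D.pos u).2) (xe u v, (D.pos v).2) ↔
      ((D.pos u).2 : ℝ) ≤ z.2 ∧ z.2 ≤ (D.pos v).2 ∧ z.1 = xe u v := fun u v h z =>
    mem_vertical_lineSegment_iff (hD u v h) z
  refine ⟨⟨box, fun u v => (xe u v, (D.pos u).2), fun u v => (xe u v, (D.pos v).2),
    fun u v h => Or.inl rfl, ?_, ?_, ⟨?_, ?_, ?_⟩⟩, fun u v h => ⟨rfl, hD u v h⟩⟩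
  · intro u v h
    have h1 : (⟨(u, v), Or.inl h⟩ : Element G) ∈ inc u := by simp [inc]
    ext z
    rw [Set.mem_inter_iff, mem_seg u v h, mem_box, Set.mem_singleton_iff]
    constructor
    · rintro ⟨⟨-, -, h2⟩, -, -, h3⟩
      exact Prod.ext h2 h3
    · rintro rfl
      have a1 : ((D.pos u).2 : ℝ) ≤ (D.pos v).2 := by exact_mod_cast (hD u v h).le
      have a2 := hlo _ _ h1
      have a3 := hhi _ _ h1
      rw [← hxe u v h] at a2 a3
      exact ⟨⟨le_rfl, a1, rfl⟩, by simpa [toPlane] using a2, by simpa [toPlane] using a3, rfl⟩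
  · intro u v h
    have h1 : (⟨(u, v), Or.inl h⟩ : Element G) ∈ inc v := by simp [inc]
    ext z
    rw [Set.mem_inter_iff, mem_seg u v h, mem_box, Set.mem_singleton_iff]
    constructor
    · rintro ⟨⟨-, -, h2⟩, -, -, h3⟩
      exact Prod.ext h2 h3
    · rintro rfl
      have a1 : ((D.pos u).2 : ℝ) ≤ (D.pos v).2 := by exact_mod_cast (hD u v h).le
      have a2 := hlo _ _ h1
      have a3 := hhi _ _ h1
      rw [← hxe u v h] at a2 a3
      exact ⟨⟨a1, le_rfl, rfl⟩, by simpa [toPlane] using a2, by simpa [toPlane] using a3, rfl⟩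
  · intro v w hvw
    rw [Set.disjoint_left]
    intro z hz hz'
    rw [mem_box] at hz hz'
    obtain ⟨a1, a2, a3⟩ := hz
    obtain ⟨b1, b2, b3⟩ := hz'
    have hy : ((D.pos v).2 : ℝ) = (D.pos w).2 := a3.symm.trans b3
    have hx : ((D.pos v).1 : ℝ) ≠ (D.pos w).1 := by
      intro hx
      have := D.planar.vertex_vertex v w hvw
      rw [Set.disjoint_singleton] at this
      exact this (Prod.ext hx hy)
    have hsep : hi v < lo w ∨ hi w < lo v := by
      obtain ⟨e, he, he'⟩ := hhi' v
      obtain ⟨f, hf, hf'⟩ := hlo' v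
      rw [mem_inc] at he hf
      rcases lt_or_gt_of_ne hx with h | h
      · left
        obtain ⟨g, hg, hg'⟩ := hlo' w
        rw [he', hg']
        rw [mem_inc] at hg
        refine hφ _ _ ⟨(D.pos v).2, spans_incident hD he, by rw [hy]; exact spans_incident hD hg, ?_⟩
        rw [xAt_incident hD he, hy, xAt_incident hD hg]; exact h
      · right
        obtain ⟨g, hg, hg'⟩ := hhi' w
        rw [hf', hg']
        rw [mem_inc] at hg
        refine hφ _ _ ⟨(D.pos v).2, by rw [hy]; exact spans_incident hD hg, spans_incident hD hf, ?_⟩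
        rw [xAt_incident hD hf, hy, xAt_incident hD hg]; exact h
    rcases hsep with h | h
    · have : (hi v : ℝ) < lo w := by exact_mod_cast h
      linarith
    · have : (hi w : ℝ) < lo v := by exact_mod_cast h
      linarith
  · intro u v w h hwu hwv
    rw [Set.disjoint_left]
    intro z hz hz'
    rw [mem_seg u v h] at hz
    rw [mem_box] at hz'
    obtain ⟨a1, a2, a3⟩ := hz
    obtain ⟨b1, b2, b3⟩ := hz'
    rw [b3] at a1 a2
    have := miss ⟨(u, v), Or.inl h⟩ w ⟨a1, a2⟩ (by
      intro hx
      have := D.planar.edge_vertex u v w h hwu hwv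
      rw [Set.disjoint_singleton_right] at this
      exact this ((mem_lineSegment_iff (hD u v h) _).2 ⟨a1, a2, hx.symm⟩))
    rw [← hxe u v h] at this
    rw [a3] at b1 b2
    have b1' : lo w ≤ xe u v := by exact_mod_cast b1
    have b2' : xe u v ≤ hi w := by exact_mod_cast b2
    omega
  · intro u v u' v' h h' hne z hz
    obtain ⟨hz1, hz2⟩ := hz
    rw [mem_seg u v h] at hz1
    rw [mem_seg u' v' h'] at hz2
    -- With equal labels neither edge is left of the other, so they coincide at the common height,
    -- and planarity of the drawing supplies a common end there.
    have hφe : φ ⟨(u, v), Or.inl h⟩ = φ ⟨(u', v'), Or.inl h'⟩ := by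
      rw [← hxe u v h, ← hxe u' v' h']
      have : (xe u v : ℝ) = xe u' v' := hz1.2.2.symm.trans hz2.2.2
      exact_mod_cast this
    have s1 : D.Spans ⟨(u, v), Or.inl h⟩ z.2 := ⟨hz1.1, hz1.2.1⟩
    have s2 : D.Spans ⟨(u', v'), Or.inl h'⟩ z.2 := ⟨hz2.1, hz2.2.1⟩
    obtain ⟨w, hw1, hw2, hw⟩ := common_vertex hD h h' hne s1 s2 (by
      by_contra hx
      rcases lt_or_gt_of_ne hx with h3 | h3
      · exact (hφ _ _ ⟨_, s1, s2, h3⟩).ne hφe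
      · exact (hφ _ _ ⟨_, s2, s1, h3⟩).ne' hφe)
    simp only [Set.mem_iUnion, Set.mem_inter_iff, Set.mem_insert_iff, Set.mem_singleton_iff]
    refine ⟨w, ⟨hw1, hw2⟩, (mem_box w z).2 ?_⟩
    have hi' : (⟨(u, v), Or.inl h⟩ : Element G) ∈ inc w := by
      rw [mem_inc]; rcases hw1 with rfl | rfl
      · exact Or.inl rfl
      · exact Or.inr rfl
    have a2 := hlo _ _ hi'
    have a3 := hhi _ _ hi'
    rw [← hxe u v h] at a2 a3
    rw [hz1.2.2]
    exact ⟨by exact_mod_cast a2, by exact_mod_cast a3, hw⟩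

end StraightLineDrawing

/-! ### Rational affine functionals, orientation and triangles -/

open Filter Topology

/-- The value at `p` of the affine functional with coefficients `f`. -/
def aff (f : ℚ × ℚ × ℚ) (p : ℚ × ℚ) : ℚ := f.1 * p.1 + f.2.1 * p.2 + f.2.2

/-- Twice the signed area of a triangle. -/
def orient (p q r : ℚ × ℚ) : ℚ := (q.1 - p.1) * (r.2 - p.2) - (q.2 - p.2) * (r.1 - p.1)

theorem aff_add_smul (f g : ℚ × ℚ × ℚ) (δ : ℚ) (p : ℚ × ℚ) :
    aff (f + δ • g) p = aff f p + δ * aff g p := by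
  simp only [aff, Prod.fst_add, Prod.snd_add, Prod.smul_fst, Prod.smul_snd, smul_eq_mul]; ring

theorem aff_neg (f : ℚ × ℚ × ℚ) (p : ℚ × ℚ) : aff (-f) p = -aff f p := by
  simp only [aff, Prod.fst_neg, Prod.snd_neg]; ring

theorem eventually_pos_add_mul {c : ℚ} (hc : 0 < c) (k : ℚ) :
    ∀ᶠ ε in 𝓝[>] (0 : ℚ), 0 < c + ε * k := by
  have h : Tendsto (fun ε : ℚ => c + ε * k) (𝓝 0) (𝓝 (c + 0 * k)) :=
    Continuous.tendsto (by fun_prop) 0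
  rw [zero_mul, add_zero] at h
  exact (h.eventually (lt_mem_nhds hc)).filter_mono nhdsWithin_le_nhds

/-- The affine functional `r ↦ orient p q r`. -/
def orientFun (p q : ℚ × ℚ) : ℚ × ℚ × ℚ :=
  (-(q.2 - p.2), q.1 - p.1, -((q.1 - p.1) * p.2) + (q.2 - p.2) * p.1)

theorem aff_orientFun (p q r : ℚ × ℚ) : aff (orientFun p q) r = orient p q r := by
  simp only [aff, orientFun, orient]; ring

theorem exists_aff_of_ne {p q : ℚ × ℚ} (h : p ≠ q) (a b : ℚ) :
    ∃ f, aff f p = a ∧ aff f q = b := by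
  by_cases h1 : p.1 = q.1
  · have h2 : p.2 - q.2 ≠ 0 := fun h2 => h (Prod.ext h1 (by linarith))
    refine ⟨(0, (a - b) / (p.2 - q.2), a - (a - b) / (p.2 - q.2) * p.2), ?_, ?_⟩ <;>
    · simp only [aff]; field_simp; ring
  · have h2 : p.1 - q.1 ≠ 0 := fun h2 => h1 (by linarith)
    refine ⟨((a - b) / (p.1 - q.1), 0, a - (a - b) / (p.1 - q.1) * p.1), ?_, ?_⟩ <;>
    · simp only [aff]; field_simp; ring

theorem exists_aff_of_orient_ne_zero {p q r : ℚ × ℚ} (h : orient p q r ≠ 0) (a b c : ℚ) :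
    ∃ f, aff f p = a ∧ aff f q = b ∧ aff f r = c := by
  -- Barycentric coordinates: `orientFun q r` vanishes at q and r and takes the value `orient p q r`
  -- at p; the others follow cyclically.
  refine ⟨(a / orient p q r) • orientFun q r + (b / orient p q r) • orientFun r p +
    (c / orient p q r) • orientFun p q, ?_, ?_, ?_⟩ <;>
  · simp only [aff_add_smul]
    simp only [aff, orientFun, Prod.smul_fst, Prod.smul_snd, smul_eq_mul]
    field_simp
    simp only [orient]
    ring

theorem orient_rotate (p q r : ℚ × ℚ) : orient q r p = orient p q r := by
  simp only [orient]; ring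

theorem orient_swap (p q r : ℚ × ℚ) : orient p r q = -orient p q r := by
  simp only [orient]; ring

/-- The point lies in the closed triangle. -/
def InTriangle (p q t z : ℚ × ℚ) : Prop :=
  ∃ a b c : ℚ, 0 ≤ a ∧ 0 ≤ b ∧ 0 ≤ c ∧ a + b + c = 1 ∧
    z = (a * p.1 + b * q.1 + c * t.1, a * p.2 + b * q.2 + c * t.2)

theorem aff_combination {f : ℚ × ℚ × ℚ} {p q t : ℚ × ℚ} {a b c : ℚ} (h : a + b + c = 1) :
    aff f (a * p.1 + b * q.1 + c * t.1, a * p.2 + b * q.2 + c * t.2) =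
      a * aff f p + b * aff f q + c * aff f t := by
  simp only [aff]
  have : c = 1 - a - b := by linarith
  subst this; ring

theorem InTriangle.rotate {p q t z : ℚ × ℚ} (h : InTriangle p q t z) : InTriangle q t p z := by
  obtain ⟨a, b, c, ha, hb, hc, habc, rfl⟩ := h
  exact ⟨b, c, a, hb, hc, ha, by linarith, by ext <;> simp only <;> ring⟩

theorem InTriangle.left (p q t : ℚ × ℚ) : InTriangle p q t p :=
  ⟨1, 0, 0, by norm_num, by norm_num, by norm_num, by norm_num, by ext <;> simp⟩

theorem InTriangle.middle (p q t : ℚ × ℚ) : InTriangle p q t q := (InTriangle.left q t p).rotate.rotate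

theorem InTriangle.right (p q t : ℚ × ℚ) : InTriangle p q t t := (InTriangle.left t p q).rotate

theorem InTriangle.trans {p q t i j k z : ℚ × ℚ} (hi : InTriangle p q t i)
    (hj : InTriangle p q t j) (hk : InTriangle p q t k) (hz : InTriangle i j k z) :
    InTriangle p q t z := by
  obtain ⟨a1, b1, c1, ha1, hb1, hc1, h1, rfl⟩ := hi
  obtain ⟨a2, b2, c2, ha2, hb2, hc2, h2, rfl⟩ := hj
  obtain ⟨a3, b3, c3, ha3, hb3, hc3, h3, rfl⟩ := hk
  obtain ⟨a, b, c, ha, hb, hc, h, rfl⟩ := hz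
  refine ⟨a * a1 + b * a2 + c * a3, a * b1 + b * b2 + c * b3, a * c1 + b * c2 + c * c3,
    by positivity, by positivity, by positivity, ?_, ?_⟩
  · have : a * (a1 + b1 + c1) + b * (a2 + b2 + c2) + c * (a3 + b3 + c3) = 1 := by
      rw [h1, h2, h3]; linarith
    linarith
  · ext <;> simp only <;> ring

variable {V : Type*}

/-! ### Separation of simplices by a line -/

/-- The simplices on `P` and on `Q` are separated by a line that meets each of them exactly in
their common face. -/
def Sep (pos : V → ℚ × ℚ) (P Q : Set V) : Prop :=
  ∃ f, ∀ i, (i ∈ P → i ∈ Q → aff f (pos i) = 0) ∧ (i ∈ P → i ∉ Q → 0 < aff f (pos i)) ∧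
    (i ∈ Q → i ∉ P → aff f (pos i) < 0)

theorem Sep.symm {pos : V → ℚ × ℚ} {P Q : Set V} (h : Sep pos P Q) : Sep pos Q P := by
  obtain ⟨f, hf⟩ := h
  refine ⟨-f, fun i => ?_⟩
  simp only [aff_neg]
  obtain ⟨h1, h2, h3⟩ := hf i
  exact ⟨fun a b => by rw [h1 b a, neg_zero], fun a b => by linarith [h3 a b],
    fun a b => by linarith [h2 a b]⟩

theorem Sep.refl (pos : V → ℚ × ℚ) (P : Set V) : Sep pos P P :=
  ⟨0, fun i => ⟨fun _ _ => by simp [aff], fun a b => absurd a b, fun a b => absurd a b⟩⟩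

theorem Sep.congr {pos pos' : V → ℚ × ℚ} {P Q : Set V} (h : Sep pos P Q)
    (hP : ∀ i ∈ P, pos' i = pos i) (hQ : ∀ i ∈ Q, pos' i = pos i) : Sep pos' P Q := by
  obtain ⟨f, hf⟩ := h
  refine ⟨f, fun i => ⟨fun a b => ?_, fun a b => ?_, fun a b => ?_⟩⟩
  · rw [hP i a]; exact (hf i).1 a b
  · rw [hP i a]; exact (hf i).2.1 a b
  · rw [hQ i a]; exact (hf i).2.2 a b

/-- Tilt f to f + δg with a small δ > 0: where f is nonzero its sign prevails, and where f vanishes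
g decides. -/
theorem Sep.of_weak [Finite V] {pos : V → ℚ × ℚ} {P Q : Set V} {f g : ℚ × ℚ × ℚ}
    (hP : ∀ i ∈ P, 0 ≤ aff f (pos i)) (hQ : ∀ i ∈ Q, aff f (pos i) ≤ 0)
    (hz : ∀ i, aff f (pos i) = 0 → (i ∈ P → i ∈ Q → aff g (pos i) = 0) ∧
      (i ∈ P → i ∉ Q → 0 < aff g (pos i)) ∧ (i ∈ Q → i ∉ P → aff g (pos i) < 0)) :
    Sep pos P Q := by
  have key : ∀ i, ∀ᶠ δ in 𝓝[>] (0 : ℚ),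
      (i ∈ P → i ∈ Q → aff (f + δ • g) (pos i) = 0) ∧
      (i ∈ P → i ∉ Q → 0 < aff (f + δ • g) (pos i)) ∧
      (i ∈ Q → i ∉ P → aff (f + δ • g) (pos i) < 0) := by
    intro i
    simp only [aff_add_smul]
    rcases lt_trichotomy (aff f (pos i)) 0 with h | h | h
    · filter_upwards [eventually_pos_add_mul (neg_pos.2 h) (-aff g (pos i))] with δ hδ
      exact ⟨fun a => absurd (hP i a) (by linarith), fun a => absurd (hP i a) (by linarith),
        fun _ _ => by linarith⟩
    · filter_upwards [self_mem_nhdsWithin] with δ hδ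
      have hδ' : 0 < δ := hδ
      obtain ⟨h1, h2, h3⟩ := hz i h
      rw [h, zero_add]
      exact ⟨fun a b => by rw [h1 a b, mul_zero], fun a b => mul_pos hδ' (h2 a b),
        fun a b => mul_neg_of_pos_of_neg hδ' (h3 a b)⟩
    · filter_upwards [eventually_pos_add_mul h (aff g (pos i))] with δ hδ
      exact ⟨fun _ a => absurd (hQ i a) (by linarith), fun _ _ => hδ,
        fun a => absurd (hQ i a) (by linarith)⟩
  obtain ⟨δ, hδ⟩ := (eventually_all.2 key).exists
  exact ⟨_, hδ⟩

/-- An affine functional can take any prescribed values at two distinct points. Hence a weak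
separation that touches the simplices in at most two vertices can always be tilted into a proper
one. -/
theorem Sep.of_weak_of_zeros [Finite V] {pos : V → ℚ × ℚ} {P Q : Set V} (f : ℚ × ℚ × ℚ) {i j : V}
    (hij : pos i ≠ pos j)
    (hP : ∀ w ∈ P, 0 ≤ aff f (pos w)) (hQ : ∀ w ∈ Q, aff f (pos w) ≤ 0)
    (hz : ∀ w, w ∈ P ∨ w ∈ Q → aff f (pos w) = 0 → w = i ∨ w = j) : Sep pos P Q := by
  classical
  let σ : V → ℚ := fun w => if w ∈ P then (if w ∈ Q then 0 else 1) else -1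
  obtain ⟨g, hi, hj⟩ := exists_aff_of_ne hij (σ i) (σ j)
  refine Sep.of_weak (f := f) (g := g) hP hQ fun w hw => ?_
  by_cases hmem : w ∈ P ∨ w ∈ Q
  · have hg : aff g (pos w) = σ w := by
      rcases hz w hmem hw with rfl | rfl
      · exact hi
      · exact hj
    rw [hg]
    simp only [σ]
    refine ⟨fun a b => ?_, fun a b => ?_, fun a b => ?_⟩ <;> simp [a, b]
  · push Not at hmem
    exact ⟨fun a => absurd a hmem.1, fun a => absurd a hmem.1, fun a => absurd a hmem.2⟩

theorem Sep.of_weak_of_zero [Finite V] {pos : V → ℚ × ℚ} {P Q : Set V} (f : ℚ × ℚ × ℚ) {i : V}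
    (hP : ∀ w ∈ P, 0 ≤ aff f (pos w)) (hQ : ∀ w ∈ Q, aff f (pos w) ≤ 0)
    (hz : ∀ w, w ∈ P ∨ w ∈ Q → aff f (pos w) = 0 → w = i) : Sep pos P Q := by
  classical
  let σ : V → ℚ := fun w => if w ∈ P then (if w ∈ Q then 0 else 1) else -1
  refine Sep.of_weak (f := f) (g := (0, 0, σ i)) hP hQ fun w hw => ?_
  by_cases hmem : w ∈ P ∨ w ∈ Q
  · have hg : aff (0, 0, σ i) (pos w) = σ w := by
      rw [hz w hmem hw]; simp [aff]
    rw [hg]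
    simp only [σ]
    refine ⟨fun a b => ?_, fun a b => ?_, fun a b => ?_⟩ <;> simp [a, b]
  · push Not at hmem
    exact ⟨fun a => absurd a hmem.1, fun a => absurd a hmem.1, fun a => absurd a hmem.2⟩

/-- Subsets of an affinely independent triple are separated. -/
theorem Sep.of_subset_triple {pos : V → ℚ × ℚ} {i j k : V}
    (h : orient (pos i) (pos j) (pos k) ≠ 0) {P Q : Set V} (hP : P ⊆ {i, j, k})
    (hQ : Q ⊆ {i, j, k}) : Sep pos P Q := by
  classical
  let σ : V → ℚ := fun w => if w ∈ P then (if w ∈ Q then 0 else 1) else -1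
  obtain ⟨f, hi, hj, hk⟩ := exists_aff_of_orient_ne_zero h (σ i) (σ j) (σ k)
  have hw : ∀ w, w ∈ P ∨ w ∈ Q → aff f (pos w) = σ w := by
    intro w hw
    have : w ∈ ({i, j, k} : Set V) := hw.elim (fun h => hP h) (fun h => hQ h)
    rcases this with rfl | rfl | rfl
    exacts [hi, hj, hk]
  refine ⟨f, fun w => ⟨fun a b => ?_, fun a b => ?_, fun a b => ?_⟩⟩
  · rw [hw w (Or.inl a)]; simp [σ, a, b]
  · rw [hw w (Or.inl a)]; simp [σ, a, b]
  · rw [hw w (Or.inr a)]; simp [σ, b]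

theorem orient_ne_zero_ne {p q r : ℚ × ℚ} (h : orient p q r ≠ 0) : p ≠ q ∧ q ≠ r ∧ r ≠ p := by
  refine ⟨?_, ?_, ?_⟩ <;> rintro rfl <;> apply h <;> simp only [orient] <;> ring

/-- If `Q` lies weakly below the triangle `i j k` but does not contain the corner `k`, then a
point of the triangle off the side `i j` lies strictly above. -/
theorem aff_pos_of_notMem_side {pos : V → ℚ × ℚ} {pos' : V → ℚ × ℚ} {i j k w : V} {f : ℚ × ℚ × ℚ}
    (hi : 0 ≤ aff f (pos i)) (hj : 0 ≤ aff f (pos j)) (hk : 0 < aff f (pos k))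
    (hpi : pos' i = pos i) (hpj : pos' j = pos j)
    (hw : InTriangle (pos i) (pos j) (pos k) (pos' w)) (hwi : w ≠ i) (hwj : w ≠ j)
    (hsep : Sep pos' {w} {i, j}) : 0 < aff f (pos' w) := by
  obtain ⟨a, b, c, ha, hb, hc, habc, hz⟩ := hw
  obtain ⟨g, hg⟩ := hsep
  have hgw := (hg w).2.1 rfl (by simp [hwi, hwj])
  have hgi := (hg i).2.2 (by simp) (by simpa using hwi.symm)
  have hgj := (hg j).2.2 (by simp) (by simpa using hwj.symm)
  rw [hpi] at hgi
  rw [hpj] at hgj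
  rw [hz, aff_combination habc] at hgw ⊢
  rcases hc.lt_or_eq with hc' | rfl
  · have := mul_pos hc' hk
    have := mul_nonneg ha hi
    have := mul_nonneg hb hj
    linarith
  -- With c = 0 the point would lie on the side ij, where g is negative, against `hgw`.
  · nlinarith [mul_nonneg ha (neg_nonneg.2 hgi.le), mul_nonneg hb (neg_nonneg.2 hgj.le)]

/-- Replacing an empty triangle of a planar complex by a planar complex drawn inside it. -/
theorem Sep.fill [Finite V] {pos pos' : V → ℚ × ℚ} {K K' : Set (Set V)} {i j k : V} {U : Set V}
    (hT : orient (pos i) (pos j) (pos k) ≠ 0)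
    (hK : ∀ P ∈ K, ∀ Q ∈ K, Sep pos P Q) (hK' : ∀ P ∈ K', ∀ Q ∈ K', Sep pos' P Q)
    (hTK : ({i, j, k} : Set V) ∈ K) (hKU : ∀ P ∈ K, ∀ w ∈ P, w ∉ U)
    (hK'U : ∀ P ∈ K', ∀ w ∈ P, w ∈ U ∨ w ∈ ({i, j, k} : Set V))
    (hi : pos' i = pos i) (hj : pos' j = pos j) (hk : pos' k = pos k)
    (hin : ∀ w ∈ U, InTriangle (pos i) (pos j) (pos k) (pos' w))
    (hU : ∀ w ∈ U, {w} ∈ K')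
    (hij : ({i, j} : Set V) ∈ K') (hjk : ({j, k} : Set V) ∈ K') (hki : ({k, i} : Set V) ∈ K')
    (hcard : ∀ P ∈ K, ({i, j, k} : Set V) ⊆ P → P = {i, j, k})
    {n : V → ℚ × ℚ} (hnU : ∀ w ∈ U, n w = pos' w) (hn : ∀ w ∉ U, n w = pos w) :
    ∀ P ∈ (K \ {{i, j, k}}) ∪ K', ∀ Q ∈ (K \ {{i, j, k}}) ∪ K', Sep n P Q := by
  have hTU : ∀ w ∈ ({i, j, k} : Set V), w ∉ U := hKU _ hTK
  have hiU := hTU i (by simp)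
  have hjU := hTU j (by simp)
  have hkU := hTU k (by simp)
  have hTn : ∀ w ∈ ({i, j, k} : Set V), n w = pos' w := by
    rintro w (rfl | rfl | rfl)
    · rw [hn _ hiU, hi]
    · rw [hn _ hjU, hj]
    · rw [hn _ hkU, hk]
  have hn' : ∀ P ∈ K', ∀ w ∈ P, n w = pos' w := fun P hP w hw =>
    (hK'U P hP w hw).elim (hnU w) (hTn w)
  obtain ⟨nij, njk, nki⟩ := orient_ne_zero_ne hT
  have mixed : ∀ P ∈ K', ∀ Q ∈ K \ {{i, j, k}}, Sep n P Q := by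
    rintro P hP Q ⟨hQ, hQT⟩
    -- The functional that separates the whole triangle from Q serves for everything drawn inside
    -- the triangle, up to a tilt.
    obtain ⟨f, hf⟩ := hK _ hTK Q hQ
    have h0 : ∀ w ∈ ({i, j, k} : Set V), 0 ≤ aff f (pos w) := fun w hw => by
      by_cases hwQ : w ∈ Q
      · exact ((hf w).1 hw hwQ).ge
      · exact ((hf w).2.1 hw hwQ).le
    have hi0 := h0 i (by simp)
    have hj0 := h0 j (by simp)
    have hk0 := h0 k (by simp)
    have neU : ∀ w ∈ U, w ≠ i ∧ w ≠ j ∧ w ≠ k := fun w hw =>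
      ⟨fun h => hiU (h ▸ hw), fun h => hjU (h ▸ hw), fun h => hkU (h ▸ hw)⟩
    -- Q misses some corner c of the triangle, so f is positive at c. A new point is off the side
    -- opposite to c, because the inner drawing is planar and contains that side; hence f is
    -- positive there as well.
    have hUpos : ∀ w ∈ U, 0 < aff f (pos' w) := by
      intro w hw
      obtain ⟨n1, n2, n3⟩ := neU w hw
      have : ¬ ({i, j, k} : Set V) ⊆ Q := fun h => hQT (hcard Q hQ h)
      rw [Set.not_subset] at this
      obtain ⟨c, hc, hcQ⟩ := this
      have hpos := (hf c).2.1 hc hcQ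
      rcases hc with rfl | rfl | rfl
      · exact aff_pos_of_notMem_side hj0 hk0 hpos hj hk (hin w hw).rotate n2 n3
          (hK' _ (hU w hw) _ hjk)
      · exact aff_pos_of_notMem_side hk0 hi0 hpos hk hi (hin w hw).rotate.rotate n3 n1
          (hK' _ (hU w hw) _ hki)
      · exact aff_pos_of_notMem_side hi0 hj0 hpos hi hj (hin w hw) n1 n2
          (hK' _ (hU w hw) _ hij)
    have hnT : ∀ w ∈ ({i, j, k} : Set V), n w = pos w := fun w hw => hn w (hTU w hw)
    have hnQ : ∀ w ∈ Q, n w = pos w := fun w hw => hn w (hKU Q hQ w hw)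
    have hP0 : ∀ w ∈ P, 0 ≤ aff f (n w) := by
      intro w hw
      rcases hK'U P hP w hw with h | h
      · rw [hnU w h]; exact (hUpos w h).le
      · rw [hnT w h]; exact h0 w h
    have hQ0 : ∀ w ∈ Q, aff f (n w) ≤ 0 := by
      intro w hw
      rw [hnQ w hw]
      by_cases hwT : w ∈ ({i, j, k} : Set V)
      · exact ((hf w).1 hwT hw).le
      · exact ((hf w).2.2 hw hwT).le
    have hzero : ∀ w, w ∈ P ∨ w ∈ Q → aff f (n w) = 0 → w ∈ ({i, j, k} : Set V) ∧ w ∈ Q := by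
      rintro w (hw | hw) hz
      · rcases hK'U P hP w hw with h | h
        · rw [hnU w h] at hz; exact absurd hz (hUpos w h).ne'
        · refine ⟨h, ?_⟩
          by_contra hwQ
          rw [hnT w h] at hz
          exact absurd hz ((hf w).2.1 h hwQ).ne'
      · refine ⟨?_, hw⟩
        by_contra hwT
        rw [hnQ w hw] at hz
        exact absurd hz ((hf w).2.2 hw hwT).ne
    have : ¬ ({i, j, k} : Set V) ⊆ Q := fun h => hQT (hcard Q hQ h)
    rw [Set.not_subset] at this
    obtain ⟨c, hc, hcQ⟩ := this
    -- The zeros of f on P and Q are among the two corners other than c.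
    rcases hc with rfl | rfl | rfl
    · refine Sep.of_weak_of_zeros f (i := j) (j := k) (by rwa [hn _ hjU, hn _ hkU]) hP0 hQ0 ?_
      intro w hw hz
      obtain ⟨h1 | h1 | h1, h2⟩ := hzero w hw hz
      · exact absurd (h1 ▸ h2) hcQ
      · exact Or.inl h1
      · exact Or.inr h1
    · refine Sep.of_weak_of_zeros f (i := k) (j := i) (by rwa [hn _ hiU, hn _ hkU]) hP0 hQ0 ?_
      intro w hw hz
      obtain ⟨h1 | h1 | h1, h2⟩ := hzero w hw hz
      · exact Or.inr h1
      · exact absurd (h1 ▸ h2) hcQ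
      · exact Or.inl h1
    · refine Sep.of_weak_of_zeros f (i := i) (j := j) (by rwa [hn _ hiU, hn _ hjU]) hP0 hQ0 ?_
      intro w hw hz
      obtain ⟨h1 | h1 | h1, h2⟩ := hzero w hw hz
      · exact Or.inl h1
      · exact Or.inr h1
      · exact absurd (h1 ▸ h2) hcQ
  rintro P (hP | hP) Q (hQ | hQ)
  · exact (hK P hP.1 Q hQ.1).congr (fun w hw => hn w (hKU P hP.1 w hw))
      (fun w hw => hn w (hKU Q hQ.1 w hw))
  · exact (mixed Q hQ P hP).symm
  · exact mixed P hP Q hQ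
  · exact (hK' P hP Q hQ).congr (hn' P hP) (hn' Q hQ)

/-! ### Bar representations and their symmetries -/

/-- A bar representation with vertical edges: the vertex `w` is the bar `[l w, r w]` at height
`lev w`, and the edge `a → b` is the vertical segment at `x a b`. -/
structure Rep (V : Type*) where
  S : Set V
  A : V → V → Prop
  lev : V → ℤ
  l : V → ℤ
  r : V → ℤ
  x : V → V → ℤ

namespace Rep

/-- Distinct levels keep the bars disjoint, and `pass` is the only further planarity condition:
edges with a common tail then have different abscissas automatically (`Valid.x_ne`). -/
structure Valid (H : Rep V) : Prop where
  inj : ∀ a ∈ H.S, ∀ b ∈ H.S, H.lev a = H.lev b → a = b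
  tail_mem : ∀ {a b}, H.A a b → a ∈ H.S
  head_mem : ∀ {a b}, H.A a b → b ∈ H.S
  up : ∀ {a b}, H.A a b → H.lev a < H.lev b
  lr : ∀ a ∈ H.S, H.l a ≤ H.r a
  tail_l : ∀ {a b}, H.A a b → H.l a ≤ H.x a b
  tail_r : ∀ {a b}, H.A a b → H.x a b ≤ H.r a
  head_l : ∀ {a b}, H.A a b → H.l b ≤ H.x a b
  head_r : ∀ {a b}, H.A a b → H.x a b ≤ H.r b
  pass : ∀ {a b w}, H.A a b → w ∈ H.S → H.lev a < H.lev w → H.lev w < H.lev b →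
    H.x a b < H.l w ∨ H.r w < H.x a b

/-- Reflection in a vertical line. -/
def mirror (H : Rep V) : Rep V where
  S := H.S
  A := H.A
  lev := H.lev
  l w := -H.r w
  r w := -H.l w
  x a b := -H.x a b

/-- Reflection in a horizontal line; the edges are reversed. -/
def flip (H : Rep V) : Rep V where
  S := H.S
  A a b := H.A b a
  lev w := -H.lev w
  l := H.l
  r := H.r
  x a b := H.x b a

/-- The induced subrepresentation. -/
def restrict (H : Rep V) (T : Set V) : Rep V where
  S := H.S ∩ T
  A a b := H.A a b ∧ a ∈ T ∧ b ∈ T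
  lev := H.lev
  l := H.l
  r := H.r
  x := H.x

variable {H : Rep V}

theorem mirror_mirror (H : Rep V) : H.mirror.mirror = H := by
  simp [mirror]

theorem Valid.mirror (h : H.Valid) : H.mirror.Valid where
  inj := h.inj
  tail_mem := h.tail_mem
  head_mem := h.head_mem
  up := h.up
  lr a ha := neg_le_neg (h.lr a ha)
  tail_l hab := neg_le_neg (h.tail_r hab)
  tail_r hab := neg_le_neg (h.tail_l hab)
  head_l hab := neg_le_neg (h.head_r hab)
  head_r hab := neg_le_neg (h.head_l hab)
  pass hab hw h1 h2 := (h.pass hab hw h1 h2).symm.imp neg_lt_neg neg_lt_neg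

theorem Valid.flip (h : H.Valid) : H.flip.Valid where
  inj a ha b hb hab := h.inj a ha b hb (neg_injective hab)
  tail_mem hab := h.head_mem hab
  head_mem hab := h.tail_mem hab
  up hab := neg_lt_neg (h.up hab)
  lr := h.lr
  tail_l hab := h.head_l hab
  tail_r hab := h.head_r hab
  head_l hab := h.tail_l hab
  head_r hab := h.tail_r hab
  pass hab hw h1 h2 := h.pass hab hw (neg_lt_neg_iff.1 h2) (neg_lt_neg_iff.1 h1)

theorem Valid.restrict (h : H.Valid) (T : Set V) : (H.restrict T).Valid where
  inj a ha b hb hab := h.inj a ha.1 b hb.1 hab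
  tail_mem hab := ⟨h.tail_mem hab.1, hab.2.1⟩
  head_mem hab := ⟨h.head_mem hab.1, hab.2.2⟩
  up hab := h.up hab.1
  lr a ha := h.lr a ha.1
  tail_l hab := h.tail_l hab.1
  tail_r hab := h.tail_r hab.1
  head_l hab := h.head_l hab.1
  head_r hab := h.head_r hab.1
  pass hab hw := h.pass hab.1 hw.1

/-- `s` is the lowest vertex, `z` is the highest one, the edge `s → z` is the left boundary and
the path `s → u → z` is the right boundary. -/
structure Framed (H : Rep V) (s u z : V) : Prop where
  sz : H.A s z
  su : H.A s u
  uz : H.A u z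
  bot : ∀ w ∈ H.S, w ≠ s → H.lev s < H.lev w
  top : ∀ w ∈ H.S, w ≠ z → H.lev w < H.lev z
  left : ∀ w ∈ H.S, w ≠ s → w ≠ z → H.x s z < H.l w
  right_below : ∀ w ∈ H.S, w ≠ s → H.lev w < H.lev u → H.r w < H.x s u
  right_above : ∀ w ∈ H.S, w ≠ z → H.lev u < H.lev w → H.r w < H.x u z

theorem Framed.flip {s u z : V} (h : H.Framed s u z) : H.flip.Framed z u s where
  sz := h.sz
  su := h.uz
  uz := h.su
  bot w hw hne := neg_lt_neg (h.top w hw hne)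
  top w hw hne := neg_lt_neg (h.bot w hw hne)
  left w hw h1 h2 := h.left w hw h2 h1
  right_below w hw h1 h2 := h.right_above w hw h1 (neg_lt_neg_iff.1 h2)
  right_above w hw h1 h2 := h.right_below w hw h1 (neg_lt_neg_iff.1 h2)

/-! ### The second lowest vertex and the regions cut off by double edges -/

/-- `s` is the lowest vertex, `v` is the second lowest one, and `s → v` is an edge. -/
structure Low (H : Rep V) (s v : V) : Prop where
  valid : H.Valid
  sv : H.A s v
  bot : ∀ w ∈ H.S, w ≠ s → H.lev s < H.lev w
  low : ∀ w ∈ H.S, w ≠ s → w ≠ v → H.lev v < H.lev w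

theorem Low.mirror {s v : V} (h : H.Low s v) : H.mirror.Low s v where
  valid := h.valid.mirror
  sv := h.sv
  bot := h.bot
  low := h.low

/-- `y` is joined to `v`, and it is joined to `s` by an edge that passes to the left of `v`. -/
def DupL (H : Rep V) (s v y : V) : Prop := H.A s y ∧ H.A v y ∧ H.x s y < H.l v

/-- `w` lies in the region bounded by the edges `s → y` and `v → y`. -/
def Region (H : Rep V) (s v y w : V) : Prop :=
  w ∈ H.S ∧ H.lev v < H.lev w ∧ H.lev w < H.lev y ∧ H.x s y < H.l w ∧ H.r w < H.x v y

/-- `w` lies in some region to the left of the edge `s → v`. -/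
def InL (H : Rep V) (s v w : V) : Prop := ∃ y, H.DupL s v y ∧ H.Region s v y w

namespace Low

variable {s v : V} (h : H.Low s v)
include h

theorem lev_sv : H.lev s < H.lev v := h.valid.up h.sv

theorem s_mem : s ∈ H.S := h.valid.tail_mem h.sv

theorem v_mem : v ∈ H.S := h.valid.head_mem h.sv

theorem s_ne_v : s ≠ v := fun e => (h.lev_sv).ne (congrArg _ e)

theorem tail_eq {a : V} (hav : H.A a v) : a = s := by
  by_contra hne
  have h1 := h.valid.up hav
  by_cases hv : a = v
  · subst hv; exact lt_irrefl _ h1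
  · exact lt_asymm h1 (h.low a (h.valid.tail_mem hav) hne hv)

theorem not_to_s {a : V} (has : H.A a s) : False := by
  have h1 := h.valid.up has
  have h2 : a ≠ s := by rintro rfl; exact lt_irrefl _ h1
  exact lt_asymm h1 (h.bot a (h.valid.tail_mem has) h2)

/-- An edge from `s` passes to the left or to the right of `v`, unless it ends there. -/
theorem side {y : V} (hy : H.A s y) (hne : y ≠ v) : H.x s y < H.l v ∨ H.r v < H.x s y := by
  have hys : y ≠ s := by rintro rfl; exact lt_irrefl _ (h.valid.up hy)
  exact h.valid.pass hy h.v_mem h.lev_sv (h.low y (h.valid.head_mem hy) hys hne)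

/-- The edge v → m starts between the two edges that bound the region. It cannot get past the bar of
y, which closes the region at the top, and the bar of m cannot cross the bounding edges. -/
theorem region_of_v {y m : V} (hy : H.DupL s v y) (hm : H.A v m) (hne : m ≠ y)
    (hx : H.x v m ≤ H.x v y) : H.Region s v y m := by
  obtain ⟨hsy, hvy, hl⟩ := hy
  have a1 := h.valid.tail_l hm
  have a2 := h.valid.head_l hsy
  have a3 := h.valid.head_r hvy
  have a4 := h.valid.head_l hm
  have a5 := h.valid.head_r hm
  have vm := h.valid.up hm
  have vy := h.valid.up hvy
  have sv := h.lev_sv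
  have mS := h.valid.head_mem hm
  have lt : H.lev m < H.lev y := by
    by_contra hcon
    have : H.lev y ≠ H.lev m := fun e => hne (h.valid.inj _ mS _ (h.valid.head_mem hvy) e.symm)
    have := h.valid.pass hm (h.valid.head_mem hvy) vy (by omega)
    omega
  have p1 := h.valid.pass hvy mS vm lt
  have p2 := h.valid.pass hsy mS (by omega) lt
  exact ⟨mS, vm, lt, by omega, by omega⟩

theorem region_of_s {y m : V} (hy : H.DupL s v y) (hm : H.A s m) (hne : m ≠ y)
    (hx : H.x s y ≤ H.x s m) (hx' : H.x s m < H.l v) : H.Region s v y m := by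
  obtain ⟨hsy, hvy, hl⟩ := hy
  have a1 := h.valid.tail_l hvy
  have a2 := h.valid.head_l hsy
  have a3 := h.valid.head_r hvy
  have a4 := h.valid.head_l hm
  have a5 := h.valid.head_r hm
  have vy := h.valid.up hvy
  have sv := h.lev_sv
  have mS := h.valid.head_mem hm
  have ms : m ≠ s := by rintro rfl; exact lt_irrefl _ (h.valid.up hm)
  have mv : m ≠ v := by rintro rfl; omega
  have vm := h.low m mS ms mv
  have lt : H.lev m < H.lev y := by
    by_contra hcon
    have : H.lev y ≠ H.lev m := fun e => hne (h.valid.inj _ mS _ (h.valid.head_mem hvy) e.symm)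
    have := h.valid.pass hm (h.valid.head_mem hvy) (by omega) (by omega)
    omega
  have p1 := h.valid.pass hvy mS vm lt
  have p2 := h.valid.pass hsy mS (by omega) lt
  exact ⟨mS, vm, lt, by omega, by omega⟩

/-- Together with `region_tail` this shows that a region is attached to the rest of the graph only
at s, v and y: the bar of y and the two bounding edges block every other way out. -/
theorem region_head {y w b : V} (hy : H.DupL s v y) (hw : H.Region s v y w) (hwb : H.A w b) :
    b = y ∨ H.Region s v y b := by
  obtain ⟨hsy, hvy, hl⟩ := hy
  obtain ⟨wS, w1, w2, w3, w4⟩ := hw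
  have a1 := h.valid.tail_l hwb
  have a2 := h.valid.tail_r hwb
  have a3 := h.valid.head_l hwb
  have a4 := h.valid.head_r hwb
  have a5 := h.valid.head_l hsy
  have a6 := h.valid.head_r hvy
  have sv := h.lev_sv
  have wb := h.valid.up hwb
  have bS := h.valid.head_mem hwb
  by_cases hne : b = y
  · exact Or.inl hne
  right
  have lt : H.lev b < H.lev y := by
    by_contra hcon
    have : H.lev y ≠ H.lev b := fun e => hne (h.valid.inj _ bS _ (h.valid.head_mem hvy) e.symm)
    have := h.valid.pass hwb (h.valid.head_mem hvy) w2 (by omega)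
    omega
  have p1 := h.valid.pass hvy bS (by omega) lt
  have p2 := h.valid.pass hsy bS (by omega) lt
  exact ⟨bS, by omega, lt, by omega, by omega⟩

theorem region_tail {y w a : V} (hy : H.DupL s v y) (hw : H.Region s v y w) (haw : H.A a w) :
    a = s ∨ a = v ∨ H.Region s v y a := by
  obtain ⟨hsy, hvy, hl⟩ := hy
  obtain ⟨wS, w1, w2, w3, w4⟩ := hw
  have a1 := h.valid.tail_l haw
  have a2 := h.valid.tail_r haw
  have a3 := h.valid.head_l haw
  have a4 := h.valid.head_r haw
  have sv := h.lev_sv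
  have wb := h.valid.up haw
  have aS := h.valid.tail_mem haw
  by_cases h1 : a = s
  · exact Or.inl h1
  by_cases h2 : a = v
  · exact Or.inr (Or.inl h2)
  right; right
  have h3 := h.low a aS h1 h2
  have p1 := h.valid.pass hvy aS h3 (by omega)
  have p2 := h.valid.pass hsy aS (by omega) (by omega)
  exact ⟨aS, h3, by omega, by omega, by omega⟩

/-- The regions on one side are nested, and the one whose edge from s is leftmost contains all
others. Its top vertex y is in no region, since membership would put y below itself. -/
theorem exists_outermost [Finite V] {w : V} (hw : H.InL s v w) :
    ∃ y, H.DupL s v y ∧ (∀ m, H.InL s v m ↔ H.Region s v y m) ∧ ¬ H.InL s v y := by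
  obtain ⟨y1, hy1, -⟩ := hw
  obtain ⟨y, hy, hmin⟩ := Set.exists_min_image {y | H.DupL s v y} (fun y => H.x s y)
    (Set.toFinite _) ⟨y1, hy1⟩
  have hreg : ∀ m, H.InL s v m → H.Region s v y m := by
    rintro m ⟨y', hy', hm⟩
    by_cases hne : y' = y
    · exact hne ▸ hm
    have hxx := hmin y' hy'
    have hr := h.region_of_s hy hy'.1 hne hxx hy'.2.2
    obtain ⟨-, -, r1, r2, r3⟩ := hr
    obtain ⟨m0, m1, m2, m3, m4⟩ := hm
    have := h.valid.head_r hy'.2.1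
    exact ⟨m0, m1, by omega, by omega, by omega⟩
  refine ⟨y, hy, fun m => ⟨hreg m, fun hm => ⟨y, hy, hm⟩⟩, fun hc => ?_⟩
  exact lt_irrefl _ (hreg y hc).2.2.1

/-- Of two double edges on the same side, the one whose edge from s is nearer to v ends inside the
region of the other. -/
theorem dupL_unique {y y' : V} (hy : H.DupL s v y) (hy' : H.DupL s v y') (hn : ¬ H.InL s v y)
    (hn' : ¬ H.InL s v y') : y = y' := by
  by_contra hne
  rcases le_total (H.x s y) (H.x s y') with hle | hle
  · exact hn' ⟨y, hy, h.region_of_s hy hy'.1 (Ne.symm hne) hle hy'.2.2⟩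
  · exact hn ⟨y', hy', h.region_of_s hy' hy.1 hne hle hy.2.2⟩

/-- Otherwise y' would lie in the left region of y, hence left of an edge of v, whereas the edge s →
y' reaches the bar of y' to the right of v. -/
theorem dup_lt {y y' : V} (hy : H.DupL s v y) (hy' : H.mirror.DupL s v y') :
    H.x v y < H.x v y' := by
  by_contra hcon
  have hvy' : H.A v y' := hy'.2.1
  have hr : -H.x s y' < -H.r v := hy'.2.2
  have hl := hy.2.2
  have hlr := h.valid.lr v h.v_mem
  have hne : y' ≠ y := by rintro rfl; omega
  have := h.region_of_v hy hvy' hne (by omega)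
  have h1 := this.2.2.2.2
  have h2 := h.valid.tail_r hy.2.1
  have h3 := h.valid.head_r (show H.A s y' from hy'.1)
  omega

theorem not_inL_inR {w : V} (hw : H.InL s v w) (hw' : H.mirror.InL s v w) : False := by
  obtain ⟨y, hy, w0, w1, w2, w3, w4⟩ := hw
  obtain ⟨y', hy', v0, v1, v2, v3, v4⟩ := hw'
  have := h.dup_lt hy hy'
  have hlr := h.valid.lr w w0
  have v4' : -H.l w < -H.x v y' := v4
  omega

theorem not_inL_s : ¬ H.InL s v s := by
  rintro ⟨y, hy, w0, w1, -⟩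
  exact lt_asymm w1 h.lev_sv

theorem not_inL_v : ¬ H.InL s v v := by
  rintro ⟨y, hy, w0, w1, -⟩
  exact lt_irrefl _ w1

end Low

/-! ### Contraction of the second lowest vertex -/

/-- The vertices outside the regions that are cut off by double edges. -/
def core (H : Rep V) (s v : V) : Set V := {w | w ∈ H.S ∧ ¬ H.InL s v w ∧ ¬ H.mirror.InL s v w}

theorem core_mirror (H : Rep V) (s v : V) : H.mirror.core s v = H.core s v := by
  ext w
  simp only [core, mirror_mirror, Set.mem_ofPred_eq]
  exact and_congr Iff.rfl and_comm

open Classical in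
/-- The contraction of `v` into `s`. -/
noncomputable def contract (H : Rep V) (s v : V) : Rep V where
  S := H.core s v \ {v}
  A a b := a ∈ H.core s v \ {v} ∧ b ∈ H.core s v \ {v} ∧ (H.A a b ∨ a = s ∧ H.A v b)
  lev := H.lev
  l := H.l
  r := H.r
  -- When s → b and v → b are both present, the abscissa of v → b is kept. No core vertex lies
  -- between the two, so the order of the edges is not disturbed.
  x a b := if a = s ∧ H.A v b then H.x v b else H.x a b

theorem contract_x_of_ne {s v a b : V} (ha : a ≠ s) : (H.contract s v).x a b = H.x a b := by
  simp [contract, ha]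

theorem contract_x_of_not {s v b : V} (hb : ¬ H.A v b) : (H.contract s v).x s b = H.x s b := by
  simp [contract, hb]

theorem contract_x_of_adj {s v b : V} (hb : H.A v b) : (H.contract s v).x s b = H.x v b := by
  simp [contract, hb]

/-- The part of the representation in the region bounded by `s → y`, `s → v → y`. -/
def inner (H : Rep V) (s v y : V) : Rep V :=
  H.restrict ({s, v, y} ∪ {w | H.Region s v y w})

/-- The region on the left of v is again a frame, with s → y as left boundary and s → v → y as right
boundary, so v plays the role of u. -/
theorem Low.inner_framed {s v y : V} (h : H.Low s v) (hy : H.DupL s v y) :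
    (H.inner s v y).Framed s v y := by
  obtain ⟨hsy, hvy, hl⟩ := hy
  have sv := h.lev_sv
  have vy := h.valid.up hvy
  have vrl := h.valid.tail_r hvy
  refine ⟨⟨hsy, by simp, by simp⟩, ⟨h.sv, by simp, by simp⟩, ⟨hvy, by simp, by simp⟩, ?_, ?_, ?_,
    ?_, ?_⟩
  · rintro w ⟨hw, -⟩ hne
    exact h.bot w hw hne
  · rintro w ⟨hw, (rfl | rfl | rfl) | hr⟩ hne
    · exact sv.trans vy
    · exact vy
    · exact absurd rfl hne
    · exact hr.2.2.1
  · rintro w ⟨hw, (rfl | rfl | rfl) | hr⟩ hs hne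
    · exact absurd rfl hs
    · exact hl
    · exact absurd rfl hne
    · exact hr.2.2.2.1
  · rintro w ⟨hw, (rfl | rfl | rfl) | hr⟩ hs hlt
    · exact absurd rfl hs
    · exact absurd hlt (lt_irrefl _)
    · exact absurd hlt (lt_asymm vy)
    · exact absurd hlt (lt_asymm hr.2.1)
  · rintro w ⟨hw, (rfl | rfl | rfl) | hr⟩ hs hlt
    · exact absurd hlt (lt_asymm sv)
    · exact absurd hlt (lt_irrefl _)
    · exact absurd rfl hs
    · exact hr.2.2.2.2

section FramedLow

variable {s u z v : V} (h : H.Low s v) (hF : H.Framed s u z) (hvu : v ≠ u) (hvz : v ≠ z)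
include h hF hvu hvz

theorem lev_vu : H.lev v < H.lev u := by
  refine h.low u (h.valid.head_mem hF.su) ?_ (Ne.symm hvu)
  rintro rfl; exact lt_irrefl _ (h.valid.up hF.su)

theorem xsz_lt_lv : H.x s z < H.l v := hF.left v h.v_mem h.s_ne_v.symm hvz

theorem rv_lt_xsu : H.r v < H.x s u :=
  hF.right_below v h.v_mem h.s_ne_v.symm (lev_vu h hF hvu hvz)

theorem core_s : s ∈ H.core s v := ⟨h.s_mem, h.not_inL_s, h.mirror.not_inL_s⟩

theorem core_v : v ∈ H.core s v := ⟨h.v_mem, h.not_inL_v, h.mirror.not_inL_v⟩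

theorem core_z : z ∈ H.core s v := by
  have hz := h.valid.head_mem hF.sz
  refine ⟨hz, ?_, ?_⟩
  · rintro ⟨y, hy, -, -, h1, -⟩
    have : y ≠ z := by rintro rfl; exact lt_irrefl _ h1
    exact lt_asymm h1 (hF.top y (h.valid.head_mem hy.1) this)
  · rintro ⟨y, hy, -, -, h1, -⟩
    have : y ≠ z := by rintro rfl; exact lt_irrefl _ h1
    exact lt_asymm h1 (hF.top y (h.valid.head_mem hy.1) this)

theorem core_u : u ∈ H.core s v := by
  have hu := h.valid.head_mem hF.su
  have ruv := rv_lt_xsu h hF hvu hvz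
  have hxu := h.valid.head_r hF.su
  refine ⟨hu, ?_, ?_⟩
  · rintro ⟨y, hy, -, -, -, -, h1⟩
    have := h.valid.tail_r hy.2.1
    omega
  · rintro ⟨y, hy, -, -, h0, h2, -⟩
    have h2' : -H.x s y < -H.r u := h2
    have h0' : H.lev u < H.lev y := h0
    have h3 : -H.x s y < -H.r v := hy.2.2
    have hyz : y ≠ z := by
      rintro rfl
      have := xsz_lt_lv h hF hvu hvz
      have := h.valid.lr v h.v_mem
      omega
    have h4 := h.valid.head_r (show H.A s y from hy.1)
    have h5 := hF.right_above y (h.valid.head_mem hy.1) hyz h0'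
    have h6 := h.valid.tail_r hF.uz
    omega

/-- The boundary edges s → z and s → u pass v on either side, so the bar of s reaches beyond that of
v and can carry the edges of v. Prolonging them down to s meets no new bar, since no level lies
between s and v. -/
theorem contract_valid : (H.contract s v).Valid := by
  have hl : H.l s ≤ H.l v := by
    have := xsz_lt_lv h hF hvu hvz
    have := h.valid.tail_l hF.sz
    omega
  have hr : H.r v ≤ H.r s := by
    have := rv_lt_xsu h hF hvu hvz
    have := h.valid.tail_r hF.su
    omega
  have hsv := h.lev_sv
  have hlow : ∀ w ∈ H.core s v \ {v}, H.lev s < H.lev w → H.lev v < H.lev w := by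
    rintro w ⟨hw, hwv⟩ hlt
    refine h.low w hw.1 ?_ hwv
    rintro rfl; exact lt_irrefl _ hlt
  have key : ∀ a b, (H.contract s v).A a b →
      (H.A a b ∧ (H.contract s v).x a b = H.x a b) ∨
      (a = s ∧ H.A v b ∧ (H.contract s v).x a b = H.x v b) := by
    rintro a b ⟨-, -, hab⟩
    by_cases h1 : a = s ∧ H.A v b
    · right
      obtain ⟨rfl, h1⟩ := h1
      exact ⟨rfl, h1, contract_x_of_adj h1⟩
    · left
      refine ⟨hab.resolve_right h1, ?_⟩
      simp only [contract, if_neg h1]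
  constructor
  · intro a ha b hb hab; exact h.valid.inj a ha.1.1 b hb.1.1 hab
  · intro a b hab; exact hab.1
  · intro a b hab; exact hab.2.1
  · intro a b hab
    rcases key a b hab with ⟨h1, -⟩ | ⟨rfl, h1, -⟩
    · exact h.valid.up h1
    · exact hsv.trans (h.valid.up h1)
  · intro a ha; exact h.valid.lr a ha.1.1
  · intro a b hab
    rcases key a b hab with ⟨h1, h2⟩ | ⟨rfl, h1, h2⟩
    · rw [h2]; exact h.valid.tail_l h1
    · rw [h2]; exact hl.trans (h.valid.tail_l h1)
  · intro a b hab
    rcases key a b hab with ⟨h1, h2⟩ | ⟨rfl, h1, h2⟩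
    · rw [h2]; exact h.valid.tail_r h1
    · rw [h2]; exact (h.valid.tail_r h1).trans hr
  · intro a b hab
    rcases key a b hab with ⟨h1, h2⟩ | ⟨rfl, h1, h2⟩
    · rw [h2]; exact h.valid.head_l h1
    · rw [h2]; exact h.valid.head_l h1
  · intro a b hab
    rcases key a b hab with ⟨h1, h2⟩ | ⟨rfl, h1, h2⟩
    · rw [h2]; exact h.valid.head_r h1
    · rw [h2]; exact h.valid.head_r h1
  · intro a b w hab hw h3 h4
    rcases key a b hab with ⟨h1, h2⟩ | ⟨rfl, h1, h2⟩
    · rw [h2]; exact h.valid.pass h1 hw.1.1 h3 h4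
    · rw [h2]; exact h.valid.pass h1 hw.1.1 (hlow w hw h3) h4

/-- A boundary edge changes its abscissa only if v is also joined to its head. A bar between the old
and the new abscissa would lie in the region of that double edge and is not in the core. -/
theorem contract_framed : (H.contract s v).Framed s u z := by
  have hs : s ∈ H.core s v \ {v} := ⟨core_s h hF hvu hvz, h.s_ne_v⟩
  have hu : u ∈ H.core s v \ {v} := ⟨core_u h hF hvu hvz, Ne.symm hvu⟩
  have hz : z ∈ H.core s v \ {v} := ⟨core_z h hF hvu hvz, Ne.symm hvz⟩
  have us : u ≠ s := by rintro rfl; exact lt_irrefl _ (h.valid.up hF.su)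
  refine ⟨⟨hs, hz, Or.inl hF.sz⟩, ⟨hs, hu, Or.inl hF.su⟩, ⟨hu, hz, Or.inl hF.uz⟩, ?_, ?_, ?_, ?_, ?_⟩
  · intro w hw hne; exact hF.bot w hw.1.1 hne
  · intro w hw hne; exact hF.top w hw.1.1 hne
  · intro w hw h1 h2
    show _ < H.l w
    have hx := hF.left w hw.1.1 h1 h2
    by_cases hvz' : H.A v z
    · rw [contract_x_of_adj hvz']
      have hlt := h.low w hw.1.1 h1 hw.2
      have hlz := hF.top w hw.1.1 h2
      rcases h.valid.pass hvz' hw.1.1 hlt hlz with h3 | h3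
      · exact h3
      · exact absurd ⟨z, ⟨hF.sz, hvz', xsz_lt_lv h hF hvu hvz⟩, hw.1.1, hlt, hlz, hx, h3⟩ hw.1.2.1
    · rwa [contract_x_of_not hvz']
  · intro w hw h1 h2
    show H.r w < _
    have hx := hF.right_below w hw.1.1 h1 h2
    by_cases hvu' : H.A v u
    · rw [contract_x_of_adj hvu']
      have hlt := h.low w hw.1.1 h1 hw.2
      rcases h.valid.pass hvu' hw.1.1 hlt h2 with h3 | h3
      · refine absurd ⟨u, ⟨hF.su, hvu', neg_lt_neg (rv_lt_xsu h hF hvu hvz)⟩, hw.1.1, hlt, h2,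
          neg_lt_neg hx, neg_lt_neg h3⟩ hw.1.2.2
      · exact h3
    · rwa [contract_x_of_not hvu']
  · intro w hw h1 h2
    rw [contract_x_of_ne us]
    exact hF.right_above w hw.1.1 h1 h2

end FramedLow

/-! ### Straight-line drawings of bar representations -/

/-- The vertices and edges of a representation, as sets of vertices. -/
def cells (H : Rep V) : Set (Set V) := {P | (∃ a ∈ H.S, P = {a}) ∨ ∃ a b, H.A a b ∧ P = {a, b}}

/-- A planar straight-line drawing that respects the order of the edges at the lowest and at the
highest vertex. -/
structure Draws (H : Rep V) (s z : V) (pos : V → ℚ × ℚ) : Prop where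
  up : ∀ {a b}, H.A a b → (pos a).2 < (pos b).2
  sep : ∀ P ∈ H.cells, ∀ Q ∈ H.cells, Sep pos P Q
  tail_order : ∀ {y y'}, H.A s y → H.A s y' → H.x s y < H.x s y' →
    orient (pos s) (pos y) (pos y') < 0
  head_order : ∀ {y y'}, H.A y z → H.A y' z → H.x y z < H.x y' z →
    0 < orient (pos z) (pos y) (pos y')

end Rep

theorem Sep.mirror {pos : V → ℚ × ℚ} {P Q : Set V} (h : Sep pos P Q) :
    Sep (fun w => (-(pos w).1, (pos w).2)) P Q := by
  obtain ⟨f, hf⟩ := h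
  refine ⟨(-f.1, f.2.1, f.2.2), fun i => ?_⟩
  have : aff (-f.1, f.2.1, f.2.2) (-(pos i).1, (pos i).2) = aff f (pos i) := by
    simp only [aff]; ring
  simp only [this]
  exact hf i

theorem Sep.flip {pos : V → ℚ × ℚ} {P Q : Set V} (h : Sep pos P Q) :
    Sep (fun w => ((pos w).1, -(pos w).2)) P Q := by
  obtain ⟨f, hf⟩ := h
  refine ⟨(f.1, -f.2.1, f.2.2), fun i => ?_⟩
  have : aff (f.1, -f.2.1, f.2.2) ((pos i).1, -(pos i).2) = aff f (pos i) := by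
    simp only [aff]; ring
  simp only [this]
  exact hf i

theorem InTriangle.mirror {p q t z : ℚ × ℚ} (h : InTriangle p q t z) :
    InTriangle (-p.1, p.2) (-q.1, q.2) (-t.1, t.2) (-z.1, z.2) := by
  obtain ⟨a, b, c, ha, hb, hc, habc, rfl⟩ := h
  exact ⟨a, b, c, ha, hb, hc, habc, by ext <;> simp only; ring⟩

theorem InTriangle.flip {p q t z : ℚ × ℚ} (h : InTriangle p q t z) :
    InTriangle (t.1, -t.2) (q.1, -q.2) (p.1, -p.2) (z.1, -z.2) := by
  obtain ⟨a, b, c, ha, hb, hc, habc, rfl⟩ := h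
  exact ⟨c, b, a, hc, hb, ha, by linarith, by ext <;> simp only <;> ring⟩

namespace Rep

variable {H : Rep V} {s u z : V}

theorem Draws.mirror {pos : V → ℚ × ℚ} (h : H.mirror.Draws s z pos) :
    H.Draws s z (fun w => (-(pos w).1, (pos w).2)) where
  up hab := h.up hab
  sep P hP Q hQ := (h.sep P hP Q hQ).mirror
  tail_order {y y'} hy hy' hlt := by
    have := h.tail_order (y := y') (y' := y) hy' hy (neg_lt_neg hlt)
    simp only [orient] at this ⊢; linarith
  head_order {y y'} hy hy' hlt := by
    have := h.head_order (y := y') (y' := y) hy' hy (neg_lt_neg hlt)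
    simp only [orient] at this ⊢; linarith

theorem Draws.flip {pos : V → ℚ × ℚ} (h : H.flip.Draws z s pos) :
    H.Draws s z (fun w => ((pos w).1, -(pos w).2)) where
  up hab := neg_lt_neg (h.up hab)
  sep := by
    have : H.cells = H.flip.cells := by
      ext P
      simp only [cells, Rep.flip]
      constructor <;>
      · rintro (h | ⟨a, b, h, rfl⟩)
        · exact Or.inl h
        · exact Or.inr ⟨b, a, h, Set.pair_comm _ _⟩
    rw [this]
    exact fun P hP Q hQ => (h.sep P hP Q hQ).flip
  tail_order {y y'} hy hy' hlt := by
    have := h.head_order (y := y) (y' := y') hy hy' hlt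
    simp only [orient] at this ⊢; linarith
  head_order {y y'} hy hy' hlt := by
    have := h.tail_order (y := y) (y' := y') hy hy' hlt
    simp only [orient] at this ⊢; linarith

/-- `H` can be drawn in every upward triangle of the right orientation, with `s`, `u`, `z` at the
corners. -/
def Drawable (H : Rep V) (s u z : V) : Prop :=
  ∀ p q t : ℚ × ℚ, p.2 < q.2 → q.2 < t.2 → orient p t q < 0 →
    ∃ pos, H.Draws s z pos ∧ pos s = p ∧ pos u = q ∧ pos z = t ∧
      ∀ w ∈ H.S, InTriangle p q t (pos w)

theorem Drawable.of_flip (h : H.flip.Drawable z u s) : H.Drawable s u z := by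
  intro p q t hpq hqt ho
  obtain ⟨pos, hd, h1, h2, h3, h4⟩ := h (t.1, -t.2) (q.1, -q.2) (p.1, -p.2) (neg_lt_neg hqt)
    (neg_lt_neg hpq) (by simp only [orient] at ho ⊢; linarith)
  refine ⟨_, hd.flip, by simp [h3], by simp [h2], by simp [h1], fun w hw => ?_⟩
  simpa using (h4 w hw).flip

end Rep

theorem Sep.of_subset_pair [Finite V] {pos : V → ℚ × ℚ} {i j : V} (h : pos i ≠ pos j)
    {P Q : Set V} (hP : P ⊆ {i, j}) (hQ : Q ⊆ {i, j}) : Sep pos P Q := by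
  refine Sep.of_weak_of_zeros (0, 0, 0) h (fun w _ => by simp [aff]) (fun w _ => by simp [aff]) ?_
  rintro w (hw | hw) -
  · exact hP hw
  · exact hQ hw

namespace Rep

variable {H : Rep V} {s u z v : V}

/-! ### Edge order at the contracted vertex and the placement of v -/

theorem contract_mirror_x (H : Rep V) (s v a b : V) :
    (H.mirror.contract s v).x a b = -(H.contract s v).x a b := by
  by_cases h : a = s ∧ H.A v b
  · exact (if_pos h : (H.mirror.contract s v).x a b = H.mirror.x v b).trans
      (congrArg Neg.neg (if_pos h : (H.contract s v).x a b = H.x v b).symm)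
  · exact (if_neg h : (H.mirror.contract s v).x a b = H.mirror.x a b).trans
      (congrArg Neg.neg (if_neg h : (H.contract s v).x a b = H.x a b).symm)

/-- Among the edges of the contracted vertex, those of `s` to the left of `v` come before those
of `v`. -/
theorem contract_x_lt_of_left (h : H.Low s v) {y m : V} (hm : m ∈ H.core s v)
    (hsy : H.A s y) (hl : H.x s y < H.l v) (hvm : H.A v m) (hne : y ≠ m) :
    (H.contract s v).x s y < (H.contract s v).x s m := by
  have h1 := h.valid.tail_l hvm
  rw [contract_x_of_adj hvm]
  by_cases hvy : H.A v y
  · rw [contract_x_of_adj hvy]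
    by_contra hcon
    exact hm.2.1 ⟨y, ⟨hsy, hvy, hl⟩,
      h.region_of_v ⟨hsy, hvy, hl⟩ hvm (Ne.symm hne) (not_lt.1 hcon)⟩
  · rw [contract_x_of_not hvy]; omega

theorem contract_x_lt_of_right (h : H.Low s v) {y m : V} (hm : m ∈ H.core s v)
    (hsy : H.A s y) (hr : H.r v < H.x s y) (hvm : H.A v m) (hne : y ≠ m) :
    (H.contract s v).x s m < (H.contract s v).x s y := by
  have := contract_x_lt_of_left h.mirror (y := y) (m := m) (by rwa [core_mirror]) hsy
    (neg_lt_neg hr) hvm hne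
  rw [contract_mirror_x, contract_mirror_x] at this
  exact neg_lt_neg_iff.1 this

theorem contract_x_lt_of_left_of_left (h : H.Low s v) {y y' : V} (hy' : y' ∈ H.core s v)
    (hsy : H.A s y) (hsy' : H.A s y') (hl' : H.x s y' < H.l v)
    (hlt : H.x s y < H.x s y') : (H.contract s v).x s y < (H.contract s v).x s y' := by
  have hne : y' ≠ y := by rintro rfl; exact lt_irrefl _ hlt
  by_cases hvy : H.A v y
  · exact absurd ⟨y, ⟨hsy, hvy, hlt.trans hl'⟩,
      h.region_of_s ⟨hsy, hvy, hlt.trans hl'⟩ hsy' hne hlt.le hl'⟩ hy'.2.1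
  · rw [contract_x_of_not hvy]
    by_cases hvy' : H.A v y'
    · rw [contract_x_of_adj hvy']
      have := h.valid.tail_l hvy'
      omega
    · rwa [contract_x_of_not hvy']

theorem contract_x_lt_of_right_of_right (h : H.Low s v) {y y' : V} (hy : y ∈ H.core s v)
    (hsy : H.A s y) (hsy' : H.A s y') (hr : H.r v < H.x s y)
    (hlt : H.x s y < H.x s y') : (H.contract s v).x s y < (H.contract s v).x s y' := by
  have := contract_x_lt_of_left_of_left h.mirror (y := y') (y' := y) (by rwa [core_mirror]) hsy'
    hsy (neg_lt_neg hr) (neg_lt_neg hlt)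
  rw [contract_mirror_x, contract_mirror_x] at this
  exact neg_lt_neg_iff.1 this

theorem contract_x_lt_of_left_of_right (h : H.Low s v) {y y' : V} (hy' : y' ∈ H.core s v)
    (hsy : H.A s y) (hsy' : H.A s y') (hl : H.x s y < H.l v)
    (hr : H.r v < H.x s y') : (H.contract s v).x s y < (H.contract s v).x s y' := by
  have hlr := h.valid.lr v h.v_mem
  by_cases hvy' : H.A v y'
  · exact contract_x_lt_of_left h hy' hsy hl hvy' (by rintro rfl; omega)
  · rw [contract_x_of_not hvy']
    by_cases hvy : H.A v y
    · rw [contract_x_of_adj hvy]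
      have := h.valid.tail_r hvy
      omega
    · rw [contract_x_of_not hvy]
      omega

/-- Edges with the same tail have different positions. -/
theorem Valid.x_ne (hV : H.Valid) {a b c : V} (hab : H.A a b) (hac : H.A a c) (hne : b ≠ c) :
    H.x a b ≠ H.x a c := by
  intro he
  have b1 := hV.head_l hab
  have b2 := hV.head_r hab
  have c1 := hV.head_l hac
  have c2 := hV.head_r hac
  rcases lt_trichotomy (H.lev b) (H.lev c) with hlt | heq | hlt
  · have := hV.pass hac (hV.head_mem hab) (hV.up hab) hlt
    omega
  · exact hne (hV.inj _ (hV.head_mem hab) _ (hV.head_mem hac) heq)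
  · have := hV.pass hab (hV.head_mem hac) (hV.up hac) hlt
    omega

/-- The point `E` is a suitable position for `v` near `s`, when the contraction is drawn by
`pos`. -/
structure Placement (H : Rep V) (s z v : V) (pos : V → ℚ × ℚ) (E : ℚ × ℚ) : Prop where
  left : ∀ y ∈ H.core s v, H.A s y → H.x s y < H.l v → orient (pos s) (pos y) E < 0
  right : ∀ y ∈ H.core s v, H.A s y → H.r v < H.x s y → 0 < orient (pos s) (pos y) E
  above : (pos s).2 < E.2
  below : ∀ m ∈ H.core s v, H.A v m → E.2 < (pos m).2
  far : ∀ m ∈ H.core s v, H.A v m → ∀ Q ∈ (H.contract s v).cells, s ∉ Q →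
    ∃ f, 0 < aff f (pos s) ∧ 0 < aff f E ∧ 0 ≤ aff f (pos m) ∧
      ∀ i ∈ Q, aff f (pos i) ≤ 0 ∧ (aff f (pos i) = 0 → i = m)
  far' : ∀ Q ∈ (H.contract s v).cells, s ∉ Q →
    ∃ f, 0 < aff f (pos s) ∧ 0 < aff f E ∧ ∀ i ∈ Q, aff f (pos i) < 0
  fan : ∀ m ∈ H.core s v, ∀ m' ∈ H.core s v, H.A v m → H.A v m' → H.x v m < H.x v m' →
    orient E (pos m) (pos m') < 0
  top : ∀ y, (H.contract s v).A y z → y ≠ s → H.A v z → 0 < orient (pos z) E (pos y)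

section

variable (h : H.Low s v) (hF : H.Framed s u z) (hvu : v ≠ u) (hvz : v ≠ z)
include h hF hvu hvz

theorem contract_adj_s {y : V} (hy : y ∈ H.core s v) (hyv : y ≠ v) (hsy : H.A s y) :
    (H.contract s v).A s y :=
  ⟨⟨core_s h hF hvu hvz, h.s_ne_v⟩, ⟨hy, hyv⟩, Or.inl hsy⟩

theorem contract_adj_v {m : V} (hm : m ∈ H.core s v) (hvm : H.A v m) :
    (H.contract s v).A s m :=
  ⟨⟨core_s h hF hvu hvz, h.s_ne_v⟩,
    ⟨hm, by rintro rfl; exact lt_irrefl _ (h.valid.up hvm)⟩, Or.inr ⟨rfl, hvm⟩⟩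

/-- The point is taken slightly above s, in the direction of the sum of the vectors to a and b, the
neighbours of s whose edges pass v most closely on the left and on the right. This direction settles
`left`, `right` and `above`. The remaining conditions of `Placement` are strict inequalities that
hold at s itself and so persist for small ε. -/
theorem exists_placement [Finite V] {pos : V → ℚ × ℚ} (hd : (H.contract s v).Draws s z pos)
    {p q t : ℚ × ℚ} (hin : ∀ w ∈ (H.contract s v).S, InTriangle p q t (pos w)) :
    ∃ E, H.Placement s z v pos E ∧ InTriangle p q t E := by
  have hcs := core_s h hF hvu hvz
  have hcF := contract_framed h hF hvu hvz
  have hlr := h.valid.lr v h.v_mem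
  have svl := h.valid.head_l h.sv
  have svr := h.valid.head_r h.sv
  let L : Set V := {y | y ∈ H.core s v ∧ H.A s y ∧ H.x s y < H.l v}
  let R : Set V := {y | y ∈ H.core s v ∧ H.A s y ∧ H.r v < H.x s y}
  have hLv : ∀ y ∈ L, y ≠ v := by rintro y ⟨-, -, hy⟩ rfl; omega
  have hRv : ∀ y ∈ R, y ≠ v := by rintro y ⟨-, -, hy⟩ rfl; omega
  have hLA : ∀ y ∈ L, (H.contract s v).A s y := fun y hy =>
    contract_adj_s h hF hvu hvz hy.1 (hLv y hy) hy.2.1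
  have hRA : ∀ y ∈ R, (H.contract s v).A s y := fun y hy =>
    contract_adj_s h hF hvu hvz hy.1 (hRv y hy) hy.2.1
  -- The frame makes both sets nonempty: z is in L, and u is in R.
  obtain ⟨a, haL, hamax⟩ := Set.exists_max_image L (fun y => H.x s y) (Set.toFinite _)
    ⟨z, core_z h hF hvu hvz, hF.sz, xsz_lt_lv h hF hvu hvz⟩
  obtain ⟨b, hbR, hbmin⟩ := Set.exists_min_image R (fun y => H.x s y) (Set.toFinite _)
    ⟨u, core_u h hF hvu hvz, hF.su, rv_lt_xsu h hF hvu hvz⟩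
  have oLR : ∀ y ∈ L, ∀ y' ∈ R, orient (pos s) (pos y) (pos y') < 0 := fun y hy y' hy' =>
    hd.tail_order (hLA y hy) (hRA y' hy')
      (contract_x_lt_of_left_of_right h hy'.1 hy.2.1 hy'.2.1 hy.2.2 hy'.2.2)
  have oLa : ∀ y ∈ L, orient (pos s) (pos y) (pos a) ≤ 0 := by
    intro y hy
    by_cases hne : y = a
    · subst hne; simp only [orient]; linarith
    · have hle := hamax y hy
      have hx := h.valid.x_ne hy.2.1 haL.2.1 hne
      exact (hd.tail_order (hLA y hy) (hLA a haL) (contract_x_lt_of_left_of_left h haL.1 hy.2.1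
        haL.2.1 haL.2.2 (lt_of_le_of_ne hle hx))).le
  have oRb : ∀ y ∈ R, orient (pos s) (pos b) (pos y) ≤ 0 := by
    intro y hy
    by_cases hne : y = b
    · subst hne; simp only [orient]; linarith
    · have hle := hbmin y hy
      have hx := h.valid.x_ne hbR.2.1 hy.2.1 (Ne.symm hne)
      exact (hd.tail_order (hRA b hbR) (hRA y hy) (contract_x_lt_of_right_of_right h hbR.1
        hbR.2.1 hy.2.1 hbR.2.2 (lt_of_le_of_ne hle hx))).le
  let d : ℚ × ℚ := ((pos a).1 - (pos s).1 + ((pos b).1 - (pos s).1),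
    (pos a).2 - (pos s).2 + ((pos b).2 - (pos s).2))
  let E : ℚ → ℚ × ℚ := fun ε => ((pos s).1 + ε * d.1, (pos s).2 + ε * d.2)
  have haff : ∀ f ε, aff f (E ε) = aff f (pos s) + ε * (f.1 * d.1 + f.2.1 * d.2) := by
    intro f ε; simp only [aff, E]; ring
  have hd2 : 0 < d.2 := by
    have h1 := hd.up (hLA a haL)
    have h2 := hd.up (hRA b hbR)
    simp only [d]; linarith
  have evfar : ∀ f, 0 < aff f (pos s) → ∀ᶠ ε in 𝓝[>] (0 : ℚ), 0 < aff f (E ε) := by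
    intro f hf
    simp only [haff]
    exact eventually_pos_add_mul hf _
  have hscell : ({s} : Set V) ∈ (H.contract s v).cells := Or.inl ⟨s, ⟨hcs, h.s_ne_v⟩, rfl⟩
  have ev0 : ∀ᶠ ε in 𝓝[>] (0 : ℚ), 0 < ε := self_mem_nhdsWithin
  -- Ensures 1 - 2ε > 0, the weight of s when E is written as a convex combination of s, a and b.
  have ev1 : ∀ᶠ ε in 𝓝[>] (0 : ℚ), 0 < 1 / 2 + ε * (-1) := eventually_pos_add_mul (by norm_num) _
  have ev2 : ∀ᶠ ε in 𝓝[>] (0 : ℚ), ∀ m, m ∈ H.core s v → H.A v m → (E ε).2 < (pos m).2 := by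
    rw [eventually_all]; intro m
    by_cases hm : m ∈ H.core s v ∧ H.A v m
    · have := hd.up (contract_adj_v h hF hvu hvz hm.1 hm.2)
      filter_upwards [eventually_pos_add_mul (c := (pos m).2 - (pos s).2) (by linarith) (-d.2)]
        with ε hε _ _
      simp only [E]; linarith
    · exact Eventually.of_forall fun ε h1 h2 => absurd ⟨h1, h2⟩ hm
  have ev3 : ∀ᶠ ε in 𝓝[>] (0 : ℚ), ∀ m, ∀ Q : Set V, m ∈ H.core s v → H.A v m →
      Q ∈ (H.contract s v).cells → s ∉ Q →
      ∃ f, 0 < aff f (pos s) ∧ 0 < aff f (E ε) ∧ 0 ≤ aff f (pos m) ∧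
        ∀ i ∈ Q, aff f (pos i) ≤ 0 ∧ (aff f (pos i) = 0 → i = m) := by
    rw [eventually_all]; intro m
    rw [eventually_all]; intro Q
    by_cases hm : m ∈ H.core s v ∧ H.A v m ∧ Q ∈ (H.contract s v).cells ∧ s ∉ Q
    -- The functional that separates the contracted edge s m from Q is positive at s, hence also at
    -- E: the edge v → m stays on the same side.
    · obtain ⟨f, hf⟩ := hd.sep {s, m} (Or.inr ⟨s, m, contract_adj_v h hF hvu hvz hm.1 hm.2.1, rfl⟩)
        Q hm.2.2.1
      have hs := (hf s).2.1 (by simp) hm.2.2.2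
      filter_upwards [evfar f hs] with ε hε _ _ _ _
      refine ⟨f, hs, hε, ?_, fun i hi => ?_⟩
      · by_cases hmQ : m ∈ Q
        · exact ((hf m).1 (by simp) hmQ).ge
        · exact ((hf m).2.1 (by simp) hmQ).le
      · by_cases him : i ∈ ({s, m} : Set V)
        · refine ⟨((hf i).1 him hi).le, fun _ => ?_⟩
          rcases him with rfl | rfl
          · exact absurd hi hm.2.2.2
          · rfl
        · have := (hf i).2.2 hi him
          exact ⟨this.le, fun h0 => absurd h0 this.ne⟩
    · exact Eventually.of_forall fun ε h1 h2 h3 h4 => absurd ⟨h1, h2, h3, h4⟩ hm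
  have ev4 : ∀ᶠ ε in 𝓝[>] (0 : ℚ), ∀ Q : Set V, Q ∈ (H.contract s v).cells → s ∉ Q →
      ∃ f, 0 < aff f (pos s) ∧ 0 < aff f (E ε) ∧ ∀ i ∈ Q, aff f (pos i) < 0 := by
    rw [eventually_all]; intro Q
    by_cases hQ : Q ∈ (H.contract s v).cells ∧ s ∉ Q
    · obtain ⟨f, hf⟩ := hd.sep {s} hscell Q hQ.1
      have hs := (hf s).2.1 (by simp) hQ.2
      filter_upwards [evfar f hs] with ε hε _ _
      refine ⟨f, hs, hε, fun i hi => (hf i).2.2 hi ?_⟩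
      rintro rfl; exact hQ.2 hi
    · exact Eventually.of_forall fun ε h1 h2 => absurd ⟨h1, h2⟩ hQ
  have ev5 : ∀ᶠ ε in 𝓝[>] (0 : ℚ), ∀ m, ∀ m', m ∈ H.core s v → m' ∈ H.core s v → H.A v m →
      H.A v m' → H.x v m < H.x v m' → orient (E ε) (pos m) (pos m') < 0 := by
    rw [eventually_all]; intro m
    rw [eventually_all]; intro m'
    by_cases hm : m ∈ H.core s v ∧ m' ∈ H.core s v ∧ H.A v m ∧ H.A v m' ∧ H.x v m < H.x v m'
    · obtain ⟨h1, h2, h3, h4, h5⟩ := hm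
      have ho := hd.tail_order (contract_adj_v h hF hvu hvz h1 h3)
        (contract_adj_v h hF hvu hvz h2 h4)
        (by rwa [contract_x_of_adj h3, contract_x_of_adj h4])
      filter_upwards [evfar (orientFun (pos m') (pos m)) (by
        rw [aff_orientFun]; simp only [orient] at ho ⊢; linarith)] with ε hε _ _ _ _ _
      rw [aff_orientFun] at hε
      simp only [orient] at hε ⊢; linarith
    · exact Eventually.of_forall fun ε h1 h2 h3 h4 h5 => absurd ⟨h1, h2, h3, h4, h5⟩ hm
  have ev6 : ∀ᶠ ε in 𝓝[>] (0 : ℚ), ∀ y, (H.contract s v).A y z → y ≠ s →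
      0 < orient (pos z) (E ε) (pos y) := by
    rw [eventually_all]; intro y
    by_cases hy : (H.contract s v).A y z ∧ y ≠ s
    · have hyz : y ≠ z := by
        rintro rfl; exact lt_irrefl _ ((contract_valid h hF hvu hvz).up hy.1)
      have hlt : (H.contract s v).x s z < (H.contract s v).x y z :=
        lt_of_lt_of_le (hcF.left y hy.1.1 hy.2 hyz)
          ((contract_valid h hF hvu hvz).tail_l hy.1)
      have ho := hd.head_order hcF.sz hy.1 hlt
      filter_upwards [evfar (orientFun (pos y) (pos z)) (by
        rw [aff_orientFun]; simp only [orient] at ho ⊢; linarith)] with ε hε _ _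
      rw [aff_orientFun] at hε
      simp only [orient] at hε ⊢; linarith
    · exact Eventually.of_forall fun ε h1 h2 => absurd ⟨h1, h2⟩ hy
  obtain ⟨ε, e0, e1, e2, e3, e4, e5, e6⟩ :=
    (ev0.and (ev1.and (ev2.and (ev3.and (ev4.and (ev5.and ev6)))))).exists
  have hor : ∀ y, orient (pos s) (pos y) (E ε) =
      ε * (orient (pos s) (pos y) (pos a) + orient (pos s) (pos y) (pos b)) := by
    intro y; simp only [orient, E, d]; ring
  refine ⟨E ε, ⟨?_, ?_, ?_, ?_, ?_, ?_, ?_, ?_⟩, ?_⟩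
  · intro y h1 h2 h3
    have hy : y ∈ L := ⟨h1, h2, h3⟩
    rw [hor]
    exact mul_neg_of_pos_of_neg e0 (by linarith [oLa y hy, oLR y hy b hbR])
  · intro y h1 h2 h3
    have hy : y ∈ R := ⟨h1, h2, h3⟩
    rw [hor]
    refine mul_pos e0 ?_
    have k1 := oRb y hy
    have k2 := oLR a haL y hy
    rw [orient_swap] at k1 k2
    linarith
  · have := mul_pos e0 hd2
    simp only [E]; linarith
  · exact fun m h1 h2 => e2 m h1 h2
  · exact fun m h1 h2 Q h3 h4 => e3 m Q h1 h2 h3 h4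
  · exact e4
  · exact fun m h1 m' h2 => e5 m m' h1 h2
  · exact fun y h1 h2 _ => e6 y h1 h2
  · refine InTriangle.trans (hin s ⟨hcs, h.s_ne_v⟩) (hin a ⟨haL.1, hLv a haL⟩)
      (hin b ⟨hbR.1, hRv b hbR⟩) ⟨1 - ε - ε, ε, ε, by linarith, e0.le, e0.le, by ring, ?_⟩
    ext <;> simp only [E, d] <;> ring

end

end Rep

namespace Rep

variable {H : Rep V} {s u z v : V}

/-! ### Splitting v off: the drawing of the core with empty triangles -/

/-- The triangles cut off by double edges, as sets of vertices. -/
def triangles (H : Rep V) (s v : V) : Set (Set V) :=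
  {T | ∃ y ∈ H.core s v, (H.DupL s v y ∨ H.mirror.DupL s v y) ∧ T = {s, v, y}}

section

variable (h : H.Low s v) (hF : H.Framed s u z) (hvu : v ≠ u) (hvz : v ≠ z)
  {pos : V → ℚ × ℚ} (hd : (H.contract s v).Draws s z pos) {E : ℚ × ℚ}
  (hE : H.Placement s z v pos E) {n : V → ℚ × ℚ} (hnv : n v = E) (hn : ∀ w, w ≠ v → n w = pos w)
include h hF hvu hvz hd hE hnv hn

theorem Placement.side {y : V} (hy : y ∈ H.core s v) (hsy : H.A s y) (hyv : y ≠ v) :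
    (H.x s y < H.l v ∧ orient (n s) (n y) (n v) < 0) ∨
    (H.r v < H.x s y ∧ 0 < orient (n s) (n y) (n v)) := by
  rw [hnv, hn s h.s_ne_v, hn y hyv]
  rcases h.side hsy hyv with h1 | h1
  · exact Or.inl ⟨h1, hE.left y hy hsy h1⟩
  · exact Or.inr ⟨h1, hE.right y hy hsy h1⟩

/-- If Q avoids s, the functionals of `far` and `far'` apply. If Q = {s}, a horizontal line
separates. If Q is an edge s → y, the line through s and y has v and the heads of all edges of v,
except possibly y, strictly on one side, by the order of the edges at s. -/
theorem Placement.sep_far [Finite V] {P Q : Set V}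
    (hP : P ⊆ {s, v} ∨ ∃ m ∈ H.core s v, H.A v m ∧ P ⊆ {s, v, m})
    (hQ : Q ∈ (H.restrict (H.core s v)).cells) (hvQ : v ∉ Q) : Sep n P Q := by
  have hns := hn s h.s_ne_v
  have hnQ : ∀ w ∈ Q, n w = pos w := fun w hw => hn w (by rintro rfl; exact hvQ hw)
  have hmv : ∀ m, H.A v m → n m = pos m := fun m hm =>
    hn m (by rintro rfl; exact lt_irrefl _ (h.valid.up hm))
  have hQc : Q ∈ (H.contract s v).cells := by
    rcases hQ with ⟨a, ha, rfl⟩ | ⟨a, b, hab, rfl⟩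
    · exact Or.inl ⟨a, ⟨ha.2, by rintro rfl; exact hvQ rfl⟩, rfl⟩
    · exact Or.inr ⟨a, b, ⟨⟨hab.2.1, by rintro rfl; exact hvQ (by simp)⟩,
        ⟨hab.2.2, by rintro rfl; exact hvQ (by simp)⟩, Or.inl hab.1⟩, rfl⟩
  by_cases hsQ : s ∈ Q
  · have hmem : ∀ w ∈ P, w = s ∨ w = v ∨ w ∈ H.core s v ∧ H.A v w := by
      intro w hw
      rcases hP with hP | ⟨m, hm, hvm, hP⟩
      · rcases hP hw with rfl | rfl
        · exact Or.inl rfl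
        · exact Or.inr (Or.inl rfl)
      · rcases hP hw with rfl | rfl | rfl
        · exact Or.inl rfl
        · exact Or.inr (Or.inl rfl)
        · exact Or.inr (Or.inr ⟨hm, hvm⟩)
    have hQ' : Q = {s} ∨ ∃ y ∈ H.core s v, H.A s y ∧ Q = {s, y} := by
      rcases hQ with ⟨a, ha, rfl⟩ | ⟨a, b, hab, rfl⟩
      · rcases hsQ with rfl
        exact Or.inl rfl
      · rcases hsQ with rfl | rfl
        · exact Or.inr ⟨b, hab.2.2, hab.1, rfl⟩
        · exact (h.not_to_s hab.1).elim
    rcases hQ' with rfl | ⟨y, hy, hsy, rfl⟩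
    · have hgt : ∀ w ∈ P, w = s ∨ (n s).2 < (n w).2 := by
        intro w hw
        rcases hmem w hw with rfl | rfl | ⟨hw1, hw2⟩
        · exact Or.inl rfl
        · right; rw [hns, hnv]; exact hE.above
        · right; rw [hns, hmv w hw2]; exact hE.above.trans (hE.below w hw1 hw2)
      have haff : ∀ w, aff (0, 1, -(n s).2) (n w) = (n w).2 - (n s).2 := by
        intro w; simp only [aff]; ring
      refine Sep.of_weak_of_zero (0, 1, -(n s).2) (i := s) ?_ ?_ ?_
      · intro w hw; rw [haff]
        rcases hgt w hw with rfl | h1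
        · linarith
        · linarith
      · rintro w rfl; rw [haff]; linarith
      · rintro w (hw | hw) h0
        · rw [haff] at h0
          exact (hgt w hw).resolve_right fun h1 => by linarith
        · exact hw
    · have hyv : y ≠ v := by rintro rfl; exact hvQ (by simp)
      have hsyn : n s ≠ n y := by
        intro he
        have := hd.up (contract_adj_s h hF hvu hvz hy hyv hsy)
        rw [hns, hn y hyv] at he
        rw [he] at this
        exact lt_irrefl _ this
      have hcy := contract_adj_s h hF hvu hvz hy hyv hsy
      have key : ∃ f, aff f (n s) = 0 ∧ aff f (n y) = 0 ∧ 0 < aff f (n v) ∧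
          ∀ m ∈ H.core s v, H.A v m → m ≠ y → 0 < aff f (n m) := by
        rcases hE.side h hF hvu hvz hd hnv hn hy hsy hyv with ⟨h1, h2⟩ | ⟨h1, h2⟩
        · refine ⟨-orientFun (n s) (n y), ?_, ?_, ?_, ?_⟩
          · rw [aff_neg, aff_orientFun]; simp only [orient]; ring
          · rw [aff_neg, aff_orientFun]; simp only [orient]; ring
          · rw [aff_neg, aff_orientFun]; linarith
          · intro m hm hvm hne
            rw [aff_neg, aff_orientFun]
            have := hd.tail_order hcy (contract_adj_v h hF hvu hvz hm hvm)
              (contract_x_lt_of_left h hm hsy h1 hvm (Ne.symm hne))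
            rw [hns, hn y hyv, hmv m hvm]; linarith
        · refine ⟨orientFun (n s) (n y), ?_, ?_, ?_, ?_⟩
          · rw [aff_orientFun]; simp only [orient]; ring
          · rw [aff_orientFun]; simp only [orient]; ring
          · rw [aff_orientFun]; exact h2
          · intro m hm hvm hne
            rw [aff_orientFun]
            have := hd.tail_order (contract_adj_v h hF hvu hvz hm hvm) hcy
              (contract_x_lt_of_right h hm hsy h1 hvm (Ne.symm hne))
            rw [orient_swap] at this
            rw [hns, hn y hyv, hmv m hvm]; linarith
      obtain ⟨f, fs, fy, fv, fm⟩ := key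
      refine Sep.of_weak_of_zeros f hsyn ?_ ?_ ?_
      · intro w hw
        rcases hmem w hw with rfl | rfl | ⟨hw1, hw2⟩
        · exact fs.ge
        · exact fv.le
        · by_cases hwy : w = y
          · subst hwy; exact fy.ge
          · exact (fm w hw1 hw2 hwy).le
      · rintro w (rfl | rfl)
        · exact fs.le
        · exact fy.le
      · rintro w (hw | hw) h0
        · rcases hmem w hw with rfl | rfl | ⟨hw1, hw2⟩
          · exact Or.inl rfl
          · exact absurd h0 fv.ne'
          · by_contra hcon
            push Not at hcon
            exact absurd h0 (fm w hw1 hw2 hcon.2).ne'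
        · exact hw
  · rcases hP with hP | ⟨m, hm, hvm, hP⟩
    · obtain ⟨f, fs, fv, fQ⟩ := hE.far' Q hQc hsQ
      rw [← hns] at fs
      rw [← hnv] at fv
      refine Sep.of_weak_of_zero f (i := s) ?_ ?_ ?_
      · intro w hw
        rcases hP hw with rfl | rfl
        · exact fs.le
        · exact fv.le
      · intro w hw; rw [hnQ w hw]; exact (fQ w hw).le
      · rintro w (hw | hw) h0
        · rcases hP hw with rfl | rfl
          · exact absurd h0 fs.ne'
          · exact absurd h0 fv.ne'
        · rw [hnQ w hw] at h0; exact absurd h0 (fQ w hw).ne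
    · obtain ⟨f, fs, fv, fm, fQ⟩ := hE.far m hm hvm Q hQc hsQ
      rw [← hns] at fs
      rw [← hnv] at fv
      refine Sep.of_weak_of_zero f (i := m) ?_ ?_ ?_
      · intro w hw
        rcases hP hw with rfl | rfl | rfl
        · exact fs.le
        · exact fv.le
        · rw [hmv w hvm]; exact fm
      · intro w hw; rw [hnQ w hw]; exact (fQ w hw).1
      · rintro w (hw | hw) h0
        · rcases hP hw with rfl | rfl | rfl
          · exact absurd h0 fs.ne'
          · exact absurd h0 fv.ne'
          · rfl
        · rw [hnQ w hw] at h0; exact (fQ w hw).2 h0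

theorem Placement.orient_dupL {y : V} (hy : y ∈ H.core s v) (hdup : H.DupL s v y) :
    orient (n s) (n y) (n v) < 0 := by
  have hyv : y ≠ v := by rintro rfl; exact lt_irrefl _ (h.valid.up hdup.2.1)
  rcases hE.side h hF hvu hvz hd hnv hn hy hdup.1 hyv with h1 | h1
  · exact h1.2
  · have h2 := hdup.2.2
    have := h.valid.lr v h.v_mem
    omega

theorem Placement.orient_dupR {y : V} (hy : y ∈ H.core s v) (hdup : H.mirror.DupL s v y) :
    0 < orient (n s) (n y) (n v) := by
  have hyv : y ≠ v := by rintro rfl; exact lt_irrefl _ (h.mirror.valid.up hdup.2.1)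
  rcases hE.side h hF hvu hvz hd hnv hn hy hdup.1 hyv with h1 | h1
  · have h2 : -H.x s y < -H.r v := hdup.2.2
    have := h.valid.lr v h.v_mem
    omega
  · exact h1.2

theorem Placement.orient_dup_ne {y : V} (hy : y ∈ H.core s v)
    (hdup : H.DupL s v y ∨ H.mirror.DupL s v y) : orient (n s) (n v) (n y) ≠ 0 := by
  rw [orient_swap]
  rcases hdup with hdup | hdup
  · have := hE.orient_dupL h hF hvu hvz hd hnv hn hy hdup
    intro h0; linarith
  · have := hE.orient_dupR h hF hvu hvz hd hnv hn hy hdup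
    intro h0; linarith

theorem Placement.orient_fan {m m' : V} (hm : m ∈ H.core s v) (hm' : m' ∈ H.core s v)
    (hvm : H.A v m) (hvm' : H.A v m') (hlt : H.x v m < H.x v m') :
    orient (n v) (n m) (n m') < 0 := by
  have h1 : m ≠ v := by rintro rfl; exact lt_irrefl _ (h.valid.up hvm)
  have h2 : m' ≠ v := by rintro rfl; exact lt_irrefl _ (h.valid.up hvm')
  rw [hnv, hn m h1, hn m' h2]
  exact hE.fan m hm m' hm' hvm hvm' hlt

/-- For m ≠ y the line through v and y separates: by the order of the edges at v, the point m is on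
the side away from s, since otherwise m would lie in the removed region. -/
theorem Placement.sep_edge_triangle [Finite V] {m y : V} (hm : m ∈ H.core s v) (hvm : H.A v m)
    (hy : y ∈ H.core s v) (hdup : H.DupL s v y ∨ H.mirror.DupL s v y) :
    Sep n {v, m} {s, v, y} := by
  have hne := hE.orient_dup_ne h hF hvu hvz hd hnv hn hy hdup
  by_cases hmy : m = y
  · subst hmy
    exact Sep.of_subset_triple hne (by intro w; simp; tauto) (by rfl)
  · have hvy : H.A v y := hdup.elim (fun h => h.2.1) (fun h => h.2.1)
    have key : ∃ f, aff f (n v) = 0 ∧ aff f (n y) = 0 ∧ 0 < aff f (n m) ∧ aff f (n s) < 0 := by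
      rcases hdup with hdup | hdup
      · have h1 := hE.orient_dupL h hF hvu hvz hd hnv hn hy hdup
        have hlt : H.x v y < H.x v m := by
          by_contra hcon
          exact hm.2.1 ⟨y, hdup, h.region_of_v hdup hvm hmy (not_lt.1 hcon)⟩
        have h2 := hE.orient_fan h hF hvu hvz hd hnv hn hy hm hvy hvm hlt
        refine ⟨-orientFun (n v) (n y), ?_, ?_, ?_, ?_⟩ <;> rw [aff_neg, aff_orientFun]
        · simp only [orient]; ring
        · simp only [orient]; ring
        · linarith
        · rw [← orient_rotate, ← orient_rotate, orient_swap] at h1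
          rw [← orient_rotate, ← orient_rotate, orient_swap, orient_rotate]
          simp only [orient] at h1 ⊢; linarith
      · have h1 := hE.orient_dupR h hF hvu hvz hd hnv hn hy hdup
        have hlt : H.x v m < H.x v y := by
          by_contra hcon
          exact hm.2.2 ⟨y, hdup, h.mirror.region_of_v hdup hvm hmy (neg_le_neg (not_lt.1 hcon))⟩
        have h2 := hE.orient_fan h hF hvu hvz hd hnv hn hm hy hvm hvy hlt
        refine ⟨orientFun (n v) (n y), ?_, ?_, ?_, ?_⟩ <;> rw [aff_orientFun]
        · simp only [orient]; ring
        · simp only [orient]; ring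
        · rw [orient_swap]; linarith
        · simp only [orient] at h1 ⊢; linarith
    obtain ⟨f, fv, fy, fm, fs⟩ := key
    have hvyn : n v ≠ n y := (orient_ne_zero_ne hne).2.1
    refine Sep.of_weak_of_zeros f hvyn ?_ ?_ ?_
    · rintro w (rfl | rfl)
      · exact fv.ge
      · exact fm.le
    · rintro w (rfl | rfl | rfl)
      · exact fs.le
      · exact fv.le
      · exact fy.le
    · rintro w ((rfl | rfl) | (rfl | rfl | rfl)) h0
      · exact Or.inl rfl
      · exact absurd h0 fm.ne'
      · exact absurd h0 fs.ne
      · exact Or.inl rfl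
      · exact Or.inr rfl

/-- Each side of s → v has at most one triangle with top in the core (`dupL_unique`), and triangles
on opposite sides are separated by the line through s and v. -/
theorem Placement.sep_triangles [Finite V] {P Q : Set V} (hP : P ∈ H.triangles s v)
    (hQ : Q ∈ H.triangles s v) : Sep n P Q := by
  obtain ⟨y, hy, hdup, rfl⟩ := hP
  obtain ⟨y', hy', hdup', rfl⟩ := hQ
  have hne := hE.orient_dup_ne h hF hvu hvz hd hnv hn hy hdup
  have opp : ∀ {y y'}, y ∈ H.core s v → y' ∈ H.core s v → H.DupL s v y → H.mirror.DupL s v y' →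
      Sep n {s, v, y} {s, v, y'} := by
    intro y y' hy hy' hdup hdup'
    have h1 := hE.orient_dupL h hF hvu hvz hd hnv hn hy hdup
    have h2 := hE.orient_dupR h hF hvu hvz hd hnv hn hy' hdup'
    have hsv : n s ≠ n v := by
      intro he; rw [he] at h1; simp only [orient] at h1; linarith
    rw [orient_swap] at h1 h2
    have fs : aff (orientFun (n s) (n v)) (n s) = 0 := by
      rw [aff_orientFun]; simp only [orient]; ring
    have fv : aff (orientFun (n s) (n v)) (n v) = 0 := by
      rw [aff_orientFun]; simp only [orient]; ring
    refine Sep.of_weak_of_zeros (orientFun (n s) (n v)) hsv ?_ ?_ ?_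
    · rintro w (rfl | rfl | rfl)
      · exact fs.ge
      · exact fv.ge
      · rw [aff_orientFun]; linarith
    · rintro w (rfl | rfl | rfl)
      · exact fs.le
      · exact fv.le
      · rw [aff_orientFun]; linarith
    · rintro w ((rfl | rfl | rfl) | (rfl | rfl | rfl)) h0
      · exact Or.inl rfl
      · exact Or.inr rfl
      · rw [aff_orientFun] at h0; linarith
      · exact Or.inl rfl
      · exact Or.inr rfl
      · rw [aff_orientFun] at h0; linarith
  rcases hdup with hdup | hdup <;> rcases hdup' with hdup' | hdup'
  · rw [h.dupL_unique hdup hdup' hy.2.1 hy'.2.1]; exact Sep.refl _ _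
  · exact opp hy hy' hdup hdup'
  · exact (opp hy' hy hdup' hdup).symm
  · rw [h.mirror.dupL_unique hdup hdup' hy.2.2 hy'.2.2]; exact Sep.refl _ _

theorem Placement.sep [Finite V] :
    ∀ P ∈ (H.restrict (H.core s v)).cells ∪ H.triangles s v,
    ∀ Q ∈ (H.restrict (H.core s v)).cells ∪ H.triangles s v, Sep n P Q := by
  have hsvn : n s ≠ n v := by
    intro he
    have := hE.above
    rw [← hnv, ← he, hn s h.s_ne_v] at this
    exact lt_irrefl _ this
  have near : ∀ P ∈ (H.restrict (H.core s v)).cells ∪ H.triangles s v, v ∈ P →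
      P ⊆ {s, v} ∨ (∃ m ∈ H.core s v, H.A v m ∧ P = {v, m}) ∨ P ∈ H.triangles s v := by
    rintro P ((⟨a, ha, rfl⟩ | ⟨a, b, hab, rfl⟩) | hT) hv
    · rcases hv with rfl
      left; simp
    · rcases hv with rfl | rfl
      · exact Or.inr (Or.inl ⟨b, hab.2.2, hab.1, rfl⟩)
      · left; rw [h.tail_eq hab.1]
    · exact Or.inr (Or.inr hT)
  have nearsub : ∀ P ∈ (H.restrict (H.core s v)).cells ∪ H.triangles s v, v ∈ P →
      P ⊆ {s, v} ∨ ∃ m ∈ H.core s v, H.A v m ∧ P ⊆ {s, v, m} := by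
    intro P hP hv
    rcases near P hP hv with h1 | ⟨m, hm, hvm, rfl⟩ | ⟨y, hy, hdup, rfl⟩
    · exact Or.inl h1
    · exact Or.inr ⟨m, hm, hvm, by intro w; simp; tauto⟩
    · exact Or.inr ⟨y, hy, hdup.elim (fun h => h.2.1) (fun h => h.2.1), subset_rfl⟩
  have tv : ∀ T ∈ H.triangles s v, v ∈ T := by rintro T ⟨y, -, -, rfl⟩; simp
  have pairEdge : ∀ P : Set V, P ⊆ {s, v} → v ∈ P → ∀ m ∈ H.core s v, H.A v m →
      Sep n P {v, m} := by
    intro P hP hv m hm hvm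
    have haff : ∀ w, aff (0, -1, (n v).2) (n w) = (n v).2 - (n w).2 := by
      intro w; simp only [aff]; ring
    have mv : m ≠ v := by rintro rfl; exact lt_irrefl _ (h.valid.up hvm)
    have h1 : (n s).2 < (n v).2 := by rw [hn s h.s_ne_v, hnv]; exact hE.above
    have h2 : (n v).2 < (n m).2 := by rw [hn m mv, hnv]; exact hE.below m hm hvm
    refine Sep.of_weak_of_zero (0, -1, (n v).2) (i := v) ?_ ?_ ?_
    · intro w hw; rw [haff]
      rcases hP hw with rfl | rfl <;> linarith
    · rintro w (rfl | rfl) <;> rw [haff] <;> linarith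
    · rintro w (hw | (rfl | rfl)) h0
      · rw [haff] at h0
        rcases hP hw with rfl | rfl
        · linarith
        · rfl
      · rfl
      · rw [haff] at h0; linarith
  have pairTri : ∀ P : Set V, P ⊆ {s, v} → ∀ T ∈ H.triangles s v, Sep n P T := by
    rintro P hP T ⟨y, hy, hdup, rfl⟩
    refine Sep.of_subset_triple (hE.orient_dup_ne h hF hvu hvz hd hnv hn hy hdup) ?_ subset_rfl
    intro w hw
    rcases hP hw with rfl | rfl <;> simp
  have edgeTri : ∀ m ∈ H.core s v, H.A v m → ∀ T ∈ H.triangles s v, Sep n {v, m} T := by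
    rintro m hm hvm T ⟨y, hy, hdup, rfl⟩
    exact hE.sep_edge_triangle h hF hvu hvz hd hnv hn hm hvm hy hdup
  intro P hP Q hQ
  by_cases hvP : v ∈ P
  · by_cases hvQ : v ∈ Q
    · rcases near P hP hvP with h1 | ⟨m, hm, hvm, rfl⟩ | h1 <;>
      rcases near Q hQ hvQ with h2 | ⟨m', hm', hvm', rfl⟩ | h2
      · exact Sep.of_subset_pair hsvn h1 h2
      · exact pairEdge P h1 hvP m' hm' hvm'
      · exact pairTri P h1 Q h2
      · exact (pairEdge Q h2 hvQ m hm hvm).symm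
      · by_cases hmm : m = m'
        · rw [hmm]; exact Sep.refl _ _
        · have hx := h.valid.x_ne hvm hvm' hmm
          have hne : orient (n v) (n m) (n m') ≠ 0 := by
            rcases lt_or_gt_of_ne hx with h3 | h3
            · exact (hE.orient_fan h hF hvu hvz hd hnv hn hm hm' hvm hvm' h3).ne
            · have := hE.orient_fan h hF hvu hvz hd hnv hn hm' hm hvm' hvm h3
              rw [orient_swap] at this
              intro h0; linarith
          exact Sep.of_subset_triple hne (by intro w; simp; tauto) (by intro w; simp; tauto)
      · exact edgeTri m hm hvm Q h2
      · exact (pairTri Q h2 P h1).symm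
      · exact (edgeTri m' hm' hvm' P h1).symm
      · exact hE.sep_triangles h hF hvu hvz hd hnv hn h1 h2
    · exact hE.sep_far h hF hvu hvz hd hnv hn (nearsub P hP hvP)
        (hQ.resolve_right fun hT => hvQ (tv Q hT)) hvQ
  · have hP' := hP.resolve_right fun hT => hvP (tv P hT)
    by_cases hvQ : v ∈ Q
    · exact (hE.sep_far h hF hvu hvz hd hnv hn (nearsub Q hQ hvQ) hP' hvP).symm
    · have hQ' := hQ.resolve_right fun hT => hvQ (tv Q hT)
      have old : ∀ P ∈ (H.restrict (H.core s v)).cells, v ∉ P →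
          P ∈ (H.contract s v).cells ∧ ∀ w ∈ P, n w = pos w := by
        intro P hP hvP
        refine ⟨?_, fun w hw => hn w (by rintro rfl; exact hvP hw)⟩
        rcases hP with ⟨a, ha, rfl⟩ | ⟨a, b, hab, rfl⟩
        · exact Or.inl ⟨a, ⟨ha.2, by rintro rfl; exact hvP rfl⟩, rfl⟩
        · exact Or.inr ⟨a, b, ⟨⟨hab.2.1, by rintro rfl; exact hvP (by simp)⟩,
            ⟨hab.2.2, by rintro rfl; exact hvP (by simp)⟩, Or.inl hab.1⟩, rfl⟩
      exact (hd.sep P (old P hP' hvP).1 Q (old Q hQ' hvQ).1).congr (old P hP' hvP).2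
        (old Q hQ' hvQ).2

theorem Placement.draws [Finite V] : (H.restrict (H.core s v)).Draws s z n := by
  have hns := hn s h.s_ne_v
  have hlr := h.valid.lr v h.v_mem
  have svl := h.valid.head_l h.sv
  have svr := h.valid.head_r h.sv
  have hcF := contract_framed h hF hvu hvz
  have hcV := contract_valid h hF hvu hvz
  have hcs := core_s h hF hvu hvz
  have hnz : n z = pos z := hn z (Ne.symm hvz)
  refine ⟨?_, fun P hP Q hQ => hE.sep h hF hvu hvz hd hnv hn P (Or.inl hP) Q (Or.inl hQ), ?_, ?_⟩
  · rintro a b ⟨hab, ha, hb⟩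
    by_cases hav : a = v
    · subst hav
      rw [hnv, hn b (by rintro rfl; exact lt_irrefl _ (h.valid.up hab))]
      exact hE.below b hb hab
    · by_cases hbv : b = v
      · subst hbv
        rw [h.tail_eq hab, hns, hnv]; exact hE.above
      · rw [hn a hav, hn b hbv]
        exact hd.up ⟨⟨ha, hav⟩, ⟨hb, hbv⟩, Or.inl hab⟩
  · rintro y y' ⟨hy, -, hyc⟩ ⟨hy', -, hyc'⟩ (hlt : H.x s y < H.x s y')
    by_cases hyv : y = v
    · subst hyv
      have hne : y' ≠ y := by rintro rfl; exact lt_irrefl _ hlt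
      rcases hE.side h hF hvu hvz hd hnv hn hyc' hy' hne with ⟨h1, h2⟩ | ⟨h1, h2⟩
      · omega
      · rw [orient_swap]; linarith
    · by_cases hyv' : y' = v
      · subst hyv'
        rcases hE.side h hF hvu hvz hd hnv hn hyc hy hyv with ⟨h1, h2⟩ | ⟨h1, h2⟩
        · exact h2
        · omega
      · rw [hns, hn y hyv, hn y' hyv']
        refine hd.tail_order (contract_adj_s h hF hvu hvz hyc hyv hy)
          (contract_adj_s h hF hvu hvz hyc' hyv' hy') ?_
        rcases h.side hy hyv with h1 | h1 <;> rcases h.side hy' hyv' with h2 | h2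
        · exact contract_x_lt_of_left_of_left h hyc' hy hy' h2 hlt
        · exact contract_x_lt_of_left_of_right h hyc' hy hy' h1 h2
        · omega
        · exact contract_x_lt_of_right_of_right h hyc hy hy' h1 hlt
  · rintro y y' ⟨hy, hyc, -⟩ ⟨hy', hyc', -⟩ (hlt : H.x y z < H.x y' z)
    have hzc := core_z h hF hvu hvz
    have hnez : ∀ {a}, H.A a z → a ≠ z := by
      rintro a ha rfl; exact lt_irrefl _ (h.valid.up ha)
    have hs' : y' ≠ s := by
      rintro rfl
      have hys : y ≠ y' := by rintro rfl; exact lt_irrefl _ hlt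
      have h1 := hF.left y hyc.1 hys (hnez hy)
      have h2 := h.valid.tail_l hy
      omega
    have hc : ∀ {a}, a ∈ H.core s v → a ≠ v → H.A a z → (H.contract s v).A a z :=
      fun ha hav haz => ⟨⟨ha, hav⟩, ⟨hzc, Ne.symm hvz⟩, Or.inl haz⟩
    rw [hnz]
    by_cases hyv : y = v
    · subst hyv
      have hyv' : y' ≠ y := by rintro rfl; exact lt_irrefl _ hlt
      rw [hnv, hn y' hyv']
      exact hE.top y' (hc hyc' hyv' hy') hs' hy
    · rw [hn y hyv]
      by_cases hyv' : y' = v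
      · subst hyv'
        rw [hnv]
        by_cases hys : y = s
        · subst hys
          have := hE.left z hzc hF.sz (xsz_lt_lv h hF hvu hvz)
          simp only [orient] at this ⊢; linarith
        · have := hE.top y (hc hyc hyv hy) hys hy'
          -- Here v → z has become the left boundary of the contracted frame, so the bar of y ≠ s
          -- lies to its right, against the assumed order at z.
          exfalso
          have h1 := hd.head_order hcF.sz (hc hyc hyv hy)
            (lt_of_lt_of_le (hcF.left y ⟨hyc, hyv⟩ hys (hnez hy)) (hcV.tail_l (hc hyc hyv hy)))
          have h2 := hcF.left y ⟨hyc, hyv⟩ hys (hnez hy)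
          rw [contract_x_of_adj hy'] at h2
          have h3 : H.l y ≤ H.x y z := h.valid.tail_l hy
          have h4 : H.x y' z < H.l y := h2
          omega
      · rw [hn y' hyv']
        by_cases hys : y = s
        · subst hys
          exact hd.head_order hcF.sz (hc hyc' hyv' hy')
            (lt_of_lt_of_le (hcF.left y' ⟨hyc', hyv'⟩ hs' (hnez hy'))
              (hcV.tail_l (hc hyc' hyv' hy')))
        · refine hd.head_order (hc hyc hyv hy) (hc hyc' hyv' hy') ?_
          rwa [contract_x_of_ne hys, contract_x_of_ne hs']

end

end Rep

/-! ### Filling the empty triangles -/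

/-- Gluing two linearly ordered families along a common interval `[p, q]`. -/
theorem glue_order {x : V → ℤ} {lt : V → V → Prop} {F G : Set V} {p q : V} (hpF : p ∈ F)
    (hqF : q ∈ F) (hpG : p ∈ G) (hqG : q ∈ G)
    (hinj : ∀ a ∈ F ∪ G, ∀ b ∈ F ∪ G, x a = x b → a = b)
    (htr : ∀ a ∈ F ∪ G, ∀ b ∈ F ∪ G, ∀ c ∈ F ∪ G, lt a b → lt b c → lt a c)
    (hF : ∀ a ∈ F, x a ≤ x p ∨ x q ≤ x a) (hG : ∀ a ∈ G, x p ≤ x a ∧ x a ≤ x q)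
    (hFF : ∀ a ∈ F, ∀ b ∈ F, x a < x b → lt a b) (hGG : ∀ a ∈ G, ∀ b ∈ G, x a < x b → lt a b) :
    ∀ a ∈ F ∪ G, ∀ b ∈ F ∪ G, x a < x b → lt a b := by
  rintro a (ha | ha) b (hb | hb) hlt
  · exact hFF a ha b hb hlt
  · have hb' := hG b hb
    rcases hF a ha with h1 | h1
    · rcases h1.lt_or_eq with h2 | h2
      · rcases hb'.1.lt_or_eq with h3 | h3
        · exact htr a (Or.inl ha) p (Or.inl hpF) b (Or.inr hb) (hFF a ha p hpF h2)
            (hGG p hpG b hb h3)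
        · rw [← hinj p (Or.inl hpF) b (Or.inr hb) h3]
          exact hFF a ha p hpF h2
      · have := hinj a (Or.inl ha) p (Or.inl hpF) h2
        subst this
        exact hGG a hpG b hb hlt
    · omega
  · have ha' := hG a ha
    rcases hF b hb with h1 | h1
    · omega
    · rcases h1.lt_or_eq with h2 | h2
      · rcases ha'.2.lt_or_eq with h3 | h3
        · exact htr a (Or.inr ha) q (Or.inl hqF) b (Or.inl hb) (hGG a ha q hqG h3)
            (hFF q hqF b hb h2)
        · rw [hinj a (Or.inr ha) q (Or.inl hqF) h3]
          exact hFF q hqF b hb h2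
      · have := hinj q (Or.inl hqF) b (Or.inl hb) h2
        subst this
        exact hGG a ha q hqG hlt
  · exact hGG a ha b hb hlt

/-- The angular order around o is transitive because all points are above o. The identity `key`
expresses this with positive height differences as coefficients. -/
theorem orient_neg_trans {o a b c : ℚ × ℚ} (ha : o.2 < a.2) (hb : o.2 < b.2) (hc : o.2 < c.2)
    (hab : orient o a b < 0) (hbc : orient o b c < 0) : orient o a c < 0 := by
  have key : orient o a c * (b.2 - o.2) =
      orient o a b * (c.2 - o.2) + orient o b c * (a.2 - o.2) := by
    simp only [orient]; ring
  have h1 := mul_neg_of_neg_of_pos hab (sub_pos.2 hc)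
  have h2 := mul_neg_of_neg_of_pos hbc (sub_pos.2 ha)
  by_contra hcon
  have := mul_nonneg (not_lt.1 hcon) (sub_pos.2 hb).le
  linarith

theorem orient_pos_trans {o a b c : ℚ × ℚ} (ha : a.2 < o.2) (hb : b.2 < o.2) (hc : c.2 < o.2)
    (hab : 0 < orient o a b) (hbc : 0 < orient o b c) : 0 < orient o a c := by
  have key : orient o a c * (o.2 - b.2) =
      orient o a b * (o.2 - c.2) + orient o b c * (o.2 - a.2) := by
    simp only [orient]; ring
  have h1 := mul_pos hab (sub_pos.2 hc)
  have h2 := mul_pos hbc (sub_pos.2 ha)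
  by_contra hcon
  have := mul_nonneg (neg_nonneg.2 (not_lt.1 hcon)) (sub_pos.2 hb).le
  linarith

namespace Rep

variable {H : Rep V} {s u z v : V}

theorem not_triple_subset_cell {a b c : V} (hab : a ≠ b) (hac : a ≠ c) (hbc : b ≠ c) {P : Set V}
    (hP : P ∈ H.cells) : ¬ ({a, b, c} : Set V) ⊆ P := by
  intro hsub
  have h1 := hsub (show a ∈ ({a, b, c} : Set V) by simp)
  have h2 := hsub (show b ∈ ({a, b, c} : Set V) by simp)
  have h3 := hsub (show c ∈ ({a, b, c} : Set V) by simp)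
  rcases hP with ⟨d, -, rfl⟩ | ⟨d, e, -, rfl⟩
  · exact hab (h1.trans h2.symm)
  · rcases h1 with rfl | rfl <;> rcases h2 with rfl | rfl <;> rcases h3 with rfl | rfl <;>
    first
    | exact hab rfl
    | exact hac rfl
    | exact hbc rfl

theorem Draws.mirror' {pos : V → ℚ × ℚ} (h : H.Draws s z pos) :
    H.mirror.Draws s z (fun w => (-(pos w).1, (pos w).2)) := by
  rw [← mirror_mirror H] at h
  exact h.mirror

theorem Draws.of_restrict {pos : V → ℚ × ℚ} (hV : H.Valid) {W : Set V} (hW : H.S ⊆ W)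
    (h : (H.restrict W).Draws s z pos) : H.Draws s z pos := by
  have hA : ∀ {a b}, H.A a b → (H.restrict W).A a b := fun hab =>
    ⟨hab, hW (hV.tail_mem hab), hW (hV.head_mem hab)⟩
  have hc : ∀ P ∈ H.cells, P ∈ (H.restrict W).cells := by
    rintro P (⟨a, ha, rfl⟩ | ⟨a, b, hab, rfl⟩)
    · exact Or.inl ⟨a, ⟨ha, hW ha⟩, rfl⟩
    · exact Or.inr ⟨a, b, hA hab, rfl⟩
  exact ⟨fun hab => h.up (hA hab), fun P hP Q hQ => h.sep P (hc P hP) Q (hc Q hQ),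
    fun h1 h2 => h.tail_order (hA h1) (hA h2), fun h1 h2 => h.head_order (hA h1) (hA h2)⟩

theorem Low.not_inR_of_dupL (h : H.Low s v) {y : V} (hy : H.DupL s v y) :
    ¬ H.mirror.InL s v y := by
  rintro ⟨y', hy', -, -, -, -, h1⟩
  have h1' : -H.l y < -H.x v y' := h1
  have h2 := h.valid.tail_l (show H.A v y' from hy'.2.1)
  have h3 := h.valid.head_l hy.1
  have h4 := hy.2.2
  omega

/-- Drawing the vertices to the left of the edge `s → v` into the empty triangle that is left for
them. -/
theorem Low.exists_fill [Finite V] (h : H.Low s v) {W : Set V} {𝒯 : Set (Set V)}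
    {n : V → ℚ × ℚ} (hd : (H.restrict W).Draws s z n)
    (hsep : ∀ P ∈ (H.restrict W).cells ∪ 𝒯, ∀ Q ∈ (H.restrict W).cells ∪ 𝒯, Sep n P Q)
    (hsW : s ∈ W) (hvW : v ∈ W) (hzW : z ∈ W) (hWL : ∀ w ∈ W, ¬ H.InL s v w)
    (hT : ∀ y, H.DupL s v y → ¬ H.InL s v y → y ∈ W ∧ {s, v, y} ∈ 𝒯)
    (h𝒯 : ∀ T ∈ 𝒯, ∃ y ∈ W, T = {s, v, y})
    (IH : ∀ y, H.DupL s v y → (H.inner s v y).Drawable s v y) {p q t : ℚ × ℚ}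
    (hin : ∀ w ∈ W, InTriangle p q t (n w)) :
    ∃ n', (H.restrict (W ∪ {w | H.InL s v w})).Draws s z n' ∧
      (∀ P ∈ (H.restrict (W ∪ {w | H.InL s v w})).cells ∪
          {T ∈ 𝒯 | ∀ y, H.DupL s v y → T ≠ {s, v, y}},
        ∀ Q ∈ (H.restrict (W ∪ {w | H.InL s v w})).cells ∪
          {T ∈ 𝒯 | ∀ y, H.DupL s v y → T ≠ {s, v, y}}, Sep n' P Q) ∧
      (∀ w ∈ W, n' w = n w) ∧ ∀ w ∈ W ∪ {w | H.InL s v w}, InTriangle p q t (n' w) := by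
  classical
  by_cases hne : ∃ w, H.InL s v w
  swap
  · have : {w | H.InL s v w} = ∅ := Set.eq_empty_of_forall_notMem fun w hw => hne ⟨w, hw⟩
    rw [this, Set.union_empty]
    refine ⟨n, hd, fun P hP Q hQ => hsep P ?_ Q ?_, fun _ _ => rfl, hin⟩
    · exact hP.imp id fun h => h.1
    · exact hQ.imp id fun h => h.1
  obtain ⟨w0, hw0⟩ := hne
  obtain ⟨y, hy, hreg, hyL⟩ := h.exists_outermost hw0
  obtain ⟨hyW, hyT⟩ := hT y hy hyL
  have hU : {w | H.InL s v w} = {w | H.Region s v y w} := Set.ext hreg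
  have hWR : ∀ w ∈ W, ¬ H.Region s v y w := fun w hw hr => hWL w hw ((hreg w).2 hr)
  rw [hU]
  obtain ⟨hsy, hvy, hl⟩ := id hy
  have hsv := h.s_ne_v
  have sy : s ≠ y := by rintro rfl; exact lt_irrefl _ (h.valid.up hsy)
  have vy : v ≠ y := by rintro rfl; exact lt_irrefl _ (h.valid.up hvy)
  have svl := h.valid.head_l h.sv
  have svr := h.valid.head_r h.sv
  have hA : ∀ {a b}, H.A a b → a ∈ W → b ∈ W → (H.restrict W).A a b := fun h1 h2 h3 => ⟨h1, h2, h3⟩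
  have hi : ∀ {w}, w = s ∨ w = v ∨ w = y ∨ H.Region s v y w →
      w ∈ ({s, v, y} ∪ {w | H.Region s v y w} : Set V) := by
    rintro w (rfl | rfl | rfl | hw)
    · simp
    · simp
    · simp
    · exact Or.inr hw
  have o1 : orient (n s) (n y) (n v) < 0 :=
    hd.tail_order (hA hsy hsW hyW) (hA h.sv hsW hvW) (show H.x s y < H.x s v by omega)
  have hsvup : (n s).2 < (n v).2 := hd.up (hA h.sv hsW hvW)
  have hvyup : (n v).2 < (n y).2 := hd.up (hA hvy hvW hyW)
  -- The region is drawn in the triangle on the points already chosen for s, v and y, so the two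
  -- drawings agree at the corners.
  obtain ⟨m, hm, hms, hmv, hmy, hmin⟩ := IH y hy (n s) (n v) (n y) hsvup hvyup o1
  let n' : V → ℚ × ℚ := fun w => if H.Region s v y w then m w else n w
  have hn'R : ∀ w, H.Region s v y w → n' w = m w := fun w hw => if_pos hw
  have hn'N : ∀ w, ¬ H.Region s v y w → n' w = n w := fun w hw => if_neg hw
  have hn'W : ∀ w ∈ W, n' w = n w := fun w hw => hn'N w (hWR w hw)
  have hn'm : ∀ w, w = s ∨ w = v ∨ w = y ∨ H.Region s v y w → n' w = m w := by
    rintro w (rfl | rfl | rfl | hw)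
    · rw [hn'W _ hsW, hms]
    · rw [hn'W _ hvW, hmv]
    · rw [hn'W _ hyW, hmy]
    · exact hn'R w hw
  have hs' := hn'W s hsW
  -- every edge of the union is an old edge or an inner edge
  have split : ∀ {a b}, (H.restrict (W ∪ {w | H.Region s v y w})).A a b →
      (H.restrict W).A a b ∨ (H.inner s v y).A a b := by
    rintro a b ⟨hab, ha, hb⟩
    by_cases haR : H.Region s v y a
    · right
      refine ⟨hab, hi (by simp [haR]), hi ?_⟩
      rcases h.region_head hy haR hab with h1 | h1 <;> simp [h1]
    · by_cases hbR : H.Region s v y b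
      · right
        refine ⟨hab, hi ?_, hi (by simp [hbR])⟩
        rcases h.region_tail hy hbR hab with h1 | h1 | h1 <;> simp [h1]
      · exact Or.inl ⟨hab, ha.resolve_right haR, hb.resolve_right hbR⟩
  have hinS : ∀ {w}, w ∈ (H.inner s v y).S → w = s ∨ w = v ∨ w = y ∨ H.Region s v y w := by
    rintro w ⟨-, (hw | hw | hw) | hw⟩
    exacts [Or.inl hw, Or.inr (Or.inl hw), Or.inr (Or.inr (Or.inl hw)),
      Or.inr (Or.inr (Or.inr hw))]
  have hiV : (H.inner s v y).Valid := h.valid.restrict _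
  have hcellsW : ∀ P ∈ (H.restrict W).cells ∪ 𝒯, ∀ w ∈ P, w ∈ W := by
    rintro P ((⟨a, ha, rfl⟩ | ⟨a, b, hab, rfl⟩) | hPT) w hw
    · rcases hw with rfl; exact ha.2
    · rcases hw with rfl | rfl
      · exact hab.2.1
      · exact hab.2.2
    · obtain ⟨y', hy', rfl⟩ := h𝒯 P hPT
      rcases hw with rfl | rfl | rfl <;> assumption
  have hcellsI : ∀ P ∈ (H.inner s v y).cells, ∀ w ∈ P,
      w = s ∨ w = v ∨ w = y ∨ H.Region s v y w := by
    rintro P (⟨a, ha, rfl⟩ | ⟨a, b, hab, rfl⟩) w hw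
    · rcases hw with rfl; exact hinS ha
    · rcases hw with rfl | rfl
      · exact hinS (hiV.tail_mem hab)
      · exact hinS (hiV.head_mem hab)
  have sepU := Sep.fill (pos := n) (pos' := m) (K := (H.restrict W).cells ∪ 𝒯)
    (K' := (H.inner s v y).cells) (i := s) (j := v) (k := y) (U := {w | H.Region s v y w})
    (by rw [orient_swap]; intro h0; linarith) hsep hm.sep (Or.inr hyT)
    (fun P hP w hw => hWR w (hcellsW P hP w hw))
    (fun P hP w hw => by
      rcases hcellsI P hP w hw with rfl | rfl | rfl | hr
      · right; simp
      · right; simp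
      · right; simp
      · exact Or.inl hr)
    hms hmv hmy
    (fun w hw => hmin w ⟨hw.1, Or.inr hw⟩)
    (fun w hw => Or.inl ⟨w, ⟨hw.1, Or.inr hw⟩, rfl⟩)
    (Or.inr ⟨s, v, ⟨h.sv, hi (by simp), hi (by simp)⟩, rfl⟩)
    (Or.inr ⟨v, y, ⟨hvy, hi (by simp), hi (by simp)⟩, rfl⟩)
    (Or.inr ⟨s, y, ⟨hsy, hi (by simp), hi (by simp)⟩, Set.pair_comm _ _⟩)
    (by
      rintro P (hP | hP) hsub
      · exact absurd hsub (not_triple_subset_cell hsv sy vy hP)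
      · obtain ⟨y', hy', rfl⟩ := h𝒯 P hP
        rcases hsub (show y ∈ ({s, v, y} : Set V) by simp) with h1 | h1 | h1
        · exact absurd h1.symm sy
        · exact absurd h1.symm vy
        · rw [h1])
    (n := n') hn'R hn'N
  have cellsplit : ∀ P ∈ (H.restrict (W ∪ {w | H.Region s v y w})).cells,
      P ∈ (((H.restrict W).cells ∪ 𝒯) \ {{s, v, y}}) ∪ (H.inner s v y).cells := by
    have hold : ∀ P ∈ (H.restrict W).cells, P ∈ ((H.restrict W).cells ∪ 𝒯) \ {{s, v, y}} := by
      intro P hP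
      refine ⟨Or.inl hP, ?_⟩
      rintro rfl
      exact not_triple_subset_cell hsv sy vy hP subset_rfl
    rintro P (⟨a, ⟨haS, ha⟩, rfl⟩ | ⟨a, b, hab, rfl⟩)
    · rcases ha with ha | ha
      · exact Or.inl (hold _ (Or.inl ⟨a, ⟨haS, ha⟩, rfl⟩))
      · exact Or.inr (Or.inl ⟨a, ⟨haS, Or.inr ha⟩, rfl⟩)
    · rcases split hab with h1 | h1
      · exact Or.inl (hold _ (Or.inr ⟨a, b, h1, rfl⟩))
      · exact Or.inr (Or.inr ⟨a, b, h1, rfl⟩)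
  have cellsplit' : ∀ P ∈ (H.restrict (W ∪ {w | H.Region s v y w})).cells ∪
      {T ∈ 𝒯 | ∀ y, H.DupL s v y → T ≠ {s, v, y}},
      P ∈ (((H.restrict W).cells ∪ 𝒯) \ {{s, v, y}}) ∪ (H.inner s v y).cells := by
    rintro P (hP | hP)
    · exact cellsplit P hP
    · exact Or.inl ⟨Or.inr hP.1, hP.2 y hy⟩
  have up' : ∀ {a b}, (H.restrict (W ∪ {w | H.Region s v y w})).A a b →
      (n' a).2 < (n' b).2 := by
    intro a b hab
    rcases split hab with h1 | h1
    · rw [hn'W a h1.2.1, hn'W b h1.2.2]; exact hd.up h1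
    · rw [hn'm a (hinS (hiV.tail_mem h1)), hn'm b (hinS (hiV.head_mem h1))]; exact hm.up h1
  refine ⟨n', ⟨up', fun P hP Q hQ => sepU P (cellsplit P hP) Q (cellsplit Q hQ), ?_, ?_⟩,
    fun P hP Q hQ => sepU P (cellsplit' P hP) Q (cellsplit' Q hQ), hn'W, ?_⟩
  · -- order at `s`
    intro a b ha hb hlt
    have hyF : (H.restrict W).A s y := hA hsy hsW hyW
    have hvF : (H.restrict W).A s v := hA h.sv hsW hvW
    have hyG : (H.inner s v y).A s y := ⟨hsy, hi (by simp), hi (by simp)⟩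
    have hvG : (H.inner s v y).A s v := ⟨h.sv, hi (by simp), hi (by simp)⟩
    have hAall : ∀ c ∈ {c | (H.restrict W).A s c} ∪ {c | (H.inner s v y).A s c},
        H.A s c ∧ (n' s).2 < (n' c).2 := by
      rintro c (hc | hc)
      · exact ⟨hc.1, by rw [hs', hn'W c hc.2.2]; exact hd.up hc⟩
      · refine ⟨hc.1, ?_⟩
        rw [hn'm s (by simp), hn'm c (hinS (hiV.head_mem hc))]; exact hm.up hc
    -- At s the inner edges fill the interval from s → y to s → v, and no old edge lies strictly
    -- between these two, since its head would be in the region.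
    refine glue_order (x := fun c => H.x s c)
      (lt := fun a b => orient (n' s) (n' a) (n' b) < 0)
      (F := {c | (H.restrict W).A s c}) (G := {c | (H.inner s v y).A s c}) (p := y) (q := v)
      hyF hvF hyG hvG ?_ ?_ ?_ ?_ ?_ ?_ a (split ha) b (split hb) hlt
    · intro c hc e he hce
      by_contra hne
      exact h.valid.x_ne (hAall c hc).1 (hAall e he).1 hne hce
    · intro c hc e he g hg h1 h2
      exact orient_neg_trans (hAall c hc).2 (hAall e he).2 (hAall g hg).2 h1 h2
    · intro c hc
      by_contra! hcon
      have hcv : c ≠ v := by rintro rfl; exact lt_irrefl _ hcon.2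
      have hcy : c ≠ y := by rintro rfl; exact lt_irrefl _ hcon.1
      rcases h.side hc.1 hcv with h1 | h1
      · exact hWR c hc.2.2 (h.region_of_s hy hc.1 hcy hcon.1.le h1)
      · have := hcon.2; omega
    · intro c hc
      rcases hinS (hiV.head_mem hc) with rfl | rfl | rfl | hr
      · exact (h.not_to_s hc.1).elim
      · exact ⟨by omega, le_rfl⟩
      · exact ⟨le_rfl, by omega⟩
      · have h1 := h.valid.head_l hc.1
        have h2 := h.valid.head_r hc.1
        obtain ⟨-, r1, r2, r3, r4⟩ := hr
        have h3 := h.valid.tail_r hvy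
        have hcv : c ≠ v := by rintro rfl; exact lt_irrefl _ r1
        rcases h.side hc.1 hcv with h4 | h4
        · exact ⟨by omega, by omega⟩
        · omega
    · intro c hc e he hlt
      rw [hs', hn'W c hc.2.2, hn'W e he.2.2]
      exact hd.tail_order hc he hlt
    · intro c hc e he hlt
      rw [hn'm s (by simp), hn'm c (hinS (hiV.head_mem hc)), hn'm e (hinS (hiV.head_mem he))]
      exact hm.tail_order hc he hlt
  · -- order at `z`
    intro a b ha hb hlt
    -- The region contributes edges at z only if it is closed by z itself. In that case they fill
    -- the interval from s → z to v → z.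
    by_cases hzy : z = y
    · subst hzy
      have hsF : (H.restrict W).A s z := hA hsy hsW hzW
      have hvF : (H.restrict W).A v z := hA hvy hvW hzW
      have hsG : (H.inner s v z).A s z := ⟨hsy, hi (by simp), hi (by simp)⟩
      have hvG : (H.inner s v z).A v z := ⟨hvy, hi (by simp), hi (by simp)⟩
      have hvzl := h.valid.tail_l hvy
      have hz' := hn'W z hzW
      have hAall : ∀ c ∈ {c | (H.restrict W).A c z} ∪ {c | (H.inner s v z).A c z},
          H.A c z ∧ (n' c).2 < (n' z).2 := by
        rintro c (hc | hc)
        · exact ⟨hc.1, by rw [hz', hn'W c hc.2.1]; exact hd.up hc⟩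
        · refine ⟨hc.1, ?_⟩
          rw [hn'm z (by simp), hn'm c (hinS (hiV.tail_mem hc))]; exact hm.up hc
      refine glue_order (x := fun c => H.x c z)
        (lt := fun a b => 0 < orient (n' z) (n' a) (n' b))
        (F := {c | (H.restrict W).A c z}) (G := {c | (H.inner s v z).A c z}) (p := s) (q := v)
        hsF hvF hsG hvG ?_ ?_ ?_ ?_ ?_ ?_ a (split ha) b (split hb) hlt
      · intro c hc e he hce
        by_contra hne
        exact h.valid.flip.x_ne (a := z) (hAall c hc).1 (hAall e he).1 hne hce
      · intro c hc e he g hg h1 h2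
        exact orient_pos_trans (hAall c hc).2 (hAall e he).2 (hAall g hg).2 h1 h2
      · intro c hc
        by_contra! hcon
        have hcv : c ≠ v := by rintro rfl; exact lt_irrefl _ hcon.2
        have hcs : c ≠ s := by rintro rfl; exact lt_irrefl _ hcon.1
        have hcS := h.valid.tail_mem hc.1
        have h1 := h.low c hcS hcs hcv
        have h2 := h.valid.up hc.1
        have h3 := h.valid.tail_l hc.1
        have h4 := h.valid.tail_r hc.1
        have p1 := h.valid.pass hvy hcS h1 h2
        have p2 := h.valid.pass hsy hcS (h.lev_sv.trans h1) h2
        have c1 := hcon.1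
        have c2 := hcon.2
        exact hWR c hc.2.1 ⟨hcS, h1, h2, by omega, by omega⟩
      · intro c hc
        have h1 := h.valid.tail_l hc.1
        have h2 := h.valid.tail_r hc.1
        rcases hinS (hiV.tail_mem hc) with rfl | rfl | rfl | hr
        · exact ⟨le_rfl, by omega⟩
        · exact ⟨by omega, le_rfl⟩
        · exact absurd (h.valid.up hc.1) (lt_irrefl _)
        · obtain ⟨-, r1, r2, r3, r4⟩ := hr
          exact ⟨by omega, by omega⟩
      · intro c hc e he hlt
        rw [hz', hn'W c hc.2.1, hn'W e he.2.1]
        exact hd.head_order hc he hlt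
      · intro c hc e he hlt
        rw [hn'm z (by simp), hn'm c (hinS (hiV.tail_mem hc)), hn'm e (hinS (hiV.tail_mem he))]
        exact hm.head_order hc he hlt
    · have old : ∀ {c}, (H.restrict (W ∪ {w | H.Region s v y w})).A c z →
          (H.restrict W).A c z := by
        intro c hc
        refine ⟨hc.1, ?_, hzW⟩
        refine hc.2.1.resolve_right fun hr => ?_
        rcases h.region_head hy hr hc.1 with h1 | h1
        · exact hzy h1
        · exact hWR z hzW h1
      rw [hn'W z hzW, hn'W a (old ha).2.1, hn'W b (old hb).2.1]
      exact hd.head_order (old ha) (old hb) hlt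
  · rintro w (hw | hw)
    · rw [hn'W w hw]; exact hin w hw
    · rw [hn'R w hw]
      exact InTriangle.trans (hin s hsW) (hin v hvW) (hin y hyW) (hmin w ⟨hw.1, Or.inr hw⟩)

/-! ### The induction -/

theorem ncard_inner_lt [Finite V] {y w : V} (hw : w ∈ H.S) (hws : w ≠ s)
    (hwv : w ≠ v) (hwy : w ≠ y) (hwr : ¬ H.Region s v y w) :
    (H.inner s v y).S.ncard < H.S.ncard := by
  refine Set.ncard_lt_ncard ?_ (Set.toFinite _)
  refine ⟨fun a ha => ha.1, fun hsub => ?_⟩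
  obtain ⟨-, (h1 | h1 | h1) | h1⟩ := hsub hw
  exacts [hws h1, hwv h1, hwy h1, hwr h1]

theorem drawable_of_low [Finite V] (h : H.Low s v) (hF : H.Framed s u z) (hvu : v ≠ u)
    (hvz : v ≠ z)
    (IH : ∀ (H' : Rep V) (s' u' z' : V), H'.Valid → H'.Framed s' u' z' →
      H'.S.ncard < H.S.ncard → H'.Drawable s' u' z') : H.Drawable s u z := by
  classical
  intro p q t hpq hqt ho
  have hcs := core_s h hF hvu hvz
  have hcv := core_v h hF hvu hvz
  have hcu := core_u h hF hvu hvz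
  have hcz := core_z h hF hvu hvz
  have hlr := h.valid.lr v h.v_mem
  have hus : u ≠ s := by rintro rfl; exact lt_irrefl _ (h.valid.up hF.su)
  have hzs : z ≠ s := by rintro rfl; exact lt_irrefl _ (h.valid.up hF.sz)
  have hcard : (H.contract s v).S.ncard < H.S.ncard := by
    refine Set.ncard_lt_ncard ?_ (Set.toFinite _)
    exact ⟨fun a ha => ha.1.1, fun hsub => (hsub h.v_mem).2 rfl⟩
  obtain ⟨pos, hd, hps, hpu, hpz, hin⟩ := IH _ s u z (contract_valid h hF hvu hvz)
    (contract_framed h hF hvu hvz) hcard p q t hpq hqt ho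
  obtain ⟨E, hE, hEin⟩ := exists_placement h hF hvu hvz hd hin
  let n : V → ℚ × ℚ := Function.update pos v E
  have hnv : n v = E := Function.update_self _ _ _
  have hn : ∀ w, w ≠ v → n w = pos w := fun w hw => Function.update_of_ne hw _ _
  have hd0 := hE.draws h hF hvu hvz hd hnv hn
  have hsep0 := hE.sep h hF hvu hvz hd hnv hn
  have hin0 : ∀ w ∈ H.core s v, InTriangle p q t (n w) := by
    intro w hw
    by_cases hwv : w = v
    · rw [hwv, hnv]; exact hEin
    · rw [hn w hwv]; exact hin w ⟨hw, hwv⟩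
  have IHL : ∀ y, H.DupL s v y → (H.inner s v y).Drawable s v y := by
    intro y hy
    -- The induction applies because u lies outside every left frame; for the right frames the
    -- missing vertex is z.
    refine IH _ s v y (h.valid.restrict _) (h.inner_framed hy)
      (ncard_inner_lt (w := u) hcu.1 hus (Ne.symm hvu) ?_ fun hr => hcu.2.1 ⟨y, hy, hr⟩)
    rintro rfl
    have h1 := hy.2.2
    have h2 := rv_lt_xsu h hF hvu hvz
    omega
  have IHR : ∀ y, H.mirror.DupL s v y → (H.mirror.inner s v y).Drawable s v y := by
    intro y hy
    refine IH _ s v y (h.mirror.valid.restrict _) (h.mirror.inner_framed hy)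
      (ncard_inner_lt (w := z) hcz.1 hzs (Ne.symm hvz) ?_ fun hr => hcz.2.2 ⟨y, hy, hr⟩)
    rintro rfl
    have h1 : -H.x s z < -H.r v := hy.2.2
    have h2 := xsz_lt_lv h hF hvu hvz
    omega
  obtain ⟨n1, hd1, hsep1, hn1, hin1⟩ := h.exists_fill hd0 hsep0 hcs hcv hcz
    (fun w hw => hw.2.1)
    (fun y hy hyn => by
      have hyc : y ∈ H.core s v := ⟨h.valid.head_mem hy.1, hyn, h.not_inR_of_dupL hy⟩
      exact ⟨hyc, y, hyc, Or.inl hy, rfl⟩)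
    (fun T ⟨y, hy, _, hT⟩ => ⟨y, hy, hT⟩) IHL hin0
  have dne : ∀ {y y'}, H.mirror.DupL s v y → H.DupL s v y' →
      ({s, v, y} : Set V) ≠ {s, v, y'} := by
    intro y y' hy hy' he
    have hys : y ≠ s := by rintro rfl; exact h.not_to_s hy.1
    have hyv : y ≠ v := by rintro rfl; exact lt_irrefl _ (h.mirror.valid.up hy.2.1)
    have hmem : y ∈ ({s, v, y'} : Set V) := he ▸ (by simp)
    rcases hmem with h1 | h1 | h1
    · exact hys h1
    · exact hyv h1
    · have hyy : y = y' := h1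
      subst hyy
      have k1 : -H.x s y < -H.r v := hy.2.2
      have k2 := hy'.2.2
      omega
  -- The right side is the left side of the mirror image. Triangles already filled on the left are
  -- no longer listed.
  obtain ⟨n2, hd2, -, hn2, hin2⟩ := h.mirror.exists_fill (z := z)
    (W := H.core s v ∪ {w | H.InL s v w})
    (𝒯 := {T ∈ H.triangles s v | ∀ y, H.DupL s v y → T ≠ {s, v, y}})
    (n := fun w => (-(n1 w).1, (n1 w).2)) hd1.mirror'
    (fun P hP Q hQ => (hsep1 P hP Q hQ).mirror)
    (Or.inl hcs) (Or.inl hcv) (Or.inl hcz)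
    (by
      rintro w (hw | hw)
      · exact hw.2.2
      · exact fun hw' => h.not_inL_inR hw hw')
    (fun y hy hyn => by
      have hyL : ¬ H.InL s v y := by
        have := h.mirror.not_inR_of_dupL hy
        rwa [mirror_mirror] at this
      have hyc : y ∈ H.core s v := ⟨h.mirror.valid.head_mem hy.1, hyL, hyn⟩
      exact ⟨Or.inl hyc, ⟨y, hyc, Or.inr hy, rfl⟩, fun y' hy' => dne hy hy'⟩)
    (fun T ⟨⟨y, hy, _, hT⟩, _⟩ => ⟨y, Or.inl hy, hT⟩) IHR
    (p := (-p.1, p.2)) (q := (-q.1, q.2)) (t := (-t.1, t.2))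
    (fun w hw => (hin1 w hw).mirror)
  have hall : H.S ⊆ H.core s v ∪ {w | H.InL s v w} ∪ {w | H.mirror.InL s v w} := by
    intro w hw
    by_cases h1 : H.InL s v w
    · exact Or.inl (Or.inr h1)
    · by_cases h2 : H.mirror.InL s v w
      · exact Or.inr h2
      · exact Or.inl (Or.inl ⟨hw, h1, h2⟩)
  have hfix : ∀ w ∈ H.core s v, w ≠ v →
      (fun w => (-(n2 w).1, (n2 w).2) : V → ℚ × ℚ) w = pos w := by
    intro w hw hwv
    have e1 := hn2 w (Or.inl hw)
    have e2 := hn1 w hw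
    simp only [e1, e2, hn w hwv, neg_neg]
  refine ⟨_, Draws.of_restrict h.valid hall (Draws.mirror hd2), ?_, ?_, ?_, ?_⟩
  · exact (hfix s hcs h.s_ne_v).trans hps
  · exact (hfix u hcu (Ne.symm hvu)).trans hpu
  · exact (hfix z hcz (Ne.symm hvz)).trans hpz
  · intro w hw
    simpa using (hin2 w (hall hw)).mirror

open Classical in
/-- Adding the edge from the lowest to the second lowest vertex. -/
noncomputable def addEdge (H : Rep V) (s v : V) : Rep V where
  S := H.S
  A a b := H.A a b ∨ a = s ∧ b = v
  lev := H.lev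
  l := H.l
  r := H.r
  x a b := if a = s ∧ b = v then H.l v else H.x a b

/-- The missing edge s → v can be inserted at the left end of v, as no level lies between the two
bars. A drawing with the extra edge restricts to one without it. -/
theorem drawable_of_second_lowest [Finite V] (hV : H.Valid) (hF : H.Framed s u z)
    (hv : v ∈ H.S) (hvs : v ≠ s) (hlow : ∀ w ∈ H.S, w ≠ s → w ≠ v → H.lev v < H.lev w)
    (hvu : v ≠ u) (hvz : v ≠ z)
    (IH : ∀ (H' : Rep V) (s' u' z' : V), H'.Valid → H'.Framed s' u' z' →
      H'.S.ncard < H.S.ncard → H'.Drawable s' u' z') : H.Drawable s u z := by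
  by_cases hsv : H.A s v
  · exact drawable_of_low ⟨hV, hsv, hF.bot, hlow⟩ hF hvu hvz IH
  have hs := hV.tail_mem hF.sz
  have hlev := hF.bot v hv hvs
  have hlr := hV.lr v hv
  have hus : u ≠ s := by rintro rfl; exact lt_irrefl _ (hV.up hF.su)
  have hx1 := hF.left v hv hvs hvz
  have hx2 := hF.right_below v hv hvs (hlow u (hV.head_mem hF.su) hus (Ne.symm hvu))
  have hx3 := hV.tail_l hF.sz
  have hx4 := hV.tail_r hF.su
  have xold : ∀ {a b}, H.A a b → (H.addEdge s v).x a b = H.x a b := by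
    intro a b hab
    refine if_neg ?_
    rintro ⟨rfl, rfl⟩; exact hsv hab
  have xnew : (H.addEdge s v).x s v = H.l v := if_pos ⟨rfl, rfl⟩
  have hV' : (H.addEdge s v).Valid := by
    constructor
    · exact hV.inj
    · rintro a b (hab | ⟨rfl, rfl⟩)
      · exact hV.tail_mem hab
      · exact hs
    · rintro a b (hab | ⟨rfl, rfl⟩)
      · exact hV.head_mem hab
      · exact hv
    · rintro a b (hab | ⟨rfl, rfl⟩)
      · exact hV.up hab
      · exact hlev
    · exact hV.lr
    · rintro a b (hab | ⟨rfl, rfl⟩)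
      · rw [xold hab]; exact hV.tail_l hab
      · rw [xnew]; show H.l a ≤ _; omega
    · rintro a b (hab | ⟨rfl, rfl⟩)
      · rw [xold hab]; exact hV.tail_r hab
      · rw [xnew]; show _ ≤ H.r a; omega
    · rintro a b (hab | ⟨rfl, rfl⟩)
      · rw [xold hab]; exact hV.head_l hab
      · rw [xnew]; exact le_rfl
    · rintro a b (hab | ⟨rfl, rfl⟩)
      · rw [xold hab]; exact hV.head_r hab
      · rw [xnew]; exact hlr
    · rintro a b w (hab | ⟨rfl, rfl⟩) hw h1 h2
      · rw [xold hab]; exact hV.pass hab hw h1 h2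
      · exfalso
        have h1' : H.lev a < H.lev w := h1
        have h2' : H.lev w < H.lev b := h2
        refine lt_asymm h2' (hlow w hw ?_ ?_)
        · rintro rfl; exact lt_irrefl _ h1'
        · rintro rfl; exact lt_irrefl _ h2'
  have hF' : (H.addEdge s v).Framed s u z := by
    refine ⟨Or.inl hF.sz, Or.inl hF.su, Or.inl hF.uz, hF.bot, hF.top, ?_, ?_, ?_⟩
    · rw [xold hF.sz]; exact hF.left
    · rw [xold hF.su]; exact hF.right_below
    · rw [xold hF.uz]; exact hF.right_above
  have := drawable_of_low (H := H.addEdge s v) ⟨hV', Or.inr ⟨rfl, rfl⟩, hF.bot, hlow⟩ hF' hvu hvz IH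
  intro p q t hpq hqt ho
  obtain ⟨pos, hd, h1⟩ := this p q t hpq hqt ho
  have hc : ∀ P ∈ H.cells, P ∈ (H.addEdge s v).cells := by
    rintro P (⟨a, ha, rfl⟩ | ⟨a, b, hab, rfl⟩)
    · exact Or.inl ⟨a, ha, rfl⟩
    · exact Or.inr ⟨a, b, Or.inl hab, rfl⟩
  refine ⟨pos, ⟨fun hab => hd.up (Or.inl hab), fun P hP Q hQ => hd.sep P (hc P hP) Q (hc Q hQ),
    fun k1 k2 k3 => hd.tail_order (Or.inl k1) (Or.inl k2) (by rwa [xold k1, xold k2]),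
    fun k1 k2 k3 => hd.head_order (Or.inl k1) (Or.inl k2) (by rwa [xold k1, xold k2])⟩, h1⟩

theorem drawable_of_triangle [Finite V] (hV : H.Valid) (hF : H.Framed s u z)
    (hS : ∀ w ∈ H.S, w = s ∨ w = u ∨ w = z) : H.Drawable s u z := by
  classical
  intro p q t hpq hqt ho
  have lsu := hV.up hF.su
  have luz := hV.up hF.uz
  have hus : u ≠ s := by rintro rfl; exact lt_irrefl _ lsu
  have hzu : z ≠ u := by rintro rfl; exact lt_irrefl _ luz
  have hzs : z ≠ s := by rintro rfl; exact lt_asymm lsu luz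
  let pos : V → ℚ × ℚ := fun w => if w = s then p else if w = u then q else t
  have ps : pos s = p := by simp [pos]
  have pu : pos u = q := by simp [pos, hus]
  have pz : pos z = t := by simp [pos, hzs, hzu]
  have hx1 := hF.left u (hV.head_mem hF.su) hus (Ne.symm hzu)
  have hx2 := hV.head_l hF.su
  have hx3 := hV.tail_l hF.uz
  have hno : orient (pos s) (pos u) (pos z) ≠ 0 := by
    rw [ps, pu, pz, orient_swap]; intro h0; linarith
  have hcell : ∀ P ∈ H.cells, P ⊆ {s, u, z} := by
    rintro P (⟨a, ha, rfl⟩ | ⟨a, b, hab, rfl⟩) w hw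
    · rcases hw with rfl; exact hS w ha
    · rcases hw with rfl | rfl
      · exact hS w (hV.tail_mem hab)
      · exact hS w (hV.head_mem hab)
  refine ⟨pos, ⟨?_, fun P hP Q hQ => Sep.of_subset_triple hno (hcell P hP) (hcell Q hQ), ?_, ?_⟩,
    ps, pu, pz, ?_⟩
  · intro a b hab
    have h1 := hV.up hab
    rcases hS a (hV.tail_mem hab) with rfl | rfl | rfl <;>
    rcases hS b (hV.head_mem hab) with rfl | rfl | rfl <;>
    first
    | omega
    | (simp only [ps, pu, pz]; linarith)
  · intro a b ha hb hlt
    have h1 := hV.up ha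
    have h2 := hV.up hb
    rcases hS a (hV.head_mem ha) with rfl | rfl | rfl <;>
    rcases hS b (hV.head_mem hb) with rfl | rfl | rfl <;>
    first
    | omega
    | (rw [ps, pu, pz]; exact ho)
  · intro a b ha hb hlt
    have h1 := hV.up ha
    have h2 := hV.up hb
    rcases hS a (hV.tail_mem ha) with rfl | rfl | rfl <;>
    rcases hS b (hV.tail_mem hb) with rfl | rfl | rfl <;>
    first
    | omega
    | (rw [ps, pu, pz]; simp only [orient] at ho ⊢; linarith)
  · intro w hw
    rcases hS w hw with rfl | rfl | rfl
    · rw [ps]; exact InTriangle.left _ _ _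
    · rw [pu]; exact InTriangle.middle _ _ _
    · rw [pz]; exact InTriangle.right _ _ _

theorem Valid.exists_lowest [Finite V] (hV : H.Valid) {s u : V} (hu : u ∈ H.S) (hus : u ≠ s) :
    ∃ v ∈ H.S, v ≠ s ∧ ∀ w ∈ H.S, w ≠ s → w ≠ v → H.lev v < H.lev w := by
  obtain ⟨v, ⟨hv, hvs⟩, hmin⟩ := Set.exists_min_image {w | w ∈ H.S ∧ w ≠ s} H.lev (Set.toFinite _)
    ⟨u, hu, hus⟩
  refine ⟨v, hv, hvs, fun w hw hws hwv => lt_of_le_of_ne (hmin w ⟨hw, hws⟩) fun he => ?_⟩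
  exact hwv (hV.inj w hw v hv he.symm)

/-- Every framed bar representation can be drawn with straight lines in every triangle. -/
theorem Framed.drawable [Finite V] (hV : H.Valid) (hF : H.Framed s u z) : H.Drawable s u z := by
  induction hc : H.S.ncard using Nat.strong_induction_on generalizing H s u z with
  | _ k ih =>
  have IH : ∀ (H' : Rep V) (s' u' z' : V), H'.Valid → H'.Framed s' u' z' →
      H'.S.ncard < H.S.ncard → H'.Drawable s' u' z' := fun H' s' u' z' h1 h2 h3 =>
    ih _ (hc ▸ h3) h1 h2 rfl
  have lsu := hV.up hF.su
  have luz := hV.up hF.uz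
  have hus : u ≠ s := by rintro rfl; exact lt_irrefl _ lsu
  have huz : u ≠ z := by rintro rfl; exact lt_irrefl _ luz
  have hu := hV.head_mem hF.su
  obtain ⟨v, hv, hvs, hlow⟩ := hV.exists_lowest hu hus
  by_cases hvu : v = u
  -- The frame vertex u itself cannot be contracted, so the second highest vertex is used instead.
  -- If that is u too, only the three corners exist.
  · obtain ⟨v', hv', hvz', hlow'⟩ := hV.flip.exists_lowest (s := z) hu huz
    by_cases hvu' : v' = u
    · refine drawable_of_triangle hV hF fun w hw => ?_
      by_contra! hcon
      subst hvu hvu'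
      have h1 := hlow w hw hcon.1 hcon.2.1
      have h2 : -H.lev v' < -H.lev w := hlow' w hw hcon.2.2 hcon.2.1
      omega
    · refine Drawable.of_flip (drawable_of_second_lowest hV.flip hF.flip hv' hvz' hlow' hvu' ?_ IH)
      rintro rfl
      have h2 : -H.lev v' < -H.lev u := hlow' u hu huz (Ne.symm hvu')
      omega
  · refine drawable_of_second_lowest hV hF hv hvs hlow hvu ?_ IH
    rintro rfl
    have h1 := hlow u hu hus huz
    omega

end Rep

/-! ### Framing a visibility representation -/

/-- The vertices of a graph together with a bottom, a middle and a top vertex. -/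
inductive Augmented (V : Type*)
  | inner (v : V)
  | bot
  | mid
  | top

namespace Augmented

instance [Finite V] : Finite (Augmented V) :=
  Finite.of_injective (β := Option (Option (Option V)))
    (fun a => match a with
      | inner v => some (some (some v))
      | bot => some (some none)
      | mid => some none
      | top => none)
    (by
      intro a b h
      cases a <;> cases b <;> simp_all)

/-- The edges of the graph and the sides of the triangle `bot`, `mid`, `top`. -/
def Adj (G : Digraph V) : Augmented V → Augmented V → Prop
  | inner a, inner b => G.Adj a b
  | bot, mid => True
  | mid, top => True
  | bot, top => True
  | _, _ => False

/-- The bars of a visibility representation, with a frame around them. -/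
def rep {G : Digraph V} (R : VisibilityRepresentation G) (lev : V → ℤ) (B : ℤ) :
    Rep (Augmented V) where
  S := Set.univ
  A := Adj G
  lev
    | inner v => lev v
    | bot => -B - 1
    | mid => -B
    | top => B
  l
    | inner v => (R.box v).left
    -- The bar of `mid` is a single point at abscissa B, where both edges of the right boundary path
    -- run; `bot` and `top` span all abscissas from -B to B.
    | mid => B
    | _ => -B
  r
    | inner v => (R.box v).right
    | _ => B
  x
    | inner a, inner b => (R.tailPt a b).1
    | bot, top => -B
    | _, _ => B

end Augmented

namespace VisibilityRepresentation

variable {G : Digraph V} {R : VisibilityRepresentation G}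

theorem mem_box_iff (B : Box) (p : ℤ × ℤ) :
    toPlane p ∈ B.toSet ↔ (B.left ≤ p.1 ∧ p.1 ≤ B.right) ∧ B.bottom ≤ p.2 ∧ p.2 ≤ B.top := by
  simp only [Box.toSet, toPlane, Set.mem_prod, Set.mem_Icc, Int.cast_le]

theorem tail_mem_box {a b : V} (h : G.Adj a b) : toPlane (R.tailPt a b) ∈ (R.box a).toSet := by
  have hmem := Set.mem_singleton (toPlane (R.tailPt a b))
  rw [← R.attach_tail a b h] at hmem
  exact hmem.2

theorem head_mem_box {a b : V} (h : G.Adj a b) : toPlane (R.headPt a b) ∈ (R.box b).toSet := by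
  have hmem := Set.mem_singleton (toPlane (R.headPt a b))
  rw [← R.attach_head a b h] at hmem
  exact hmem.2

/-- This allows a box to be replaced by a bar at its bottom, even when bottoms tie. If the abscissa
of the edge hit w, the bottom of w would meet the box of a when it is not above the top of a, and
otherwise the edge itself. -/
theorem pass (hR : R.IsVerticalUpward) {a b w : V} (h : G.Adj a b) (hwa : w ≠ a) (hwb : w ≠ b)
    (h1 : (R.box a).bottom ≤ (R.box w).bottom) (h2 : (R.box w).bottom ≤ (R.box b).bottom) :
    (R.tailPt a b).1 < (R.box w).left ∨ (R.box w).right < (R.tailPt a b).1 := by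
  by_contra! hcon
  obtain ⟨hx, hab⟩ := hR a b h
  have ht := (mem_box_iff _ _).1 (tail_mem_box (R := R) h)
  have hh := (mem_box_iff _ _).1 (head_mem_box (R := R) h)
  have hbw := (R.box w).bottom_le_top
  have hw : toPlane ((R.tailPt a b).1, (R.box w).bottom) ∈ (R.box w).toSet :=
    (mem_box_iff _ _).2 ⟨hcon, le_rfl, hbw⟩
  by_cases hle : (R.box w).bottom ≤ (R.box a).top
  · have ha : toPlane ((R.tailPt a b).1, (R.box w).bottom) ∈ (R.box a).toSet :=
      (mem_box_iff _ _).2 ⟨ht.1, h1, hle⟩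
    exact Set.disjoint_left.1 (R.planar.vertex_vertex w a hwa) hw ha
  · refine Set.disjoint_left.1 (R.planar.edge_vertex a b w h hwa hwb) ?_ hw
    have hlt : (R.tailPt a b).2 < (R.headPt a b).2 := by omega
    have e : R.headPt a b = ((R.tailPt a b).1, (R.headPt a b).2) := Prod.ext hx.symm rfl
    have := (mem_vertical_lineSegment_iff (c := (R.tailPt a b).1) hlt
      (toPlane ((R.tailPt a b).1, (R.box w).bottom))).2 ⟨by
        simp only [toPlane]; exact_mod_cast (by omega : (R.tailPt a b).2 ≤ (R.box w).bottom), by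
        simp only [toPlane]; exact_mod_cast (by omega : (R.box w).bottom ≤ (R.headPt a b).2), rfl⟩
    rw [← e] at this
    exact this

theorem exists_framed_rep [Finite V] (hR : R.IsVerticalUpward) : ∃ lev B,
    (Augmented.rep R lev B).Valid ∧
    (Augmented.rep R lev B).Framed Augmented.bot Augmented.mid Augmented.top := by
  obtain ⟨N, ⟨e⟩⟩ := Finite.exists_equiv_fin V
  -- Bottom heights, with ties broken by a numbering of the vertices by 0, ..., N - 1.
  let lev : V → ℤ := fun v => N * (R.box v).bottom + (e v : ℕ)
  have mono : ∀ a b, (R.box a).bottom < (R.box b).bottom → lev a < lev b := by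
    intro a b hab
    have h1 : ((e a : ℕ) : ℤ) < N := by exact_mod_cast (e a).2
    have h2 : (0 : ℤ) ≤ ((e b : ℕ) : ℤ) := by positivity
    have h3 : (0 : ℤ) ≤ N * ((R.box b).bottom - (R.box a).bottom - 1) :=
      mul_nonneg (by positivity) (by omega)
    simp only [lev]
    linarith
  have bot_le : ∀ a b, lev a < lev b → (R.box a).bottom ≤ (R.box b).bottom := by
    intro a b hab
    by_contra hcon
    exact lt_asymm hab (mono b a (not_le.1 hcon))
  have inj : ∀ a b, lev a = lev b → a = b := by
    intro a b hab
    have : (R.box a).bottom = (R.box b).bottom := by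
      rcases lt_trichotomy (R.box a).bottom (R.box b).bottom with h | h | h
      · exact absurd hab (mono a b h).ne
      · exact h
      · exact absurd hab (mono b a h).ne'
    simp only [lev, this] at hab
    have : (e a : ℕ) = e b := by omega
    exact e.injective (Fin.ext this)
  obtain ⟨B0, hB0⟩ := (Set.finite_range
    fun v => |lev v| + |(R.box v).left| + |(R.box v).right|).bddAbove
  have hB : ∀ v, |lev v| + |(R.box v).left| + |(R.box v).right| < |B0| + 1 := fun v =>
    lt_of_le_of_lt (hB0 ⟨v, rfl⟩) (by have := le_abs_self B0; omega)
  set B := |B0| + 1 with hBdef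
  have hBpos : 0 < B := by have := abs_nonneg B0; omega
  have bl : ∀ v, -B < lev v ∧ lev v < B := fun v => by
    have := hB v
    have h1 := abs_nonneg (R.box v).left
    have h2 := abs_nonneg (R.box v).right
    exact abs_lt.1 (by omega)
  have bb : ∀ v, -B < (R.box v).left ∧ (R.box v).right < B := fun v => by
    have := hB v
    have h0 := abs_nonneg (lev v)
    have h1 := abs_nonneg (R.box v).left
    have h2 := abs_nonneg (R.box v).right
    exact ⟨(abs_lt.1 (by omega : |(R.box v).left| < B)).1,
      (abs_lt.1 (by omega : |(R.box v).right| < B)).2⟩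
  have lr : ∀ v, (R.box v).left ≤ (R.box v).right := fun v => (R.box v).left_le_right
  have ht : ∀ {a b}, G.Adj a b →
      (R.box a).left ≤ (R.tailPt a b).1 ∧ (R.tailPt a b).1 ≤ (R.box a).right := fun h =>
    ((mem_box_iff _ _).1 (tail_mem_box (R := R) h)).1
  have hh : ∀ {a b}, G.Adj a b →
      (R.box b).left ≤ (R.tailPt a b).1 ∧ (R.tailPt a b).1 ≤ (R.box b).right := fun {a b} h => by
    rw [(hR a b h).1]
    exact ((mem_box_iff _ _).1 (head_mem_box (R := R) h)).1
  refine ⟨lev, B, ?_, ?_⟩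
  · constructor
    · rintro (a | _ | _ | _) - (b | _ | _ | _) - hab <;> simp only [Augmented.rep] at hab
      · rw [inj a b hab]
      all_goals first
        | rfl
        | omega
        | (have := bl a; omega)
        | (have := bl b; omega)
    · intros; trivial
    · intros; trivial
    · rintro (a | _ | _ | _) (b | _ | _ | _) hab <;> simp only [Augmented.rep, Augmented.Adj] at hab ⊢
      · have h1 := (hR a b hab).2
        have h2 := (R.box a).bottom_le_top
        exact mono a b (by omega)
      all_goals omega
    · rintro (a | _ | _ | _) - <;> simp only [Augmented.rep]
      · exact lr a
      all_goals omega
    · rintro (a | _ | _ | _) (b | _ | _ | _) hab <;> simp only [Augmented.rep, Augmented.Adj] at hab ⊢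
      · exact (ht hab).1
      all_goals omega
    · rintro (a | _ | _ | _) (b | _ | _ | _) hab <;> simp only [Augmented.rep, Augmented.Adj] at hab ⊢
      · exact (ht hab).2
      all_goals omega
    · rintro (a | _ | _ | _) (b | _ | _ | _) hab <;> simp only [Augmented.rep, Augmented.Adj] at hab ⊢
      · exact (hh hab).1
      all_goals omega
    · rintro (a | _ | _ | _) (b | _ | _ | _) hab <;> simp only [Augmented.rep, Augmented.Adj] at hab ⊢
      · exact (hh hab).2
      all_goals omega
    · rintro (a | _ | _ | _) (b | _ | _ | _) (w | _ | _ | _) hab - h1 h2 <;>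
        simp only [Augmented.rep, Augmented.Adj] at hab h1 h2 ⊢
      · refine pass hR hab ?_ ?_ (bot_le a w h1) (bot_le w b h2)
        · rintro rfl; exact lt_irrefl _ h1
        · rintro rfl; exact lt_irrefl _ h2
      all_goals first
        | omega
        | (have := bb w; omega)
        | (have := bl a; have := bl b; omega)
  · refine ⟨trivial, trivial, trivial, ?_, ?_, ?_, ?_, ?_⟩
    · rintro (w | _ | _ | _) - hne <;> simp only [Augmented.rep]
      · have := bl w; omega
      · exact absurd rfl hne
      all_goals omega
    · rintro (w | _ | _ | _) - hne <;> simp only [Augmented.rep]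
      · have := bl w; omega
      · omega
      · omega
      · exact absurd rfl hne
    · rintro (w | _ | _ | _) - hne hne' <;> simp only [Augmented.rep]
      · exact (bb w).1
      · exact absurd rfl hne
      · omega
      · exact absurd rfl hne'
    · rintro (w | _ | _ | _) - hne hlt <;> simp only [Augmented.rep] at hlt ⊢
      · exact (bb w).2
      · exact absurd rfl hne
      all_goals omega
    · rintro (w | _ | _ | _) - hne hlt <;> simp only [Augmented.rep] at hlt ⊢
      · exact (bb w).2
      · omega
      · omega
      · exact absurd rfl hne

end VisibilityRepresentation

/-! ### From rational drawings to the integer grid -/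

theorem exists_common_denominator {ι : Type*} [Finite ι] (f : ι → ℚ) :
    ∃ N : ℕ, 0 < N ∧ ∃ k : ι → ℤ, ∀ i, (k i : ℚ) = N * f i := by
  classical
  have := Fintype.ofFinite ι
  refine ⟨∏ i, (f i).den, Finset.prod_pos fun i _ => (f i).pos, ?_⟩
  have : ∀ i, ∃ m : ℤ, (m : ℚ) = ((∏ i, (f i).den : ℕ) : ℚ) * f i := by
    intro i
    obtain ⟨c, hc⟩ := Finset.dvd_prod_of_mem (fun i => (f i).den) (Finset.mem_univ i)
    refine ⟨c * (f i).num, ?_⟩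
    rw [hc]
    push_cast
    have := Rat.mul_den_eq_num (f i)
    rw [← this]; ring
  choose k hk using this
  exact ⟨k, hk⟩

/-- A planar rational straight-line drawing yields one on the integer grid. -/
theorem exists_straightLineDrawing [Finite V] {G : Digraph V} {pos : V → ℚ × ℚ}
    (up : ∀ a b, G.Adj a b → (pos a).2 < (pos b).2)
    (hvv : ∀ a b, Sep pos {a} {b}) (hev : ∀ a b c, G.Adj a b → Sep pos {a, b} {c})
    (hee : ∀ a b c d, G.Adj a b → G.Adj c d → Sep pos {a, b} {c, d}) :
    ∃ D : StraightLineDrawing G, D.IsUpward := by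
  obtain ⟨N, hN, k, hk⟩ := exists_common_denominator
    (fun i : V × Bool => if i.2 then (pos i.1).1 else (pos i.1).2)
  have hNq : (0 : ℚ) < N := by exact_mod_cast hN
  have hNr : (0 : ℝ) < N := by exact_mod_cast hN
  let P : V → ℤ × ℤ := fun v => (k (v, true), k (v, false))
  have hP1 : ∀ v, ((P v).1 : ℚ) = N * (pos v).1 := fun v => by simpa using hk (v, true)
  have hP2 : ∀ v, ((P v).2 : ℚ) = N * (pos v).2 := fun v => by simpa using hk (v, false)
  have hup : ∀ a b, G.Adj a b → (P a).2 < (P b).2 := by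
    intro a b hab
    have : ((P a).2 : ℚ) < (P b).2 := by
      rw [hP2, hP2]; exact mul_lt_mul_of_pos_left (up a b hab) hNq
    exact_mod_cast this
  -- The functional f transported to the plane scaled by N: its constant term is multiplied by N, so
  -- its values at the vertices are N times the old ones.
  let F : ℚ × ℚ × ℚ → ℝ × ℝ → ℝ := fun f z => f.1 * z.1 + f.2.1 * z.2 + N * f.2.2
  have hF : ∀ f v, F f (toPlane (P v)) = N * (aff f (pos v) : ℚ) := by
    intro f v
    have h1 : ((P v).1 : ℝ) = N * ((pos v).1 : ℚ) := by exact_mod_cast congrArg (Rat.cast (K := ℝ)) (hP1 v)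
    have h2 : ((P v).2 : ℝ) = N * ((pos v).2 : ℚ) := by exact_mod_cast congrArg (Rat.cast (K := ℝ)) (hP2 v)
    simp only [F, toPlane, h1, h2, aff]
    push_cast
    ring
  have hpos : ∀ {f v}, 0 < aff f (pos v) → 0 < F f (toPlane (P v)) := by
    intro f v h; rw [hF]; exact mul_pos hNr (by exact_mod_cast h)
  have hneg : ∀ {f v}, aff f (pos v) < 0 → F f (toPlane (P v)) < 0 := by
    intro f v h; rw [hF]; exact mul_neg_of_pos_of_neg hNr (by exact_mod_cast h)
  have hzero : ∀ {f v}, aff f (pos v) = 0 → F f (toPlane (P v)) = 0 := by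
    intro f v h; rw [hF, h]; simp
  have hseg : ∀ f a b z, z ∈ lineSegment (P a) (P b) → ∃ θ : ℝ, 0 ≤ θ ∧ θ ≤ 1 ∧
      z = (1 - θ) • toPlane (P a) + θ • toPlane (P b) ∧
      F f z = (1 - θ) * F f (toPlane (P a)) + θ * F f (toPlane (P b)) := by
    intro f a b z hz
    rw [lineSegment, segment_eq_image] at hz
    obtain ⟨θ, ⟨h0, h1⟩, rfl⟩ := hz
    refine ⟨θ, h0, h1, rfl, ?_⟩
    simp only [F, Prod.fst_add, Prod.smul_fst, Prod.snd_add, Prod.smul_snd, smul_eq_mul]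
    ring
  have combo : ∀ {θ x y : ℝ}, 0 ≤ θ → θ ≤ 1 → 0 < x → 0 < y → 0 < (1 - θ) * x + θ * y := by
    intro θ x y h0 h1 hx hy
    rcases h0.lt_or_eq with h | rfl
    · have := mul_pos h hy
      have := mul_nonneg (sub_nonneg.2 h1) hx.le
      linarith
    · linarith
  refine ⟨⟨P, ⟨?_, ?_, ?_⟩⟩, hup⟩
  · intro v w hvw
    rw [Set.disjoint_singleton]
    intro he
    obtain ⟨f, hf⟩ := hvv v w
    have h1 := hpos ((hf v).2.1 rfl hvw)
    have h2 := hneg ((hf w).2.2 rfl (Ne.symm hvw))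
    rw [he] at h1
    exact lt_asymm h1 h2
  · intro u v w huv hwu hwv
    rw [Set.disjoint_singleton_right]
    intro hz
    obtain ⟨f, hf⟩ := hev u v w huv
    have h1 := hpos ((hf u).2.1 (by simp) (Ne.symm hwu))
    have h2 := hpos ((hf v).2.1 (by simp) (Ne.symm hwv))
    have h3 := hneg ((hf w).2.2 rfl (by simp [hwu, hwv]))
    obtain ⟨θ, h0, h01, -, hθ⟩ := hseg f u v _ hz
    have := combo h0 h01 h1 h2
    linarith
  · intro u v u' v' huv huv' hne z hz
    obtain ⟨f, hf⟩ := hee u v u' v' huv huv'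
    obtain ⟨θ, h0, h01, hzθ, hθ⟩ := hseg f u v z hz.1
    obtain ⟨η, k0, k01, -, hη⟩ := hseg f u' v' z hz.2
    have sgnP : ∀ w ∈ ({u, v} : Set V), w ∈ ({u', v'} : Set V) ∧ F f (toPlane (P w)) = 0 ∨
        0 < F f (toPlane (P w)) := by
      intro w hw
      by_cases hw' : w ∈ ({u', v'} : Set V)
      · exact Or.inl ⟨hw', hzero ((hf w).1 hw hw')⟩
      · exact Or.inr (hpos ((hf w).2.1 hw hw'))
    have sgnQ : ∀ w ∈ ({u', v'} : Set V), F f (toPlane (P w)) ≤ 0 := by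
      intro w hw
      by_cases hw' : w ∈ ({u, v} : Set V)
      · exact (hzero ((hf w).1 hw' hw)).le
      · exact (hneg ((hf w).2.2 hw hw')).le
    have hz0 : F f z ≤ 0 := by
      rw [hη]
      have := mul_nonneg k0 (neg_nonneg.2 (sgnQ v' (by simp)))
      have := mul_nonneg (sub_nonneg.2 k01) (neg_nonneg.2 (sgnQ u' (by simp)))
      linarith
    simp only [Set.mem_iUnion]
    rcases sgnP u (by simp) with ⟨hu, hu0⟩ | hu <;> rcases sgnP v (by simp) with ⟨hv, hv0⟩ | hv
    -- Both ends of the first edge are ends of the second, so the edges would be equal or opposite;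
    -- opposite edges cannot both go upward.
    · exfalso
      have hup1 := hup u v huv
      have hup2 := hup u' v' huv'
      rcases hu with rfl | rfl <;> rcases hv with rfl | rfl
      · exact lt_irrefl _ hup1
      · exact hne rfl
      · exact lt_asymm hup1 hup2
      · exact lt_irrefl _ hup1
    · refine ⟨u, ⟨by simp, hu⟩, ?_⟩
      rw [hu0, mul_zero, zero_add] at hθ
      rcases h0.lt_or_eq with h | rfl
      · have := mul_pos h hv; linarith
      · rw [hzθ]; simp
    · refine ⟨v, ⟨by simp, hv⟩, ?_⟩
      rw [hv0, mul_zero, add_zero] at hθ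
      rcases h01.lt_or_eq with h | rfl
      · have := mul_pos (sub_pos.2 h) hu; linarith
      · rw [hzθ]; simp
    · have := combo h0 h01 hu hv
      linarith

theorem VisibilityRepresentation.exists_straightLineDrawing [Finite V] {G : Digraph V}
    (R : VisibilityRepresentation G) (hR : R.IsVerticalUpward) :
    ∃ D : StraightLineDrawing G, D.IsUpward := by
  obtain ⟨lev, B, hV, hF⟩ := exists_framed_rep hR
  -- Any upward triangle of the right orientation would serve here.
  obtain ⟨pos, hd, -⟩ := hF.drawable hV (0, 0) (1, 1) (0, 2) (by norm_num) (by norm_num)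
    (by norm_num [orient])
  let n : V → ℚ × ℚ := fun v => pos (Augmented.inner v)
  have pull : ∀ {P Q : Set V}, Sep pos (Augmented.inner '' P) (Augmented.inner '' Q) →
      Sep n P Q := by
    rintro P Q ⟨f, hf⟩
    have inj : Function.Injective (Augmented.inner : V → Augmented V) := fun a b h => by
      cases h; rfl
    refine ⟨f, fun i => ?_⟩
    have := hf (Augmented.inner i)
    rwa [inj.mem_set_image, inj.mem_set_image] at this
  have vcell : ∀ a, Augmented.inner '' ({a} : Set V) ∈ (Augmented.rep R lev B).cells := fun a =>
    Or.inl ⟨Augmented.inner a, trivial, Set.image_singleton⟩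
  have ecell : ∀ a b, G.Adj a b →
      Augmented.inner '' ({a, b} : Set V) ∈ (Augmented.rep R lev B).cells := fun a b h =>
    Or.inr ⟨Augmented.inner a, Augmented.inner b, h, Set.image_pair _ _ _⟩
  exact GraphDrawing.exists_straightLineDrawing (pos := n)
    (fun a b h => hd.up (a := Augmented.inner a) (b := Augmented.inner b) h)
    (fun a b => pull (hd.sep _ (vcell a) _ (vcell b)))
    (fun a b c h => pull (hd.sep _ (ecell a b h) _ (vcell c)))
    (fun a b c d h h' => pull (hd.sep _ (ecell a b h) _ (ecell c d h')))

end GraphDrawing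

theorem mainTheorem7 {V : Type*} [Finite V] (G : Digraph V) (hG : GraphDrawing.IsDAG G) :
    (∃ D : GraphDrawing.StraightLineDrawing G, D.IsUpward) ↔
      ∃ R : GraphDrawing.VisibilityRepresentation G, R.IsVerticalUpward :=
  ⟨fun ⟨D, hD⟩ => D.exists_visibilityRepresentation hD, 
    fun ⟨R, hR⟩ => R.exists_straightLineDrawing hR⟩
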